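/- Let $\Gamma$ be a finite connected metric graph (loops and multiple edges allowed) with edges $e\cong[0,\ell_e]$, $\ell_e>0$, and let $H=-d^2/dx^2$ be the Laplacian on $\Gamma$ with Neumann–Kirchhoff conditions at all vertices: functions $u\in\bigoplus_e H^2(e)$ that are continuous at every vertex and whose outgoing derivatives at every vertex sum to zero. Let $\lambda_1\le\lambda_2\le\dots$ be its eigenvalues, repeated according to multiplicity, and for an eigenvalue $\lambda$ let $n(\lambda)$ be the first index $k\ge 1$ with $\lambda_k=\lambda$. Let $(\lambda,f)$ be an eigenpair of $H$ such that $\lambda>(\pi/\ell_{\min})^2$, where $\ell_{\min}$ is the length of the shortest edge of $\Gamma$, and such that $f$ is real-valued and does not vanish at any vertex of degree larger than two (a loop counts twice in the degree). Let $P_0(f)=\{x\in\Gamma: f(x)=0\}$ be its nodal set, let $\Gamma_0^f$ be the graph obtained by cutting $\Gamma$ at all points of $P_0(f)$, and let $\nu_0(f)$ be the number of connected components of $\Gamma_0^f$ (the nodal domains of $f$). Let $\beta$ denote the first Betti number of a graph. For $\mu\in\mathbb R$, the two-sided Dirichlet-to-Neumann map $\Lambda^f(\mu)$ on $\mathbb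 C^{P_0(f)}$ is defined as follows whenever the boundary value problem below is uniquely solvable for every $\xi$. Regard the points of $P_0(f)$ as vertices of $\Gamma$ (subdividing edges where necessary); for $\xi\in\mathbb C^{P_0(f)}$ let $u^\xi$ be the unique function which is $H^2$ on each edge, satisfies $-u''=\mu u$ on the edges, takes the value $\xi(v)$ at each $v\in P_0(f)$, and satisfies Neumann–Kirchhoff conditions at all other vertices; then $(\Lambda^f(\mu)\xi)(v)$ is minus the sum of the outgoing derivatives of $u^\xi$ at $v$. Let $\operatorname{Pos}$ denote the number of positive eigenvalues, counted with multiplicity. Then $P_0(f)$ is finite, the nodal domains have no cycles, that is, $\beta(\Gamma_0^f)=0$, and for all sufficiently small $\varepsilon>0$ the map $\Lambda^f(\lambda-\varepsilon)$ is well defined and $$n(\lambda)-\nu_0(f)=\beta(\Gamma)-\operatorname{Pos}\Lambda^f(\lambda-\varepsilon).$$ -/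

import Mathlib

open MeasureTheory Set Filter Topology

/-- A metric graph with vertex set `V` and edge set `E` (loops and multiple edges are allowed):
the edge `e` is the interval `[0, len e]`, with `0` glued to `src e` and `len e` to `tgt e`. -/
structure MetricGraph (V : Type*) (E : Type*) where
  src : E → V
  tgt : E → V
  len : E → ℝ
  len_pos : ∀ e, 0 < len e

/-- `w` lies in the Sobolev space `H²(0, L)` (as its continuous representative on `[0, L]`) and its
second derivative is `g`: `w` is the integral of a function which is the integral of `g ∈ L²`. -/
def HasSobolevSecondDeriv (L : ℝ) (w g : ℝ → ℂ) : Prop :=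
  MemLp g 2 (volume.restrict (Icc 0 L)) ∧
    ∃ d : ℝ → ℂ, (∀ x ∈ Icc 0 L, d x = d 0 + ∫ t in (0 : ℝ)..x, g t) ∧
      ∀ x ∈ Icc 0 L, w x = w 0 + ∫ t in (0 : ℝ)..x, d t

/-- The number of positive eigenvalues of an operator, counted with multiplicity. -/
noncomputable def positiveIndex {M : Type*} [AddCommGroup M] [Module ℂ M]
    (T : M →ₗ[ℂ] M) : ℕ :=
  ∑ᶠ t : Ioi (0 : ℝ), Module.finrank ℂ (Module.End.eigenspace T ((t : ℝ) : ℂ))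

namespace MetricGraph

variable {V E : Type*} (Γ : MetricGraph V E)

/-! ### Combinatorics -/

/-- The vertex at an end of an edge: `(e, false)` is the initial end and `(e, true)` is the
terminal end. A loop has two ends at its vertex. -/
def endVertex (h : E × Bool) : V := if h.2 then Γ.tgt h.1 else Γ.src h.1

/-- The edge ends attached to a vertex. -/
def endsAt (v : V) : Set (E × Bool) := {h | Γ.endVertex h = v}

/-- The degree of a vertex; a loop counts twice. -/
noncomputable def degree (v : V) : ℕ := (Γ.endsAt v).ncard

/-- The connected components: the quotient of the vertex set by the equivalence relation
generated by adjacency. -/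
def Components : Type _ := Quot fun v w : V => ∃ e, Γ.src e = v ∧ Γ.tgt e = w

noncomputable def numComponents : ℕ := Nat.card Γ.Components

def IsConnected : Prop := Γ.numComponents = 1

/-- The simplicial boundary map, sending an edge to its terminal minus its initial vertex. -/
noncomputable def boundary : (E →₀ ℚ) →ₗ[ℚ] (V →₀ ℚ) :=
  Finsupp.lsum ℚ fun e => Finsupp.lsingle (Γ.tgt e) - Finsupp.lsingle (Γ.src e)

/-- The first Betti number: the dimension of the space of cycles. -/
noncomputable def betti : ℕ := Module.finrank ℚ (LinearMap.ker Γ.boundary)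

/-- The length of the shortest edge. -/
noncomputable def minLen : ℝ := ⨅ e, Γ.len e

open Classical in
/-- The graph obtained by cutting at the vertices of `B`: each edge end at a vertex of `B` becomes
a separate vertex. -/
noncomputable def cut (B : Set V) :
    MetricGraph ({v : V // v ∉ B} ⊕ {h : E × Bool // Γ.endVertex h ∈ B}) E where
  src e := if h : Γ.endVertex (e, false) ∈ B then .inr ⟨(e, false), h⟩ else .inl ⟨_, h⟩
  tgt e := if h : Γ.endVertex (e, true) ∈ B then .inr ⟨(e, true), h⟩ else .inl ⟨_, h⟩
  len := Γ.len
  len_pos := Γ.len_pos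

/-! ### Subdivision at interior points of edges -/

/-- The points of the edge `e` which are vertices after subdividing at the points of `P e` that
are interior to `e`. -/
def marks (P : E → Set ℝ) (e : E) : Set ℝ := {0, Γ.len e} ∪ (P e ∩ Ioo 0 (Γ.len e))

/-- Vertices of the subdivided graph: the old ones and the interior points in `P`. -/
abbrev SubV (P : E → Set ℝ) : Type _ := V ⊕ {p : E × ℝ // p.2 ∈ P p.1 ∩ Ioo 0 (Γ.len p.1)}

/-- Edges of the subdivided graph: pieces `[a, b]` of an edge `e` between consecutive marks,
recorded as `(e, a, b)`. -/
abbrev SubE (P : E → Set ℝ) : Type _ :=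
  {s : E × ℝ × ℝ // s.2.1 ∈ Γ.marks P s.1 ∧ s.2.2 ∈ Γ.marks P s.1 ∧ s.2.1 < s.2.2 ∧
    ∀ x ∈ Γ.marks P s.1, x ∉ Ioo s.2.1 s.2.2}

open Classical in
/-- The vertex of the subdivided graph sitting at a marked point of an edge. -/
noncomputable def markVertex (P : E → Set ℝ) (e : E) (x : ℝ) (hx : x ∈ Γ.marks P e) :
    Γ.SubV P :=
  if h0 : x = 0 then .inl (Γ.src e)
  else if h1 : x = Γ.len e then .inl (Γ.tgt e)
  else .inr ⟨(e, x), by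
    rcases hx with (h | h) | h
    · exact absurd h h0
    · exact absurd h h1
    · exact h⟩

/-- The metric graph obtained by declaring the interior edge points in `P` to be vertices
(of degree two). -/
noncomputable def subdivide (P : E → Set ℝ) : MetricGraph (Γ.SubV P) (Γ.SubE P) where
  src s := Γ.markVertex P s.1.1 s.1.2.1 s.2.1
  tgt s := Γ.markVertex P s.1.1 s.1.2.2 s.2.2.1
  len s := s.1.2.2 - s.1.2.1
  len_pos s := sub_pos.2 s.2.2.2.1

/-! ### Functions and the Neumann-Kirchhoff Laplacian -/

/-- Complex functions on the disjoint union of the edges. -/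
abbrev Fn : Type _ := (e : E) → Icc (0 : ℝ) (Γ.len e) → ℂ

/-- The restriction to an edge, extended to the real line by constants. -/
noncomputable def onEdge (u : Γ.Fn) (e : E) : ℝ → ℂ := IccExtend (Γ.len_pos e).le (u e)

/-- The coordinate of an edge end in its edge. -/
noncomputable def endPoint (h : E × Bool) : ℝ := if h.2 then Γ.len h.1 else 0

/-- The value of a function at an edge end. -/
noncomputable def endValue (u : Γ.Fn) (h : E × Bool) : ℂ := Γ.onEdge u h.1 (Γ.endPoint h)

/-- The outgoing derivative at an edge end, taken in the direction from the vertex into the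
edge. -/
noncomputable def outDeriv (u : Γ.Fn) (h : E × Bool) : ℂ :=
  (if h.2 then -1 else 1) *
    derivWithin (Γ.onEdge u h.1) (Icc 0 (Γ.len h.1)) (Γ.endPoint h)

/-- `u` belongs to `H²` of every edge and `-u'' = μ u` almost everywhere. -/
def SolvesOnEdges (μ : ℝ) (u : Γ.Fn) : Prop :=
  ∀ e, ∃ g : ℝ → ℂ, HasSobolevSecondDeriv (Γ.len e) (Γ.onEdge u e) g ∧
    ∀ᵐ x ∂volume.restrict (Icc 0 (Γ.len e)), -g x = μ * Γ.onEdge u e x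

/-- The Neumann-Kirchhoff condition at the vertex `v`: continuity and current conservation. -/
def NeumannKirchhoff (u : Γ.Fn) (v : V) : Prop :=
  (∀ h ∈ Γ.endsAt v, ∀ h' ∈ Γ.endsAt v, Γ.endValue u h = Γ.endValue u h') ∧
    ∑ᶠ h ∈ Γ.endsAt v, Γ.outDeriv u h = 0

/-! The solutions of `-u'' = μ u` with these vertex conditions form a vector space. -/

section Linearity

variable {Γ}

theorem sobolev_integrableOn {L : ℝ} {w g : ℝ → ℂ} (hw : HasSobolevSecondDeriv L w g) :
    IntegrableOn g (Icc 0 L) :=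
  hw.1.integrable (by norm_num)

theorem intervalIntegrable_of_mem {L x : ℝ} {g : ℝ → ℂ} (hg : IntegrableOn g (Icc 0 L))
    (hx : x ∈ Icc 0 L) : IntervalIntegrable g volume 0 x := by
  rw [intervalIntegrable_iff, uIoc_of_le hx.1]
  exact hg.mono_set fun y hy => ⟨hy.1.le, hy.2.trans hx.2⟩

theorem continuousOn_of_primitive {L : ℝ} {d g : ℝ → ℂ} (hg : IntegrableOn g (Icc 0 L))
    (hd : ∀ x ∈ Icc 0 L, d x = d 0 + ∫ t in (0 : ℝ)..x, g t) : ContinuousOn d (Icc 0 L) := by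
  rcases le_or_gt 0 L with hL | hL
  · refine ContinuousOn.congr ?_ hd
    have := intervalIntegral.continuousOn_primitive_interval (a := 0) (b := L) (f := g)
      (μ := volume) (by rwa [uIcc_of_le hL])
    rw [uIcc_of_le hL] at this
    exact continuousOn_const.add this
  · simp [Icc_eq_empty hL.not_ge]

theorem sobolev_differentiableWithinAt {L : ℝ} {w g : ℝ → ℂ}
    (hw : HasSobolevSecondDeriv L w g) {x : ℝ} (hx : x ∈ Icc 0 L) :
    DifferentiableWithinAt ℝ w (Icc 0 L) x := by
  obtain ⟨d, hd, hwd⟩ := hw.2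
  have hc := continuousOn_of_primitive (sobolev_integrableOn hw) hd
  have : Fact (x ∈ Icc 0 L) := ⟨hx⟩
  have h := intervalIntegral.integral_hasDerivWithinAt_right (s := Icc 0 L) (t := Icc 0 L)
    (intervalIntegrable_of_mem hc.integrableOn_Icc hx)
    (hc.stronglyMeasurableAtFilter_nhdsWithin measurableSet_Icc x) (hc x hx)
  exact ((h.const_add (w 0)).congr_of_mem hwd hx).differentiableWithinAt

theorem sobolev_add {L : ℝ} {w₁ w₂ g₁ g₂ : ℝ → ℂ} (h₁ : HasSobolevSecondDeriv L w₁ g₁)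
    (h₂ : HasSobolevSecondDeriv L w₂ g₂) :
    HasSobolevSecondDeriv L (w₁ + w₂) (g₁ + g₂) := by
  obtain ⟨d₁, hd₁, hw₁⟩ := h₁.2
  obtain ⟨d₂, hd₂, hw₂⟩ := h₂.2
  have c₁ := (continuousOn_of_primitive (sobolev_integrableOn h₁) hd₁).integrableOn_Icc
    (μ := volume)
  have c₂ := (continuousOn_of_primitive (sobolev_integrableOn h₂) hd₂).integrableOn_Icc
    (μ := volume)
  refine ⟨h₁.1.add h₂.1, d₁ + d₂, fun x hx => ?_, fun x hx => ?_⟩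
  · simp only [Pi.add_apply]
    rw [intervalIntegral.integral_add (intervalIntegrable_of_mem (sobolev_integrableOn h₁) hx)
      (intervalIntegrable_of_mem (sobolev_integrableOn h₂) hx), hd₁ x hx, hd₂ x hx]
    ring
  · simp only [Pi.add_apply]
    rw [intervalIntegral.integral_add (intervalIntegrable_of_mem c₁ hx)
      (intervalIntegrable_of_mem c₂ hx), hw₁ x hx, hw₂ x hx]
    ring

theorem sobolev_smul {L : ℝ} {w g : ℝ → ℂ} (c : ℂ) (h : HasSobolevSecondDeriv L w g) :
    HasSobolevSecondDeriv L (c • w) (c • g) := by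
  obtain ⟨d, hd, hw⟩ := h.2
  refine ⟨h.1.const_smul c, c • d, fun x hx => ?_, fun x hx => ?_⟩
  · simp only [Pi.smul_apply, smul_eq_mul]
    rw [intervalIntegral.integral_const_mul, hd x hx]
    ring
  · simp only [Pi.smul_apply, smul_eq_mul]
    rw [intervalIntegral.integral_const_mul, hw x hx]
    ring

theorem endPoint_mem (h : E × Bool) : Γ.endPoint h ∈ Icc 0 (Γ.len h.1) := by
  have := (Γ.len_pos h.1).le
  unfold endPoint
  split_ifs <;> simp [this]

theorem SolvesOnEdges.add {μ : ℝ} {u w : Γ.Fn} (hu : Γ.SolvesOnEdges μ u)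
    (hw : Γ.SolvesOnEdges μ w) : Γ.SolvesOnEdges μ (u + w) := fun e => by
  obtain ⟨g₁, h₁, a₁⟩ := hu e
  obtain ⟨g₂, h₂, a₂⟩ := hw e
  refine ⟨g₁ + g₂, sobolev_add h₁ h₂, ?_⟩
  filter_upwards [a₁, a₂] with x e₁ e₂
  have : Γ.onEdge (u + w) e x = Γ.onEdge u e x + Γ.onEdge w e x := rfl
  rw [this, Pi.add_apply, neg_add, e₁, e₂]
  ring

theorem SolvesOnEdges.smul {μ : ℝ} {u : Γ.Fn} (c : ℂ) (hu : Γ.SolvesOnEdges μ u) :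
    Γ.SolvesOnEdges μ (c • u) := fun e => by
  obtain ⟨g, h, a⟩ := hu e
  refine ⟨c • g, sobolev_smul c h, ?_⟩
  filter_upwards [a] with x e₁
  have : Γ.onEdge (c • u) e x = c * Γ.onEdge u e x := rfl
  rw [this, Pi.smul_apply, smul_eq_mul, ← mul_neg, e₁]
  ring

theorem SolvesOnEdges.differentiableWithinAt {μ : ℝ} {u : Γ.Fn} (hu : Γ.SolvesOnEdges μ u)
    (h : E × Bool) :
    DifferentiableWithinAt ℝ (Γ.onEdge u h.1) (Icc 0 (Γ.len h.1)) (Γ.endPoint h) := by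
  obtain ⟨g, hg, _⟩ := hu h.1
  exact sobolev_differentiableWithinAt hg (endPoint_mem h)

theorem outDeriv_add {μ : ℝ} {u w : Γ.Fn} (hu : Γ.SolvesOnEdges μ u)
    (hw : Γ.SolvesOnEdges μ w) (h : E × Bool) :
    Γ.outDeriv (u + w) h = Γ.outDeriv u h + Γ.outDeriv w h := by
  have : Γ.onEdge (u + w) h.1 = Γ.onEdge u h.1 + Γ.onEdge w h.1 := rfl
  unfold outDeriv
  rw [this, derivWithin_add (hu.differentiableWithinAt h) (hw.differentiableWithinAt h), mul_add]

theorem outDeriv_smul {μ : ℝ} {u : Γ.Fn} (c : ℂ) (hu : Γ.SolvesOnEdges μ u) (h : E × Bool) :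
    Γ.outDeriv (c • u) h = c * Γ.outDeriv u h := by
  have : Γ.onEdge (c • u) h.1 = c • Γ.onEdge u h.1 := rfl
  unfold outDeriv
  rw [this, derivWithin_const_smul c (hu.differentiableWithinAt h), smul_eq_mul]
  ring

end Linearity

/-- The eigenspace `ker (H - μ)` of the Neumann-Kirchhoff Laplacian `H = -d²/dx²`, whose domain
consists of the `H²` functions satisfying Neumann-Kirchhoff conditions at all vertices. -/
def eigenspace [Finite E] (μ : ℝ) : Submodule ℂ Γ.Fn where
  carrier := {u | Γ.SolvesOnEdges μ u ∧ ∀ v, Γ.NeumannKirchhoff u v}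
  zero_mem' := by
    have hz : ∀ e, Γ.onEdge 0 e = 0 := fun e => rfl
    refine ⟨fun e => ⟨0, ?_, by simp [hz]⟩, fun v => ⟨fun h _ h' _ => rfl, ?_⟩⟩
    · exact ⟨MemLp.zero, 0, by simp, by simp [hz]⟩
    · simp [outDeriv, hz]
  add_mem' := by
    rintro u w ⟨hu, ku⟩ ⟨hw, kw⟩
    refine ⟨hu.add hw, fun v => ⟨fun h hh h' hh' => ?_, ?_⟩⟩
    · exact congrArg₂ (· + ·) ((ku v).1 h hh h' hh') ((kw v).1 h hh h' hh')
    · simp_rw [outDeriv_add hu hw]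
      rw [finsum_mem_add_distrib (toFinite _), (ku v).2, (kw v).2, add_zero]
  smul_mem' := by
    rintro c u ⟨hu, ku⟩
    refine ⟨hu.smul c, fun v => ⟨fun h hh h' hh' => ?_, ?_⟩⟩
    · exact congrArg (c * ·) ((ku v).1 h hh h' hh')
    · simp_rw [outDeriv_smul c hu]
      rw [← mul_finsum_mem, (ku v).2, mul_zero]

/-- `(μ, u)` is an eigenpair of the Neumann-Kirchhoff Laplacian. -/
def IsEigenpair [Finite E] (μ : ℝ) (u : Γ.Fn) : Prop := u ∈ Γ.eigenspace μ ∧ u ≠ 0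

/-- The multiplicity of `μ` as an eigenvalue. -/
noncomputable def mult [Finite E] (μ : ℝ) : ℕ := Module.finrank ℂ (Γ.eigenspace μ)

/-- The number of eigenvalues in `(-∞, μ]`, counted with multiplicity. -/
noncomputable def countLE [Finite E] (μ : ℝ) : ℕ∞ :=
  {p : ℝ × ℕ | p.1 ≤ μ ∧ p.2 < Γ.mult p.1}.encard

/-- The `k`-th entry (`k ≥ 1`) of the list `λ₁ ≤ λ₂ ≤ …` of eigenvalues, repeated according to
multiplicity: the least `μ` such that `(-∞, μ]` contains at least `k` eigenvalues. -/
noncomputable def nthEigenvalue [Finite E] (k : ℕ) : ℝ := sInf {μ : ℝ | (k : ℕ∞) ≤ Γ.countLE μ}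

/-- The first place where `μ` appears in the ordered list of eigenvalues. -/
noncomputable def firstIndex [Finite E] (μ : ℝ) : ℕ := sInf {k | 1 ≤ k ∧ Γ.nthEigenvalue k = μ}

/-! ### The Dirichlet-to-Neumann map -/

/-- `u` solves `-u'' = μ u` with boundary values `ξ` at `B` and Neumann-Kirchhoff conditions at
the other vertices. -/
def SolvesDirichlet (B : Set V) (μ : ℝ) (ξ : B → ℂ) (u : Γ.Fn) : Prop :=
  Γ.SolvesOnEdges μ u ∧ (∀ v : B, ∀ h ∈ Γ.endsAt v, Γ.endValue u h = ξ v) ∧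
    ∀ v ∉ B, Γ.NeumannKirchhoff u v

/-- `Λ` is the two-sided Dirichlet-to-Neumann map at `B` with parameter `μ`; this includes the
unique solvability of the boundary value problem, so there is at most one such `Λ`. -/
def IsDtNMap (B : Set V) (μ : ℝ) (Λ : (B → ℂ) →ₗ[ℂ] (B → ℂ)) : Prop :=
  (∀ ξ, ∃! u, Γ.SolvesDirichlet B μ ξ u) ∧
    ∀ ξ u, Γ.SolvesDirichlet B μ ξ u → ∀ v : B, Λ ξ v = -∑ᶠ h ∈ Γ.endsAt v, Γ.outDeriv u h

/-! ### Nodal points and nodal domains -/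

/-- The function vanishes at the vertex `v`. -/
def VanishesAt (f : Γ.Fn) (v : V) : Prop := ∃ h ∈ Γ.endsAt v, Γ.endValue f h = 0

/-- The zeros of `f` on each edge. -/
def edgeZeros (f : Γ.Fn) (e : E) : Set ℝ := {x | ∃ hx : x ∈ Icc 0 (Γ.len e), f e ⟨x, hx⟩ = 0}

/-- The graph `Γ` with additional vertices of degree two at the nodal points of `f` interior to
edges. -/
noncomputable def nodalSubdivision (f : Γ.Fn) :
    MetricGraph (Γ.SubV (Γ.edgeZeros f)) (Γ.SubE (Γ.edgeZeros f)) :=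
  Γ.subdivide (Γ.edgeZeros f)

/-- The nodal set of `f`, as a set of vertices of the subdivided graph: the vertices of `Γ` where
`f` vanishes and all zeros of `f` interior to edges. -/
def nodalSet (f : Γ.Fn) : Set (Γ.SubV (Γ.edgeZeros f)) :=
  {p | ∀ v, p = .inl v → Γ.VanishesAt f v}

/-- The disjoint union of the nodal domains: the graph obtained by cutting `Γ` at the nodal points
of `f`. -/
noncomputable def nodalGraph (f : Γ.Fn) := (Γ.nodalSubdivision f).cut (Γ.nodalSet f)

/-- The number of nodal domains of `f`. -/
noncomputable def numNodalDomains (f : Γ.Fn) : ℕ := (Γ.nodalGraph f).numComponents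

end MetricGraph

/-! ### Inertia of Hermitian operators on `ι → ℂ` -/

section Inertia

variable {ι M Y : Type*} [Fintype ι] [AddCommGroup M] [Module ℂ M]
  [AddCommGroup Y] [Module ℂ Y]

/-! Declare the nodal points to be vertices and let `vertexOp μ` be the Dirichlet-to-Neumann map on
all vertices of the subdivided graph. A piece between consecutive marks has length at most `π/√λ`
(`nodal_piece_length`), so for `0 ≤ μ < λ` no piece has Dirichlet eigenvalue `μ`. Solutions on the
pieces are then determined by their vertex values, and the kernel of the Hermitian matrix `vertexOp
μ` is the eigenspace of `H` at `μ` (`mult_eq_finrank_ker`, `mult_subdivide`). The family is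
continuous, strictly decreasing in `μ` and nonnegative at `0`; negative eigenvalues can only be born
from kernels. Hence just below `λ` the matrix is nonsingular and has exactly `N = n(λ) - 1` negative
eigenvalues (`negativeIndex_eq_sum_finrank_ker`, `firstIndex_eq`).

The map `Λ` is the Schur complement of this matrix onto the nodal points. Every original edge is
longer than `π/√λ`, so every piece has a nodal end (`nodal_piece_meets`) and the complementary block
is diagonal. The Kirchhoff condition for `f` at a vertex that is not nodal says that its diagonal
entry vanishes at `λ` (`sum_diagCoef_eq_zero`), so by monotonicity the entry is positive below `λ`.
Passing to the Schur complement therefore removes one positive eigenvalue for each such vertex,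
which leaves `Pos Λ = |P₀| - N` (`exists_dtn_counting`).

The rest is Euler characteristic. Since every piece has a nodal end, cutting destroys all cycles;
since nodal points have degree two, cutting adds `|P₀|` vertices. Comparing `Γ` with the cut graph
gives `ν₀ = |P₀| + 1 - β(Γ)` (`betti_add_card`, `card_cut_vertices`, `card_subE`). Substituting
`n(λ) = N + 1` yields the formula. -/

theorem finrank_eigenspace_of_basis (b : Module.Basis ι ℂ M) {T : M →ₗ[ℂ] M} {t : ι → ℂ}
    (hb : ∀ i, T (b i) = t i • b i) (c : ℂ) [DecidablePred fun i => t i = c] :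
    Module.finrank ℂ (Module.End.eigenspace T c) = Fintype.card {i // t i = c} := by
  classical
  have hrepr : ∀ x i, b.repr (T x) i = t i * b.repr x i := by
    intro x i
    conv_lhs => rw [← b.sum_repr x]
    simp only [map_sum, map_smul, hb, Finsupp.coe_finsetSum, Finset.sum_apply, Finsupp.coe_smul,
      Pi.smul_apply, b.repr_self, smul_eq_mul, Finsupp.single_apply]
    simp [mul_comm]
  have hmem : ∀ x, x ∈ Module.End.eigenspace T c ↔ ∀ i, t i ≠ c → b.repr x i = 0 := by
    intro x
    rw [Module.End.mem_eigenspace_iff, ← b.repr.injective.eq_iff, Finsupp.ext_iff]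
    refine forall_congr' fun i => ?_
    rw [hrepr, map_smul, Finsupp.smul_apply, smul_eq_mul, mul_eq_mul_right_iff]
    tauto
  let φ : Module.End.eigenspace T c →ₗ[ℂ] ({i // t i = c} → ℂ) :=
    LinearMap.pi fun i => (b.coord i.1) ∘ₗ (Submodule.subtype _)
  have hφ : Function.Bijective φ := by
    refine ⟨(injective_iff_map_eq_zero φ).2 fun x hx => ?_, fun y => ?_⟩
    · ext
      apply b.repr.injective
      ext i
      by_cases hi : t i = c
      · simpa [φ] using congrFun hx ⟨i, hi⟩
      · simpa using (hmem _).1 x.2 i hi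
    · refine ⟨⟨∑ i : {i // t i = c}, y i • b i.1, (hmem _).2 fun i hi => ?_⟩, ?_⟩
      · simp only [map_sum, map_smul, b.repr_self, Finsupp.coe_finsetSum, Finset.sum_apply,
          Finsupp.coe_smul, Pi.smul_apply, smul_eq_mul]
        refine Finset.sum_eq_zero fun j _ => ?_
        rw [Finsupp.single_eq_of_ne (by rintro rfl; exact hi j.2), mul_zero]
      · ext i
        simp only [φ, LinearMap.pi_apply, LinearMap.comp_apply, Submodule.subtype_apply,
          Module.Basis.coord_apply, map_sum, map_smul, b.repr_self, smul_eq_mul]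
        rw [Finset.sum_eq_single i]
        · simp
        · intro j _ hj
          rw [Finsupp.single_eq_of_ne (by simpa [Subtype.ext_iff] using hj.symm), mul_zero]
        · simp
  rw [(LinearEquiv.ofBijective φ hφ).finrank_eq, Module.finrank_fintype_fun_eq_card]

/-- The `finsum` over all positive reals has finite support, because only values of `t` have a
nonzero eigenspace. Adding up the fibres of `t` over its image recounts the index set. -/
theorem positiveIndex_of_basis (b : Module.Basis ι ℂ M) {T : M →ₗ[ℂ] M} {t : ι → ℝ}
    (hb : ∀ i, T (b i) = (t i : ℂ) • b i) :
    positiveIndex T = Fintype.card {i // 0 < t i} := by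
  classical
  unfold positiveIndex
  have h : ∀ s : Ioi (0 : ℝ), Module.finrank ℂ (Module.End.eigenspace T ((s : ℝ) : ℂ)) =
      (Finset.univ.filter fun i : {i // 0 < t i} => (⟨t i, i.2⟩ : Ioi (0 : ℝ)) = s).card := by
    intro s
    rw [finrank_eigenspace_of_basis b hb, Fintype.card_subtype, eq_comm]
    refine Finset.card_bij (fun i _ => i.1) ?_ (fun i _ j _ h => Subtype.ext h) ?_
    · intro i hi
      have := congrArg Subtype.val (Finset.mem_filter.1 hi).2
      simpa using this
    · intro i hi
      have hi' : t i = s := by simpa using hi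
      exact ⟨⟨i, hi'.symm ▸ s.2⟩, by simp [Subtype.ext_iff, hi'], rfl⟩
  simp_rw [h]
  rw [finsum_eq_sum_of_support_subset (s := Finset.univ.image
    fun i : {i // 0 < t i} => (⟨t i, i.2⟩ : Ioi (0 : ℝ)))]
  · rw [← Finset.card_eq_sum_card_image, Finset.card_univ]
  · intro s hs
    obtain ⟨i, hi⟩ := Finset.card_pos.1 (Nat.pos_of_ne_zero hs)
    simp only [Finset.coe_image, Finset.coe_univ, image_univ, mem_range]
    exact ⟨i, (Finset.mem_filter.1 hi).2⟩

/-- `T` is Hermitian with respect to the standard inner product. -/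
def IsHermOp (T : (ι → ℂ) →ₗ[ℂ] (ι → ℂ)) : Prop :=
  ∀ x y, star x ⬝ᵥ T y = star (T x) ⬝ᵥ y

/-- The quadratic form of an operator. -/
noncomputable def opForm (T : (ι → ℂ) →ₗ[ℂ] (ι → ℂ)) (x : ι → ℂ) : ℝ := (star x ⬝ᵥ T x).re

theorem opForm_neg (T : (ι → ℂ) →ₗ[ℂ] (ι → ℂ)) (x : ι → ℂ) : opForm (-T) x = -opForm T x := by
  simp [opForm]

theorem IsHermOp.neg {T : (ι → ℂ) →ₗ[ℂ] (ι → ℂ)} (hT : IsHermOp T) : IsHermOp (-T) := by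
  intro x y
  simp [hT x y]

/-- The spectral theorem is available on `EuclideanSpace`, so an orthonormal eigenbasis is
transported along `WithLp.linearEquiv`. Parseval diagonalises the form; orthogonality itself is not
needed afterwards. -/
theorem IsHermOp.exists_basis {T : (ι → ℂ) →ₗ[ℂ] (ι → ℂ)} (hT : IsHermOp T) :
    ∃ (b : Module.Basis ι ℂ (ι → ℂ)) (t : ι → ℝ), (∀ i, T (b i) = (t i : ℂ) • b i) ∧
      ∀ x, opForm T x = ∑ i, t i * ‖b.repr x i‖ ^ 2 := by
  classical
  let e := WithLp.linearEquiv 2 ℂ (ι → ℂ)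
  let S : EuclideanSpace ℂ ι →ₗ[ℂ] EuclideanSpace ℂ ι := e.symm.toLinearMap ∘ₗ T ∘ₗ e.toLinearMap
  have hS : S.IsSymmetric := by
    intro x y
    have := hT (e x) (e y)
    rw [dotProduct_comm, dotProduct_comm (star (T (e x)))] at this
    exact this.symm
  have hn : Module.finrank ℂ (EuclideanSpace ℂ ι) = Fintype.card ι := finrank_euclideanSpace
  let σ := (Fintype.equivFin ι).symm
  let B := (hS.eigenvectorBasis hn).reindex σ
  let t : ι → ℝ := fun i => hS.eigenvalues hn (σ.symm i)
  have hB : ∀ i, S (B i) = (t i : ℂ) • B i := fun i => by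
    simp only [B, OrthonormalBasis.reindex_apply]
    exact hS.apply_eigenvectorBasis hn _
  refine ⟨B.toBasis.map e, t, fun i => ?_, fun x => ?_⟩
  · have := congrArg e (hB i)
    simpa [S, e] using this
  · have h1 : opForm T x = RCLike.re (inner ℂ (e.symm x) (S (e.symm x))) := by
      rw [opForm, dotProduct_comm]; rfl
    rw [h1, ← B.sum_inner_mul_inner, map_sum]
    refine Finset.sum_congr rfl fun i _ => ?_
    rw [← hS (B i), hB i, inner_smul_left]
    have h2 : (B.toBasis.map e).repr x i = inner ℂ (B i) (e.symm x) := by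
      simp [B.repr_apply_apply]
    have hz : ∀ (r : ℝ) (z : ℂ),
        (starRingEnd ℂ z * (starRingEnd ℂ (r : ℂ) * z)).re = r * ‖z‖ ^ 2 := fun r z => by
      rw [← Complex.normSq_eq_norm_sq, Complex.normSq_apply]
      simp
      ring
    rw [h2, ← inner_conj_symm (e.symm x)]
    exact hz _ _

theorem IsHermOp.inertia {T : (ι → ℂ) →ₗ[ℂ] (ι → ℂ)} (hT : IsHermOp T) :
    positiveIndex T + positiveIndex (-T) + Module.finrank ℂ (LinearMap.ker T) =
      Fintype.card ι := by
  classical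
  obtain ⟨b, t, hb, -⟩ := hT.exists_basis
  rw [positiveIndex_of_basis b hb, positiveIndex_of_basis (T := -T) (t := fun i => -t i) b
    (fun i => by simp [hb]), ← Module.End.eigenspace_zero, finrank_eigenspace_of_basis b hb]
  simp only [Fintype.card_subtype, Complex.ofReal_eq_zero]
  rw [← Finset.card_union_of_disjoint, ← Finset.card_union_of_disjoint, ← Finset.card_univ]
  · congr 1
    ext i
    simp only [Finset.mem_union, Finset.mem_filter, Finset.mem_univ, true_and, iff_true]
    rcases lt_trichotomy 0 (t i) with h | h | h
    · exact Or.inl (Or.inl h)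
    · exact Or.inr h.symm
    · exact Or.inl (Or.inr (neg_pos.2 h))
  · rw [Finset.disjoint_left]
    intro i hi
    simp only [Finset.mem_union, Finset.mem_filter, Finset.mem_univ, true_and] at hi ⊢
    rintro h
    simp [h] at hi
  · rw [Finset.disjoint_left]
    intro i hi
    simp only [Finset.mem_filter, Finset.mem_univ, true_and] at hi ⊢
    linarith

/-- Common core of the two dimension bounds below: a space on which the coordinates selected by `p`
are faithful embeds into those coordinates. -/
theorem finrank_le_card_of_coords (b : Module.Basis ι ℂ M) (p : ι → Prop) [DecidablePred p]
    (φ : Y →ₗ[ℂ] M) (h : ∀ y, (∀ i, p i → b.repr (φ y) i = 0) → y = 0) :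
    Module.finrank ℂ Y ≤ Fintype.card {i // p i} := by
  let ψ : Y →ₗ[ℂ] ({i // p i} → ℂ) := LinearMap.pi fun i => (b.coord i.1) ∘ₗ φ
  have hψ : Function.Injective ψ := (injective_iff_map_eq_zero ψ).2 fun y hy =>
    h y fun i hi => congrFun hy ⟨i, hi⟩
  simpa using LinearMap.finrank_le_finrank_of_injective hψ

/-- A space on which the form is nonpositive has dimension at most `card ι - positiveIndex`. -/
theorem IsHermOp.finrank_add_positiveIndex_le {T : (ι → ℂ) →ₗ[ℂ] (ι → ℂ)} (hT : IsHermOp T)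
    (φ : Y →ₗ[ℂ] (ι → ℂ)) (hφ : Function.Injective φ) (h : ∀ y, opForm T (φ y) ≤ 0) :
    Module.finrank ℂ Y + positiveIndex T ≤ Fintype.card ι := by
  classical
  obtain ⟨b, t, hb, hQ⟩ := hT.exists_basis
  -- If the coordinates with `t i ≤ 0` vanish, the form is a sum of nonnegative terms. It is also `≤
  -- 0` by hypothesis, so each term is zero and the remaining coordinates vanish too.
  have h1 : Module.finrank ℂ Y ≤ Fintype.card {i // ¬ 0 < t i} := by
    refine finrank_le_card_of_coords b _ φ fun y hy => ?_
    apply hφ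
    rw [map_zero]
    apply b.repr.injective
    have h0 : ∀ i ∈ Finset.univ, 0 ≤ t i * ‖b.repr (φ y) i‖ ^ 2 := fun i _ => by
      by_cases hi : 0 < t i
      · positivity
      · simp [hy i hi]
    have hs := (Finset.sum_eq_zero_iff_of_nonneg h0).1
      (le_antisymm ((hQ _).symm.trans_le (h y)) (Finset.sum_nonneg h0))
    ext i
    by_cases hi : 0 < t i
    · simpa [hi.ne'] using hs i (Finset.mem_univ i)
    · simp [hy i hi]
  rw [positiveIndex_of_basis b hb]
  have := Fintype.card_subtype_compl fun i => 0 < t i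
  have := Fintype.card_subtype_le fun i => 0 < t i
  omega

/-- A space on which the form is positive definite has dimension at most `positiveIndex`. -/
theorem IsHermOp.finrank_le_positiveIndex {T : (ι → ℂ) →ₗ[ℂ] (ι → ℂ)} (hT : IsHermOp T)
    (φ : Y →ₗ[ℂ] (ι → ℂ)) (h : ∀ y ≠ 0, 0 < opForm T (φ y)) :
    Module.finrank ℂ Y ≤ positiveIndex T := by
  classical
  obtain ⟨b, t, hb, hQ⟩ := hT.exists_basis
  rw [positiveIndex_of_basis b hb]
  refine finrank_le_card_of_coords b _ φ fun y hy => ?_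
  by_contra h0
  refine (h y h0).not_ge ((hQ _).trans_le (Finset.sum_nonpos fun i _ => ?_))
  by_cases hi : 0 < t i
  · simp [hy i hi]
  · exact mul_nonpos_of_nonpos_of_nonneg (not_lt.1 hi) (by positivity)

theorem exists_coord_embedding (b : Module.Basis ι ℂ M) (p : ι → Prop) [DecidablePred p] :
    ∃ φ : ({i // p i} → ℂ) →ₗ[ℂ] M,
      ∀ y i, b.repr (φ y) i = if h : p i then y ⟨i, h⟩ else 0 := by
  refine ⟨b.equivFun.symm.toLinearMap ∘ₗ LinearMap.pi fun i =>
    if h : p i then LinearMap.proj ⟨i, h⟩ else 0, fun y i => ?_⟩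
  have : ∀ z : ι → ℂ, b.repr (b.equivFun.symm z) i = z i := fun z => by
    rw [← Module.Basis.equivFun_apply, LinearEquiv.apply_symm_apply]
  simp only [LinearMap.comp_apply, LinearEquiv.coe_coe, this, LinearMap.pi_apply]
  split_ifs <;> simp

/-- The span of the positive eigenvectors attains the bound of `finrank_le_positiveIndex`.
Parametrised by `Fin`, it can be tested against the form of another operator. -/
theorem IsHermOp.exists_positive {T : (ι → ℂ) →ₗ[ℂ] (ι → ℂ)} (hT : IsHermOp T) :
    ∃ φ : (Fin (positiveIndex T) → ℂ) →ₗ[ℂ] (ι → ℂ), ∀ y ≠ 0, 0 < opForm T (φ y) := by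
  classical
  obtain ⟨b, t, hb, hQ⟩ := hT.exists_basis
  obtain ⟨φ, hφ⟩ := exists_coord_embedding b fun i => 0 < t i
  let σ : Fin (positiveIndex T) ≃ {i // 0 < t i} :=
    (finCongr (positiveIndex_of_basis b hb)).trans (Fintype.equivFin _).symm
  let e := LinearEquiv.funCongrLeft ℂ ℂ σ.symm
  refine ⟨φ ∘ₗ e.toLinearMap, fun y hy => ?_⟩
  have hy' : e y ≠ 0 := by simpa using hy
  obtain ⟨j, hj⟩ := Function.ne_iff.1 hy'
  rw [hQ]
  refine Finset.sum_pos' (fun i _ => ?_) ⟨j.1, Finset.mem_univ _, ?_⟩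
  · simp only [LinearMap.comp_apply, hφ]
    split_ifs with h
    · positivity
    · simp
  · simp only [LinearMap.comp_apply, hφ]
    rw [dif_pos j.2]
    have := j.2
    have : 0 < ‖e y j‖ := norm_pos_iff.2 hj
    simp only [LinearEquiv.coe_coe, Subtype.coe_eta]
    positivity

/-- Attains the bound of `finrank_add_positiveIndex_le`: the kernel together with the negative
eigenvectors, so that `m` counts both. -/
theorem IsHermOp.exists_nonpositive {T : (ι → ℂ) →ₗ[ℂ] (ι → ℂ)} (hT : IsHermOp T) :
    ∃ (m : ℕ) (φ : (Fin m → ℂ) →ₗ[ℂ] (ι → ℂ)), m + positiveIndex T = Fintype.card ι ∧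
      Function.Injective φ ∧ ∀ y, opForm T (φ y) ≤ 0 := by
  classical
  obtain ⟨b, t, hb, hQ⟩ := hT.exists_basis
  obtain ⟨φ, hφ⟩ := exists_coord_embedding b fun i => ¬ 0 < t i
  let e := LinearEquiv.funCongrLeft ℂ ℂ (Fintype.equivFin {i // ¬ 0 < t i})
  refine ⟨_, φ ∘ₗ e.toLinearMap, ?_, ?_, fun y => ?_⟩
  · rw [positiveIndex_of_basis b hb]
    have := Fintype.card_subtype_compl fun i => 0 < t i
    have := Fintype.card_subtype_le fun i => 0 < t i
    omega
  · have hinj : Function.Injective φ := (injective_iff_map_eq_zero φ).2 fun y hy => ?_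
    · exact hinj.comp e.injective
    ext i
    have := hφ y i
    rw [hy, dif_pos i.2] at this
    simpa using this.symm
  · rw [hQ]
    refine Finset.sum_nonpos fun i _ => ?_
    simp only [LinearMap.comp_apply, hφ]
    split_ifs with h
    · simp
    · exact mul_nonpos_of_nonpos_of_nonneg (not_lt.1 h) (by positivity)

end Inertia

/-! ### Strictly decreasing families of Hermitian operators -/

section Family

variable {ι X Y : Type*} [Fintype ι] [TopologicalSpace X] [NormedAddCommGroup Y] [NormedSpace ℂ Y]
  [FiniteDimensional ℂ Y]

theorem opForm_smul (T : (ι → ℂ) →ₗ[ℂ] (ι → ℂ)) (c : ℝ) (x : ι → ℂ) :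
    opForm T ((c : ℂ) • x) = c ^ 2 * opForm T x := by
  have h : star ((c : ℂ) • x) = (c : ℂ) • star x := by ext i; simp
  rw [opForm, opForm, map_smul, h, smul_dotProduct, dotProduct_smul, smul_smul, ← sq, smul_eq_mul,
    ← Complex.ofReal_pow, Complex.re_ofReal_mul]

/-- Positive definiteness on a subspace persists under small perturbations. -/
theorem eventually_positive {T : X → (ι → ℂ) →ₗ[ℂ] (ι → ℂ)}
    (hc : Continuous fun z : X × (ι → ℂ) => opForm (T z.1) z.2) (φ : Y →ₗ[ℂ] (ι → ℂ)) {a : X}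
    (h : ∀ y ≠ 0, 0 < opForm (T a) (φ y)) :
    ∀ᶠ s in 𝓝 a, ∀ y ≠ 0, 0 < opForm (T s) (φ y) := by
  have : ProperSpace Y := FiniteDimensional.proper ℂ Y
  have hφ : Continuous φ := φ.continuous_of_finiteDimensional
  have hc' : Continuous fun z : X × Y => opForm (T z.1) (φ z.2) :=
    hc.comp (continuous_fst.prodMk (hφ.comp continuous_snd))
  -- Positivity is uniform near `a` on the compact unit sphere; the quadratic scaling `opForm_smul`
  -- then extends it to every nonzero `y`.
  have key : ∀ᶠ s in 𝓝 a, ∀ y ∈ Metric.sphere (0 : Y) 1, 0 < opForm (T s) (φ y) := by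
    refine (isCompact_sphere (0 : Y) 1).eventually_forall_of_forall_eventually fun y hy => ?_
    have hy0 : y ≠ 0 := by
      rintro rfl
      simp at hy
    exact hc'.continuousAt.eventually (lt_mem_nhds (h y hy0))
  filter_upwards [key] with s hs y hy
  have hn : 0 < ‖y‖ := norm_pos_iff.2 hy
  have h1 := hs (((‖y‖⁻¹ : ℝ) : ℂ) • y) (by simp [norm_smul, hn.ne'])
  rw [map_smul, opForm_smul] at h1
  exact (mul_pos_iff_of_pos_left (by positivity)).1 h1

/-- If a family of Hermitian operators is continuous and strictly decreasing, and starts from a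
positive semidefinite operator, then only finitely many of its members are singular, and the
number of negative eigenvalues counts the kernels passed before. -/
theorem negativeIndex_eq_sum_finrank_ker {a b : ℝ} (hab : a < b)
    {T : ℝ → (ι → ℂ) →ₗ[ℂ] (ι → ℂ)} (hT : ∀ μ ∈ Ico a b, IsHermOp (T μ))
    (hc : Continuous fun z : Ico a b × (ι → ℂ) => opForm (T z.1) z.2)
    (hanti : ∀ μ ∈ Ico a b, ∀ ν ∈ Ico a b, μ < ν → ∀ x ≠ 0, opForm (T ν) x < opForm (T μ) x)
    (h0 : ∀ x, 0 ≤ opForm (T a) x) :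
    ∃ S : Finset ℝ, (∀ μ ∈ Ico a b, LinearMap.ker (T μ) ≠ ⊥ → μ ∈ S) ∧ (∀ μ ∈ S, μ ∈ Ico a b) ∧
      ∀ μ ∈ Ico a b, positiveIndex (-T μ) =
        ∑ ν ∈ S with ν < μ, Module.finrank ℂ (LinearMap.ker (T ν)) := by
  classical
  set k : ℝ → ℕ := fun μ => Module.finrank ℂ (LinearMap.ker (T μ)) with hk
  set n : ℝ → ℕ := fun μ => positiveIndex (-T μ) with hn
  have inert : ∀ μ ∈ Ico a b, positiveIndex (T μ) + n μ + k μ = Fintype.card ι :=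
    fun μ hμ => (hT μ hμ).inertia
  -- A maximal nonpositive subspace of `T μ` has dimension `n μ + k μ`, and by strict decrease `T ν`
  -- is negative definite on it.
  have jump : ∀ μ ∈ Ico a b, ∀ ν ∈ Ico a b, μ < ν → n μ + k μ ≤ n ν := by
    intro μ hμ ν hν hlt
    obtain ⟨m, φ, hm, hinj, hφ⟩ := (hT μ hμ).exists_nonpositive
    have h1 := (hT ν hν).neg.finrank_le_positiveIndex φ fun y hy => by
      rw [opForm_neg, neg_pos]
      exact (hanti μ hμ ν hν hlt _ (by simpa using hinj.ne hy)).trans_le (hφ y)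
    have := inert μ hμ
    simp only [Module.finrank_fin_fun] at h1
    change m ≤ n ν at h1
    omega
  -- Just to the right the positive index cannot drop, so `n ν ≤ n μ + k μ`; `jump` is the reverse
  -- inequality. The whole kernel turns negative.
  have right : ∀ μ : Ico a b, ∀ᶠ ν : Ico a b in 𝓝 μ, (μ : ℝ) < ν → n ν = n μ + k μ := by
    intro μ
    obtain ⟨φ, hφ⟩ := (hT μ μ.2).exists_positive
    filter_upwards [eventually_positive (T := fun s : Ico a b => T s) hc φ hφ] with ν hν hlt
    have h1 := (hT ν ν.2).finrank_le_positiveIndex φ hν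
    simp only [Module.finrank_fin_fun] at h1
    have := inert μ μ.2
    have := inert ν ν.2
    have := jump μ μ.2 ν ν.2 hlt
    omega
  -- Just to the left the negative directions of `T μ` persist, so `n μ ≤ n ν`; `jump` is the
  -- reverse inequality.
  have left : ∀ μ : Ico a b, ∀ᶠ ν : Ico a b in 𝓝 μ, (ν : ℝ) < μ → n ν = n μ := by
    intro μ
    obtain ⟨φ, hφ⟩ := (hT μ μ.2).neg.exists_positive
    have hc' : Continuous fun z : Ico a b × (ι → ℂ) => opForm (-T z.1) z.2 := by
      simp only [opForm_neg]
      exact hc.neg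
    filter_upwards [eventually_positive (T := fun s : Ico a b => -T s) hc' φ hφ] with ν hν hlt
    have h1 := (hT ν ν.2).neg.finrank_le_positiveIndex φ hν
    simp only [Module.finrank_fin_fun] at h1
    have := jump ν ν.2 μ μ.2 hlt
    change n μ ≤ n ν at h1
    omega
  have bound : ∀ F : Finset ℝ, (∀ μ ∈ F, μ ∈ Ico a b) → ∀ ν ∈ Ico a b, (∀ μ ∈ F, μ < ν) →
      ∑ μ ∈ F, k μ ≤ n ν := by
    intro F
    induction F using Finset.induction_on_max with
    | empty => simp
    | insert c F hc ih =>
      intro hF ν hν hlt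
      rw [Finset.sum_insert fun h => lt_irrefl _ (hc c h)]
      have h1 := ih (fun μ hμ => hF μ (Finset.mem_insert_of_mem hμ)) c
        (hF c (Finset.mem_insert_self _ _)) hc
      have h2 := jump c (hF c (Finset.mem_insert_self _ _)) ν hν (hlt c (Finset.mem_insert_self _ _))
      omega
  -- Each singular parameter adds at least one negative direction, so `card ι + 1` of them would
  -- exceed the dimension of the space.
  have hfin : {μ | μ ∈ Ico a b ∧ LinearMap.ker (T μ) ≠ ⊥}.Finite := by
    by_contra hinf
    obtain ⟨F, hF, hcard⟩ := Set.Infinite.exists_subset_card_eq hinf (Fintype.card ι + 1)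
    have hne : F.Nonempty := Finset.card_pos.1 (by omega)
    have hmax := (hF (F.max'_mem hne)).1
    obtain ⟨ν, hν1, hν2⟩ := exists_between hmax.2
    have hν : ν ∈ Ico a b := ⟨hmax.1.trans hν1.le, hν2⟩
    have h1 := bound F (fun μ hμ => (hF hμ).1) ν hν fun μ hμ => (F.le_max' μ hμ).trans_lt hν1
    have h2 : F.card ≤ ∑ μ ∈ F, k μ := by
      rw [Finset.card_eq_sum_ones]
      refine Finset.sum_le_sum fun μ hμ => Nat.one_le_iff_ne_zero.2 fun h => ?_
      exact (hF hμ).2 (Submodule.finrank_eq_zero.1 h)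
    have := inert ν hν
    omega
  refine ⟨hfin.toFinset, fun μ hμ h => hfin.mem_toFinset.2 ⟨hμ, h⟩,
    fun μ hμ => (hfin.mem_toFinset.1 hμ).1, ?_⟩
  set S := hfin.toFinset with hS
  set F : ℝ → ℕ := fun μ => ∑ ν ∈ S with ν < μ, k ν with hF
  have hkS : ∀ μ ∈ Ico a b, μ ∉ S → k μ = 0 := by
    intro μ hμ h
    have : LinearMap.ker (T μ) = ⊥ := by
      by_contra h'
      exact h (hfin.mem_toFinset.2 ⟨hμ, h'⟩)
    simp [hk, this]
  have avoid : ∀ μ : Ico a b, ∀ᶠ ν : Ico a b in 𝓝 μ, ∀ s ∈ S, s ≠ μ → (s < μ ↔ s < ν) := by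
    intro μ
    rw [Filter.eventually_all_finset]
    intro s _
    have hcs : ContinuousAt (Subtype.val : Ico a b → ℝ) μ := continuous_subtype_val.continuousAt
    rcases lt_trichotomy s (μ : ℝ) with h | h | h
    · filter_upwards [hcs.eventually (lt_mem_nhds h)] with ν hν _
      exact ⟨fun _ => hν, fun _ => h⟩
    · exact Eventually.of_forall fun ν hne => absurd h hne
    · filter_upwards [hcs.eventually (gt_mem_nhds h)] with ν hν _
      exact ⟨fun h' => absurd h' h.not_gt, fun h' => absurd h' hν.not_gt⟩
  -- `n` and the kernel count `F` have the same one-sided jumps, so their difference is locally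
  -- constant on a connected interval. Both vanish at `a`.
  have hloc : IsLocallyConstant fun μ : Ico a b => (n μ : ℤ) - F μ := by
    rw [IsLocallyConstant.iff_eventually_eq]
    intro μ
    filter_upwards [right μ, left μ, avoid μ] with ν h1 h2 h3
    rcases lt_trichotomy (ν : ℝ) μ with h | h | h
    · have : F ν = F μ := by
        refine Finset.sum_congr (Finset.filter_congr fun s hs => ?_) fun _ _ => rfl
        by_cases hsμ : s = μ
        · subst hsμ
          exact ⟨fun h' => absurd h' h.not_gt, fun h' => absurd h' (lt_irrefl _)⟩
        · exact (h3 s hs hsμ).symm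
      simp only [h2 h, this]
    · rw [h]
    · have : F ν = F μ + k μ := by
        by_cases hμS : (μ : ℝ) ∈ S
        · have : S.filter (fun s => s < (ν : ℝ)) = insert (μ : ℝ) (S.filter fun s => s < (μ : ℝ)) := by
            ext s
            by_cases hsμ : s = μ
            · subst hsμ
              simp [hμS, h]
            · simp only [Finset.mem_filter, Finset.mem_insert, hsμ, false_or]
              exact and_congr_right fun hs => (h3 s hs hsμ).symm
          simp only [hF, this]
          rw [Finset.sum_insert (by simp), add_comm]
        · rw [hkS μ μ.2 hμS, add_zero]
          refine Finset.sum_congr (Finset.filter_congr fun s hs => ?_) fun _ _ => rfl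
          exact (h3 s hs fun h' => hμS (h' ▸ hs)).symm
      simp only [h1 h, this]
      push_cast
      ring
  have ha : a ∈ Ico a b := ⟨le_rfl, hab⟩
  have hn0 : n a = 0 := by
    have h1 := (hT a ha).neg.finrank_add_positiveIndex_le LinearMap.id Function.injective_id
      fun y => by simpa [opForm_neg] using h0 y
    simp only [Module.finrank_fintype_fun_eq_card] at h1
    change _ + n a ≤ _ at h1
    omega
  have hF0 : F a = 0 := by
    refine Finset.sum_eq_zero fun s hs => ?_
    rw [Finset.mem_filter] at hs
    exact absurd hs.2 (hfin.mem_toFinset.1 hs.1).1.1.not_gt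
  have : PreconnectedSpace (Ico a b) := Subtype.preconnectedSpace isPreconnected_Ico
  intro μ hμ
  have h1 := hloc.apply_eq_of_preconnectedSpace ⟨μ, hμ⟩ ⟨a, ha⟩
  simp only [hn0, hF0] at h1
  change n μ = F μ
  omega

end Family

namespace MetricGraph

/-! ### Euler characteristic -/

section Combinatorics

variable {V E : Type*} (Γ : MetricGraph V E)

instance [Finite V] : Finite Γ.Components := inferInstanceAs (Finite (Quot _))

theorem boundary_single (e : E) (c : ℚ) :
    Γ.boundary (Finsupp.single e c) =
      Finsupp.single (Γ.tgt e) c - Finsupp.single (Γ.src e) c := by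
  simp [boundary]

/-- The Euler characteristic of a finite graph. -/
theorem betti_add_card [Finite V] [Finite E] :
    Γ.betti + Nat.card V = Nat.card E + Γ.numComponents := by
  classical
  have := Fintype.ofFinite V
  have := Fintype.ofFinite E
  have := Fintype.ofFinite Γ.Components
  -- The dual of the boundary map has as its kernel the functions constant along edges, that is, the
  -- functions on the set of components. A map and its dual have the same rank, so two applications
  -- of rank-nullity give the formula.
  let mk : V → Γ.Components := Quot.mk _
  let ψ : (Γ.Components → ℚ) →ₗ[ℚ] Module.Dual ℚ (V →₀ ℚ) :=
    { toFun := fun c => Finsupp.linearCombination ℚ fun v => c (mk v)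
      map_add' := fun c d => by ext v; simp
      map_smul' := fun r c => by ext v; simp }
  have hψ : ∀ c v, ψ c (Finsupp.single v 1) = c (mk v) := fun c v => by simp [ψ]
  have hinj : Function.Injective ψ := fun c d h => by
    ext x
    obtain ⟨v, rfl⟩ := Quot.exists_rep x
    have := congrArg (fun φ => φ (Finsupp.single v 1)) h
    simpa only [hψ] using this
  have hker : LinearMap.ker Γ.boundary.dualMap = LinearMap.range ψ := by
    ext φ
    rw [LinearMap.mem_ker, LinearMap.mem_range]
    constructor
    · intro h
      have hφ : ∀ v w, (∃ e, Γ.src e = v ∧ Γ.tgt e = w) →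
          φ (Finsupp.single v 1) = φ (Finsupp.single w 1) := by
        rintro v w ⟨e, rfl, rfl⟩
        have := congrArg (fun χ => χ (Finsupp.single e 1)) h
        simp only [LinearMap.dualMap_apply, boundary_single, map_sub, LinearMap.zero_apply] at this
        exact (sub_eq_zero.1 this).symm
      refine ⟨Quot.lift (fun v => φ (Finsupp.single v 1)) hφ, ?_⟩
      ext v
      simp [ψ, mk]
    · rintro ⟨c, rfl⟩
      ext e
      simp only [LinearMap.coe_comp, Function.comp_apply, Finsupp.lsingle_apply,
        LinearMap.dualMap_apply, boundary_single, map_sub, hψ, LinearMap.zero_apply, sub_eq_zero]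
      exact congrArg c (Quot.sound ⟨e, rfl, rfl⟩).symm
  have h1 := LinearMap.finrank_range_add_finrank_ker Γ.boundary
  have h2 := LinearMap.finrank_range_add_finrank_ker Γ.boundary.dualMap
  rw [hker, LinearMap.finrank_range_dualMap_eq_finrank_range, LinearMap.finrank_range_of_inj hinj,
    Subspace.dual_finrank_eq] at h2
  simp only [Module.finrank_finsupp_self, Module.finrank_fintype_fun_eq_card] at h1 h2
  rw [betti, numComponents, Nat.card_eq_fintype_card, Nat.card_eq_fintype_card,
    Nat.card_eq_fintype_card]
  omega

/-! ### Cutting at a set of vertices -/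

theorem cut_src_eq_inr_iff {B : Set V} (e : E) (h : {h : E × Bool // Γ.endVertex h ∈ B}) :
    (Γ.cut B).src e = .inr h ↔ (e, false) = h.1 := by
  obtain ⟨h, hh⟩ := h
  simp only [cut]
  split_ifs with h1
  · simp
  · simp only [false_iff]
    rintro rfl
    exact h1 hh

theorem cut_tgt_eq_inr_iff {B : Set V} (e : E) (h : {h : E × Bool // Γ.endVertex h ∈ B}) :
    (Γ.cut B).tgt e = .inr h ↔ (e, true) = h.1 := by
  obtain ⟨h, hh⟩ := h
  simp only [cut]
  split_ifs with h1
  · simp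
  · simp only [false_iff]
    rintro rfl
    exact h1 hh

/-- If every edge meets `B`, cutting at `B` leaves no cycles. -/
theorem betti_cut_eq_zero [Finite E] {B : Set V}
    (hB : ∀ e, Γ.src e ∈ B ∨ Γ.tgt e ∈ B) : (Γ.cut B).betti = 0 := by
  classical
  have := Fintype.ofFinite E
  have hker : LinearMap.ker (Γ.cut B).boundary = ⊥ := by
    rw [LinearMap.ker_eq_bot']
    intro z hz
    ext e
    have hcoeff : ∀ v, ∑ e', ((if (Γ.cut B).tgt e' = v then z e' else 0) -
        (if (Γ.cut B).src e' = v then z e' else 0)) = 0 := by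
      intro v
      have h1 : (Γ.cut B).boundary z v = 0 := by rw [hz]; rfl
      refine Eq.trans ?_ h1
      conv_rhs => rw [← Finsupp.univ_sum_single z]
      rw [map_sum, Finsupp.finsetSum_apply]
      refine Finset.sum_congr rfl fun e' _ => ?_
      rw [boundary_single, Finsupp.sub_apply, Finsupp.single_apply, Finsupp.single_apply]
    rcases hB e with h | h
    -- A vertex created by the cut carries a single edge end, so the coefficient of the boundary
    -- there is `z e` up to sign.
    · have hc := hcoeff (.inr ⟨(e, false), h⟩)
      simp only [cut_src_eq_inr_iff, cut_tgt_eq_inr_iff] at hc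
      simpa using hc
    · have hc := hcoeff (.inr ⟨(e, true), h⟩)
      simp only [cut_src_eq_inr_iff, cut_tgt_eq_inr_iff] at hc
      simpa using hc
  rw [betti, hker, finrank_bot]

/-- Cutting at a set of vertices of degree two adds one vertex for each of them. -/
theorem card_cut_vertices [Finite V] [Finite E] {B : Set V} (hdeg : ∀ v ∈ B, Γ.degree v = 2) :
    Nat.card ({v : V // v ∉ B} ⊕ {h : E × Bool // Γ.endVertex h ∈ B}) =
      Nat.card V + Nat.card B := by
  classical
  have := Fintype.ofFinite V
  have := Fintype.ofFinite E
  have h1 : Nat.card {h : E × Bool // Γ.endVertex h ∈ B} = 2 * Nat.card B := by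
    let σ : {h : E × Bool // Γ.endVertex h ∈ B} ≃ Σ v : B, Γ.endsAt v :=
      { toFun := fun h => ⟨⟨Γ.endVertex h.1, h.2⟩, ⟨h.1, rfl⟩⟩
        invFun := fun p => ⟨p.2.1, by rw [show Γ.endVertex p.2.1 = p.1 from p.2.2]; exact p.1.2⟩
        left_inv := fun h => rfl
        right_inv := by
          rintro ⟨⟨v, hv⟩, ⟨h, hh⟩⟩
          change Γ.endVertex h = v at hh
          subst hh
          rfl }
    rw [Nat.card_congr σ, Nat.card_sigma]
    have h2 : ∀ v : B, Nat.card (Γ.endsAt v) = 2 := fun v => hdeg v v.2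
    rw [Finset.sum_congr rfl fun v _ => h2 v]
    simp [mul_comm]
  have h2 := Nat.card_congr (Equiv.Set.sumCompl B)
  rw [Nat.card_sum] at h2
  have h3 : Nat.card {v : V // v ∉ B} = Nat.card (Bᶜ : Set V) := rfl
  rw [Nat.card_sum, h1, h3]
  omega

end Combinatorics

end MetricGraph

/-! ### The equation `-w'' = μ w` on an interval -/

/-- The solution of `-w'' = μ w` (for `0 ≤ μ`) with `w 0 = 1` and `w' 0 = 0`. -/
noncomputable def cosSol (μ x : ℝ) : ℝ := Real.cos (√μ * x)

/-- The solution of `-w'' = μ w` (for `0 ≤ μ`) with `w 0 = 0` and `w' 0 = 1`. -/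
noncomputable def sinSol (μ x : ℝ) : ℝ := x * Real.sinc (√μ * x)

section FundamentalSolutions

variable {μ ν L x : ℝ}

/-- Link to the sine without dividing by `√μ`: the `sinc` form keeps `μ = 0`, where the monotone
family starts, inside all formulas. -/
theorem sqrt_mul_sinSol (μ x : ℝ) : √μ * sinSol μ x = Real.sin (√μ * x) := by
  unfold sinSol
  rcases eq_or_ne (√μ * x) 0 with h | h
  · rw [← mul_assoc, h]; simp
  · rw [Real.sinc_of_ne_zero h, ← mul_assoc, mul_div_cancel₀ _ h]

@[simp] theorem cosSol_zero_right (μ : ℝ) : cosSol μ 0 = 1 := by simp [cosSol]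

@[simp] theorem sinSol_zero_right (μ : ℝ) : sinSol μ 0 = 0 := by simp [sinSol]

theorem hasDerivAt_cosSol (hμ : 0 ≤ μ) (x : ℝ) : HasDerivAt (cosSol μ) (-μ * sinSol μ x) x := by
  have h := ((hasDerivAt_id x).const_mul √μ).cos
  simp only [id, mul_one, ← sqrt_mul_sinSol] at h
  refine h.congr_deriv ?_
  linear_combination (-sinSol μ x) * Real.mul_self_sqrt hμ

theorem hasDerivAt_sinSol (μ x : ℝ) : HasDerivAt (sinSol μ) (cosSol μ x) x := by
  rcases eq_or_ne √μ 0 with h | h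
  · have : sinSol μ = id := by ext y; simp [sinSol, h]
    rw [this, cosSol, h, zero_mul, Real.cos_zero]
    exact hasDerivAt_id x
  · have : sinSol μ = fun y => Real.sin (√μ * y) / √μ := by
      ext y; rw [← sqrt_mul_sinSol]; field_simp
    rw [this]
    have h1 := (((hasDerivAt_id x).const_mul √μ).sin).div_const √μ
    simp only [id, mul_one] at h1
    exact h1.congr_deriv (mul_div_cancel_right₀ _ h)

theorem cosSol_sq_add (hμ : 0 ≤ μ) (x : ℝ) : cosSol μ x ^ 2 + μ * sinSol μ x ^ 2 = 1 := by
  have h : μ * sinSol μ x ^ 2 = Real.sin (√μ * x) ^ 2 := by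
    rw [← sqrt_mul_sinSol, mul_pow, Real.sq_sqrt hμ]
  rw [h, cosSol, Real.cos_sq_add_sin_sq]

theorem sinc_pos {t : ℝ} (h0 : 0 ≤ t) (hπ : t < Real.pi) : 0 < Real.sinc t := by
  rcases h0.eq_or_lt with rfl | h
  · simp
  · rw [Real.sinc_of_ne_zero h.ne']
    exact div_pos (Real.sin_pos_of_pos_of_lt_pi h hπ) h

theorem sinSol_pos (hx : 0 < x) (h : √μ * x < Real.pi) : 0 < sinSol μ x :=
  mul_pos hx (sinc_pos (by positivity) h)

/-! ### Monotonicity of the edge coefficients in the spectral parameter -/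

theorem mul_tan_lt {s t : ℝ} (hs : 0 ≤ s) (hst : s < t) (ht : t < Real.pi / 2) :
    s * Real.tan s < t * Real.tan t := by
  have h1 : Real.tan s < Real.tan t := Real.tan_lt_tan_of_nonneg_of_lt_pi_div_two hs ht hst
  have h2 : 0 ≤ Real.tan s := Real.tan_nonneg_of_nonneg_of_le_pi_div_two hs (by linarith)
  nlinarith

/-- For `x > 0` the quotient is `x cos x / sin x`, whose derivative has numerator `cos x sin x - x <
0`; `sinc` covers the endpoint `0` by continuity. -/
theorem cos_div_sinc_lt {s t : ℝ} (hs : 0 ≤ s) (hst : s < t) (ht : t < Real.pi / 2) :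
    Real.cos t / Real.sinc t < Real.cos s / Real.sinc s := by
  have hanti : StrictAntiOn (fun x => Real.cos x / Real.sinc x) (Ico 0 (Real.pi / 2)) := by
    refine strictAntiOn_of_deriv_neg (convex_Ico _ _) ?_ fun x hx => ?_
    · refine Real.continuous_cos.continuousOn.div Real.continuous_sinc.continuousOn fun x hx => ?_
      exact (sinc_pos hx.1 (by linarith [hx.2, Real.pi_pos])).ne'
    · rw [interior_Ico] at hx
      have hsin : 0 < Real.sin x :=
        Real.sin_pos_of_pos_of_lt_pi hx.1 (by linarith [hx.2, Real.pi_pos])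
      have hcos : 0 < Real.cos x :=
        Real.cos_pos_of_mem_Ioo ⟨by linarith [hx.1, Real.pi_pos], hx.2⟩
      have heq : (fun x => Real.cos x / Real.sinc x) =ᶠ[𝓝 x]
          fun y => y * Real.cos y / Real.sin y := by
        filter_upwards [lt_mem_nhds hx.1] with y hy
        rw [Real.sinc_of_ne_zero hy.ne', div_div_eq_mul_div, mul_comm]
      have hd := ((hasDerivAt_id x).mul (Real.hasDerivAt_cos x)).div (Real.hasDerivAt_sin x) hsin.ne'
      rw [heq.deriv_eq]
      change deriv (id * Real.cos / Real.sin) x < 0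
      rw [HasDerivAt.deriv hd]
      apply div_neg_of_neg_of_pos _ (by positivity)
      have h1 := Real.sin_lt hx.1
      have h2 := Real.cos_le_one x
      have h3 := Real.sin_sq_add_cos_sq x
      simp only [id, one_mul]
      have h4 : (Real.cos x + x * -Real.sin x) * Real.sin x - x * Real.cos x * Real.cos x =
        Real.cos x * Real.sin x - x * (Real.sin x ^ 2 + Real.cos x ^ 2) := by ring
      change (Real.cos x + x * -Real.sin x) * Real.sin x - x * Real.cos x * Real.cos x < 0
      rw [h4, h3]
      nlinarith
  exact hanti ⟨hs, hst.trans ht⟩ ⟨hs.trans hst.le, ht⟩ hst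

/-- Diagonal coefficient of the Dirichlet-to-Neumann map of an interval of length `L`. -/
noncomputable def diagCoef (L μ : ℝ) : ℝ := cosSol μ L / sinSol μ L

/-- Off-diagonal coefficient (up to sign) of the Dirichlet-to-Neumann map of an interval of
length `L`. -/
noncomputable def offCoef (L μ : ℝ) : ℝ := 1 / sinSol μ L

theorem sinc_two_mul (t : ℝ) : Real.sinc (2 * t) = Real.sinc t * Real.cos t := by
  rcases eq_or_ne t 0 with rfl | h
  · simp
  · rw [Real.sinc_of_ne_zero h, Real.sinc_of_ne_zero (by simpa using h), Real.sin_two_mul]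
    field_simp

/-- These are the eigenvalues of the Dirichlet-to-Neumann matrix of one interval on symmetric and
antisymmetric boundary data. The identities `(cos 2t - 1)/sin 2t = -tan t` and `(cos 2t + 1)/sin 2t
= cot t` make their monotonicity visible. -/
theorem coef_half_angle (hL : 0 < L) (h : √μ * L < Real.pi) :
    diagCoef L μ - offCoef L μ = -(2 / L) * (√μ * L / 2 * Real.tan (√μ * L / 2)) ∧
      diagCoef L μ + offCoef L μ =
        2 / L * (Real.cos (√μ * L / 2) / Real.sinc (√μ * L / 2)) := by
  obtain ⟨t, ht⟩ : ∃ t, t = √μ * L / 2 := ⟨_, rfl⟩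
  have h2 : √μ * L = 2 * t := by rw [ht]; ring
  have h0 : 0 ≤ t := by rw [ht]; positivity
  have hπ : t < Real.pi / 2 := by linarith
  have hc : 0 < Real.cos t := Real.cos_pos_of_mem_Ioo ⟨by linarith [Real.pi_pos], hπ⟩
  have hs : 0 < Real.sinc t := sinc_pos h0 (by linarith [Real.pi_pos])
  have hst : t * Real.sinc t = Real.sin t := by
    rcases eq_or_ne t 0 with rfl | hne
    · simp
    · rw [Real.sinc_of_ne_zero hne]; field_simp
  rw [← ht, diagCoef, offCoef, cosSol, sinSol, h2, sinc_two_mul, Real.tan_eq_sin_div_cos,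
    Real.cos_two_mul]
  have h1 := Real.sin_sq_add_cos_sq t
  constructor
  · rw [← hst] at h1 ⊢
    field_simp
    linarith
  · field_simp
    ring

theorem coef_sub_lt (hL : 0 < L) (h0 : 0 ≤ μ) (h : μ < ν) (hπ : √ν * L < Real.pi) :
    diagCoef L ν - offCoef L ν < diagCoef L μ - offCoef L μ := by
  have hlt : √μ < √ν := Real.sqrt_lt_sqrt h0 h
  have hlt' : √μ * L < √ν * L := by gcongr
  rw [(coef_half_angle hL hπ).1, (coef_half_angle hL (hlt'.trans hπ)).1, neg_mul, neg_mul,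
    neg_lt_neg_iff]
  have := mul_tan_lt (s := √μ * L / 2) (t := √ν * L / 2) (by positivity) (by linarith) (by linarith)
  gcongr

theorem coef_add_lt (hL : 0 < L) (h0 : 0 ≤ μ) (h : μ < ν) (hπ : √ν * L < Real.pi) :
    diagCoef L ν + offCoef L ν < diagCoef L μ + offCoef L μ := by
  have hlt : √μ < √ν := Real.sqrt_lt_sqrt h0 h
  have hlt' : √μ * L < √ν * L := by gcongr
  rw [(coef_half_angle hL hπ).2, (coef_half_angle hL (hlt'.trans hπ)).2]
  have := cos_div_sinc_lt (s := √μ * L / 2) (t := √ν * L / 2) (by positivity) (by linarith)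
    (by linarith)
  gcongr

theorem diagCoef_lt (hL : 0 < L) (h0 : 0 ≤ μ) (h : μ < ν) (hπ : √ν * L < Real.pi) :
    diagCoef L ν < diagCoef L μ := by
  linarith [coef_sub_lt hL h0 h hπ, coef_add_lt hL h0 h hπ]

theorem diagCoef_zero (L : ℝ) : diagCoef L 0 = 1 / L := by simp [diagCoef, cosSol, sinSol]

theorem offCoef_zero (L : ℝ) : offCoef L 0 = 1 / L := by simp [offCoef, sinSol]

theorem continuous_sinSol_left (L : ℝ) : Continuous fun μ => sinSol μ L :=
  continuous_const.mul (Real.continuous_sinc.comp (Real.continuous_sqrt.mul continuous_const))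

theorem continuousOn_diagCoef (hL : 0 < L) :
    ContinuousOn (diagCoef L) {μ | √μ * L < Real.pi} :=
  (Real.continuous_cos.comp (Real.continuous_sqrt.mul continuous_const)).continuousOn.div
    (continuous_sinSol_left L).continuousOn fun _ hμ => (sinSol_pos hL hμ).ne'

theorem continuousOn_offCoef (hL : 0 < L) :
    ContinuousOn (offCoef L) {μ | √μ * L < Real.pi} :=
  continuousOn_const.div (continuous_sinSol_left L).continuousOn
    fun _ hμ => (sinSol_pos hL hμ).ne'

end FundamentalSolutions

/-- `w` is a classical solution of `-w'' = μ w` on `[0, L]` with derivative `d`. -/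
def IsIntervalSol (L μ : ℝ) (w d : ℝ → ℂ) : Prop :=
  ∀ x ∈ Icc 0 L, HasDerivWithinAt w (d x) (Icc 0 L) x ∧
    HasDerivWithinAt d (-(μ : ℂ) * w x) (Icc 0 L) x

/-! ### Classical solutions on an interval -/

namespace IsIntervalSol

variable {L μ : ℝ} {w d : ℝ → ℂ}

theorem congr {w' : ℝ → ℂ} (h : IsIntervalSol L μ w d) (hw : EqOn w' w (Icc 0 L)) :
    IsIntervalSol L μ w' d := fun x hx =>
  ⟨(h x hx).1.congr_of_mem hw hx, by rw [hw hx]; exact (h x hx).2⟩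

theorem hasSobolevSecondDeriv (h : IsIntervalSol L μ w d) :
    HasSobolevSecondDeriv L w fun x => -(μ : ℂ) * w x := by
  have hw : ContinuousOn w (Icc 0 L) := fun x hx => (h x hx).1.continuousWithinAt
  have hd : ContinuousOn d (Icc 0 L) := fun x hx => (h x hx).2.continuousWithinAt
  have hg : ContinuousOn (fun x => -(μ : ℂ) * w x) (Icc 0 L) := continuousOn_const.mul hw
  have key : ∀ {F G : ℝ → ℂ}, ContinuousOn G (Icc 0 L) →
      (∀ x ∈ Icc 0 L, HasDerivWithinAt F (G x) (Icc 0 L) x) →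
      ∀ x ∈ Icc 0 L, F x = F 0 + ∫ t in (0 : ℝ)..x, G t := by
    intro F G hG hF x hx
    have hsub : Icc 0 x ⊆ Icc 0 L := Icc_subset_Icc_right hx.2
    rw [intervalIntegral.integral_eq_sub_of_hasDerivAt_of_le hx.1
      (fun y hy => ((hF y (hsub hy)).continuousWithinAt).mono hsub)
      (fun y hy => (hF y (hsub ⟨hy.1.le, hy.2.le⟩)).hasDerivAt
        (Icc_mem_nhds hy.1 (hy.2.trans_le hx.2)))
      (MetricGraph.intervalIntegrable_of_mem hG.integrableOn_Icc hx)]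
    ring
  refine ⟨?_, d, key hg fun x hx => (h x hx).2, key hd fun x hx => (h x hx).1⟩
  obtain ⟨C, hC⟩ := isCompact_Icc.exists_bound_of_continuousOn hg
  refine MemLp.of_bound (hg.aestronglyMeasurable measurableSet_Icc) C ?_
  filter_upwards [ae_restrict_mem measurableSet_Icc] with x hx using hC x hx

/-- Regularity bootstrap: `w` is a primitive of the continuous `d`, so `g` agrees almost everywhere
with the continuous function `-μ w`, and `d` is itself differentiable. -/
theorem of_hasSobolevSecondDeriv {g : ℝ → ℂ} (h : HasSobolevSecondDeriv L w g)
    (hg : ∀ᵐ x ∂volume.restrict (Icc 0 L), -g x = μ * w x) : ∃ d, IsIntervalSol L μ w d := by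
  obtain ⟨d, hd, hw⟩ := h.2
  have hdc := MetricGraph.continuousOn_of_primitive (MetricGraph.sobolev_integrableOn h) hd
  have hwc := MetricGraph.continuousOn_of_primitive hdc.integrableOn_Icc hw
  have key : ∀ {F G : ℝ → ℂ}, ContinuousOn G (Icc 0 L) →
      (∀ x ∈ Icc 0 L, F x = F 0 + ∫ t in (0 : ℝ)..x, G t) →
      ∀ x ∈ Icc 0 L, HasDerivWithinAt F (G x) (Icc 0 L) x := by
    intro F G hG hF x hx
    have : Fact (x ∈ Icc 0 L) := ⟨hx⟩
    have h := intervalIntegral.integral_hasDerivWithinAt_right (s := Icc 0 L) (t := Icc 0 L)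
      (MetricGraph.intervalIntegrable_of_mem hG.integrableOn_Icc hx)
      (hG.stronglyMeasurableAtFilter_nhdsWithin measurableSet_Icc x) (hG x hx)
    exact (h.const_add (F 0)).congr_of_mem hF hx
  have hd' : ∀ x ∈ Icc 0 L, d x = d 0 + ∫ t in (0 : ℝ)..x, -(μ : ℂ) * w t := by
    intro x hx
    rw [hd x hx]
    congr 1
    refine intervalIntegral.integral_congr_ae_restrict ?_
    have hsub : Set.uIoc 0 x ⊆ Icc 0 L := by
      rw [uIoc_of_le hx.1]
      exact fun y hy => ⟨hy.1.le, hy.2.trans hx.2⟩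
    filter_upwards [ae_restrict_of_ae_restrict_of_subset hsub hg] with y hy
    rw [neg_mul, ← hy, neg_neg]
  exact ⟨d, fun x hx => ⟨key hdc hw x hx, key (continuousOn_const.mul hwc) hd' x hx⟩⟩

/-- The combinations `w cos - d sin` and `μ w sin + d cos` (with the fundamental solutions based at
`x`) have zero derivative. The identity `cos² + μ sin² = 1` inverts this system. Any base point is
allowed, so Cauchy data may be prescribed at either end or at a zero. -/
theorem eq_of_base (hμ : 0 ≤ μ) (h : IsIntervalSol L μ w d) {x y : ℝ} (hx : x ∈ Icc 0 L)
    (hy : y ∈ Icc 0 L) :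
    w y = w x * cosSol μ (y - x) + d x * sinSol μ (y - x) ∧
      d y = -μ * w x * sinSol μ (y - x) + d x * cosSol μ (y - x) := by
  have hc : ∀ z, HasDerivAt (fun z => (cosSol μ (z - x) : ℂ)) (-μ * sinSol μ (z - x)) z := by
    intro z
    have := ((hasDerivAt_cosSol hμ (z - x)).comp_sub_const z x).ofReal_comp
    simpa using this
  have hs : ∀ z, HasDerivAt (fun z => (sinSol μ (z - x) : ℂ)) (cosSol μ (z - x)) z := fun z =>
    ((hasDerivAt_sinSol μ (z - x)).comp_sub_const z x).ofReal_comp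
  have hA : ∀ z ∈ Icc 0 L, HasDerivWithinAt
      (fun z => w z * cosSol μ (z - x) - d z * sinSol μ (z - x)) 0 (Icc 0 L) z := by
    intro z hz
    refine (((h z hz).1.mul (hc z).hasDerivWithinAt).sub
      ((h z hz).2.mul (hs z).hasDerivWithinAt)).congr_deriv ?_
    ring
  have hB : ∀ z ∈ Icc 0 L, HasDerivWithinAt
      (fun z => μ * w z * sinSol μ (z - x) + d z * cosSol μ (z - x)) 0 (Icc 0 L) z := by
    intro z hz
    refine ((((h z hz).1.const_mul (μ : ℂ)).mul (hs z).hasDerivWithinAt).add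
      ((h z hz).2.mul (hc z).hasDerivWithinAt)).congr_deriv ?_
    ring
  have const : ∀ {F : ℝ → ℂ}, (∀ z ∈ Icc 0 L, HasDerivWithinAt F 0 (Icc 0 L) z) → F y = F x := by
    intro F hF
    have h0 : ∀ z ∈ Icc 0 L, F z = F 0 := constant_of_derivWithin_zero
      (fun z hz => (hF z hz).differentiableWithinAt) fun z hz =>
        (hF z ⟨hz.1, hz.2.le⟩).derivWithin
          (uniqueDiffOn_Icc (hz.1.trans_lt hz.2) z ⟨hz.1, hz.2.le⟩)
    rw [h0 y hy, h0 x hx]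
  have h1 := const hA
  have h2 := const hB
  simp only [sub_self, cosSol_zero_right, sinSol_zero_right, Complex.ofReal_one, mul_one,
    Complex.ofReal_zero, mul_zero, sub_zero, zero_add] at h1 h2
  have h3 : (cosSol μ (y - x) : ℂ) ^ 2 + μ * (sinSol μ (y - x) : ℂ) ^ 2 = 1 := by
    exact_mod_cast cosSol_sq_add hμ (y - x)
  constructor
  · linear_combination (-(w y)) * h3 + (cosSol μ (y - x) : ℂ) * h1 + (sinSol μ (y - x) : ℂ) * h2
  · linear_combination (-(d y)) * h3 - μ * (sinSol μ (y - x) : ℂ) * h1 +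
      (cosSol μ (y - x) : ℂ) * h2

theorem of_coeffs (hμ : 0 ≤ μ) (L x : ℝ) (A B : ℂ) :
    IsIntervalSol L μ (fun y => A * cosSol μ (y - x) + B * sinSol μ (y - x))
      (fun y => -μ * A * sinSol μ (y - x) + B * cosSol μ (y - x)) := by
  intro z _
  have hc : HasDerivAt (fun z => (cosSol μ (z - x) : ℂ)) (-μ * sinSol μ (z - x)) z := by
    have := ((hasDerivAt_cosSol hμ (z - x)).comp_sub_const z x).ofReal_comp
    simpa using this
  have hs : HasDerivAt (fun z => (sinSol μ (z - x) : ℂ)) (cosSol μ (z - x)) z :=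
    ((hasDerivAt_sinSol μ (z - x)).comp_sub_const z x).ofReal_comp
  constructor
  · refine ((hc.const_mul A).add (hs.const_mul B)).hasDerivWithinAt.congr_deriv ?_
    ring
  · refine ((hs.const_mul (-μ * A)).add (hc.const_mul B)).hasDerivWithinAt.congr_deriv ?_
    ring

theorem restrict (h : IsIntervalSol L μ w d) {a b : ℝ} (ha : 0 ≤ a) (hb : b ≤ L) :
    IsIntervalSol (b - a) μ (fun x => w (a + x)) (fun x => d (a + x)) := by
  intro x hx
  have hx' : a + x ∈ Icc 0 L := ⟨by linarith [hx.1], by linarith [hx.2]⟩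
  have hmaps : MapsTo (fun y => a + y) (Icc 0 (b - a)) (Icc 0 L) := fun y hy =>
    ⟨by linarith [hy.1], by linarith [hy.2]⟩
  have hadd : HasDerivWithinAt (fun y => a + y) 1 (Icc 0 (b - a)) x :=
    (hasDerivWithinAt_id x _).const_add a
  constructor
  · simpa using! (h _ hx').1.scomp x hadd hmaps
  · simpa using! (h _ hx').2.scomp x hadd hmaps

/-- The derivatives at the ends in terms of the values at the ends. -/
theorem deriv_ends (hμ : 0 ≤ μ) (hL : 0 < L) (hπ : √μ * L < Real.pi) (h : IsIntervalSol L μ w d) :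
    d 0 = offCoef L μ * w L - diagCoef L μ * w 0 ∧
      -d L = offCoef L μ * w 0 - diagCoef L μ * w L := by
  have hs : (sinSol μ L : ℂ) ≠ 0 := by exact_mod_cast (sinSol_pos hL hπ).ne'
  have h0 : (0 : ℝ) ∈ Icc 0 L := ⟨le_rfl, hL.le⟩
  have h1 := h.eq_of_base hμ h0 (y := L) ⟨hL.le, le_rfl⟩
  rw [sub_zero] at h1
  have h3 : (cosSol μ L : ℂ) ^ 2 + μ * (sinSol μ L : ℂ) ^ 2 = 1 := by
    exact_mod_cast cosSol_sq_add hμ L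
  unfold offCoef diagCoef
  push_cast
  constructor
  · field_simp
    rw [h1.1]; ring
  · field_simp
    rw [h1.1, h1.2]
    linear_combination w 0 * h3

/-- For negative `μ` a current argument: the flux of `|w|²` increases along the interval. -/
theorem flux_mono (hμ : μ < 0) (hL : 0 < L) (h : IsIntervalSol L μ w d) :
    (d 0 * starRingEnd ℂ (w 0)).re ≤ (d L * starRingEnd ℂ (w L)).re ∧
      ((d 0 * starRingEnd ℂ (w 0)).re = (d L * starRingEnd ℂ (w L)).re →
        ∀ x ∈ Icc 0 L, w x = 0) := by
  set φ : ℝ → ℝ := fun x => (d x * starRingEnd ℂ (w x)).re with hφ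
  have hder : ∀ x ∈ Icc 0 L,
      HasDerivWithinAt φ (‖d x‖ ^ 2 - μ * ‖w x‖ ^ 2) (Icc 0 L) x := by
    intro x hx
    have h1 := (h x hx).2.mul (h x hx).1.star
    have h2 := Complex.reCLM.hasFDerivAt.comp_hasDerivWithinAt x h1
    refine HasDerivWithinAt.congr_deriv h2 ?_
    simp only [Complex.reCLM_apply, ← Complex.normSq_eq_norm_sq, Complex.normSq_apply]
    simp
    ring
  have hmono : MonotoneOn φ (Icc 0 L) := by
    refine monotoneOn_of_hasDerivWithinAt_nonneg (convex_Icc _ _)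
      (fun x hx => (hder x hx).continuousWithinAt)
      (fun x hx => (hder x (interior_subset hx)).mono interior_subset) fun x _ => ?_
    nlinarith [sq_nonneg ‖d x‖, sq_nonneg ‖w x‖]
  have m0 : (0 : ℝ) ∈ Icc 0 L := ⟨le_rfl, hL.le⟩
  have mL : L ∈ Icc 0 L := ⟨hL.le, le_rfl⟩
  refine ⟨hmono m0 mL hL.le, fun heq x hx => ?_⟩
  -- A monotone function with equal end values is constant, so its derivative `‖d‖² - μ‖w‖²`
  -- vanishes. Both terms are nonnegative because `μ < 0`, which forces `w = 0`.
  have hconst : ∀ y ∈ Icc 0 L, φ y = φ 0 := fun y hy =>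
    le_antisymm ((hmono hy mL hy.2).trans heq.ge) (hmono m0 hy hy.1)
  have h0 : HasDerivWithinAt φ 0 (Icc 0 L) x :=
    (hasDerivWithinAt_const x _ (φ 0)).congr_of_mem hconst hx
  have h1 := (uniqueDiffOn_Icc hL x hx).eq_deriv _ (hder x hx) h0
  have h2 : ‖w x‖ ^ 2 = 0 := by nlinarith [sq_nonneg ‖d x‖, sq_nonneg ‖w x‖]
  simpa using h2

end IsIntervalSol

/-! ### Schur complements -/

section Schur

variable {ι : Type*}

/-- The Schur complement onto the coordinates in `B`. -/
noncomputable def schurOp (T : (ι → ℂ) →ₗ[ℂ] (ι → ℂ)) {B : Set ι}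
    (ext : (B → ℂ) →ₗ[ℂ] (ι → ℂ)) : (B → ℂ) →ₗ[ℂ] (B → ℂ) :=
  LinearMap.funLeft ℂ ℂ Subtype.val ∘ₗ T ∘ₗ ext

theorem schurOp_apply (T : (ι → ℂ) →ₗ[ℂ] (ι → ℂ)) {B : Set ι} (ext : (B → ℂ) →ₗ[ℂ] (ι → ℂ))
    (ξ : B → ℂ) (v : B) : schurOp T ext ξ v = T (ext ξ) v := rfl

variable [Fintype ι]

theorem star_star_dotProduct (x y : ι → ℂ) : star (star x ⬝ᵥ y) = star y ⬝ᵥ x := by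
  rw [← Matrix.star_dotProduct_star, star_star]

theorem opForm_add {T : (ι → ℂ) →ₗ[ℂ] (ι → ℂ)} (hT : IsHermOp T) (x y : ι → ℂ) :
    opForm T (x + y) = opForm T x + opForm T y + 2 * (star y ⬝ᵥ T x).re := by
  have h : (star x ⬝ᵥ T y).re = (star y ⬝ᵥ T x).re := by
    rw [hT x y, ← star_star_dotProduct]
    exact Complex.conj_re _
  simp only [opForm, map_add, star_add, add_dotProduct, dotProduct_add, Complex.add_re, h]
  ring

/-- Solving for the coordinates off `B` when the form is positive definite there. -/
theorem exists_schur_extension {T : (ι → ℂ) →ₗ[ℂ] (ι → ℂ)} {B : Set ι}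
    (hpos : ∀ x ≠ 0, (∀ v ∈ B, x v = 0) → 0 < opForm T x) :
    ∃ ext : (B → ℂ) →ₗ[ℂ] (ι → ℂ), (∀ ξ (v : B), ext ξ v = ξ v) ∧
      (∀ ξ, ∀ v ∉ B, T (ext ξ) v = 0) ∧
      ∀ x, (∀ v ∉ B, T x v = 0) → x = ext fun v => x v := by
  classical
  -- Values on `B` together with the equations `T x = 0` off `B` form a square system. A homogeneous
  -- solution has zero form, so positivity makes the system uniquely solvable.
  let K : (ι → ℂ) →ₗ[ℂ] (ι → ℂ) :=
    LinearMap.pi fun v => if v ∈ B then LinearMap.proj v else LinearMap.proj v ∘ₗ T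
  have hK1 : ∀ x, ∀ v ∈ B, K x v = x v := fun x v hv => by simp [K, hv]
  have hK2 : ∀ x, ∀ v ∉ B, K x v = T x v := fun x v hv => by simp [K, hv]
  have hinj : Function.Injective K := by
    refine (injective_iff_map_eq_zero K).2 fun x hx => ?_
    by_contra hne
    have h1 : ∀ v ∈ B, x v = 0 := fun v hv => by rw [← hK1 x v hv, hx]; rfl
    have h2 : ∀ v ∉ B, T x v = 0 := fun v hv => by rw [← hK2 x v hv, hx]; rfl
    refine (hpos x hne h1).ne' ?_
    have : star x ⬝ᵥ T x = 0 := Finset.sum_eq_zero fun v _ => by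
      by_cases hv : v ∈ B
      · simp [h1 v hv]
      · simp [h2 v hv]
    rw [opForm, this, Complex.zero_re]
  let e := LinearEquiv.ofBijective K ⟨hinj, LinearMap.injective_iff_surjective.1 hinj⟩
  have he : ∀ y, K (e.symm y) = y := fun y => e.apply_symm_apply y
  let z : (B → ℂ) →ₗ[ℂ] (ι → ℂ) :=
    LinearMap.pi fun v => if h : v ∈ B then LinearMap.proj ⟨v, h⟩ else 0
  have hz1 : ∀ ξ (v : B), z ξ v = ξ v := fun ξ v => by simp [z]
  have hz2 : ∀ ξ, ∀ v ∉ B, z ξ v = 0 := fun ξ v hv => by simp [z, hv]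
  refine ⟨e.symm.toLinearMap ∘ₗ z, fun ξ v => ?_, fun ξ v hv => ?_, fun x hx => ?_⟩
  · exact (hK1 _ v v.2).symm.trans ((congrFun (he _) v).trans (hz1 ξ v))
  · exact (hK2 _ v hv).symm.trans ((congrFun (he _) v).trans (hz2 ξ v hv))
  · apply hinj
    refine Eq.trans ?_ (he _).symm
    ext v
    by_cases hv : v ∈ B
    · rw [hK1 x v hv]
      exact (hz1 (fun v => x v) ⟨v, hv⟩).symm
    · rw [hK2 x v hv, hx v hv, hz2 _ v hv]

variable {T : (ι → ℂ) →ₗ[ℂ] (ι → ℂ)} {B : Set ι} [Fintype B] {ext : (B → ℂ) →ₗ[ℂ] (ι → ℂ)}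

theorem dotProduct_schurOp (h2 : ∀ ξ, ∀ v ∉ B, T (ext ξ) v = 0) (ξ : B → ℂ) (x : ι → ℂ) :
    x ⬝ᵥ T (ext ξ) = (fun v : B => x v) ⬝ᵥ schurOp T ext ξ := by
  simp only [dotProduct, schurOp_apply]
  rw [Finset.sum_set_coe (f := fun i => x i * T (ext ξ) i)]
  refine (Finset.sum_subset (Finset.subset_univ _) fun v _ hv => ?_).symm
  rw [h2 ξ v (by simpa using hv), mul_zero]

/-- Inertia is additive when the complementary block is positive definite. Among all vectors with
values `ξ` on `B`, `ext ξ` minimises the form of `T`. Hence restriction to `B` and `ext` carry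
nonpositive subspaces to nonpositive subspaces, injectively, and the maximal dimensions agree. -/
theorem positiveIndex_schurOp (hT : IsHermOp T)
    (hpos : ∀ x ≠ 0, (∀ v ∈ B, x v = 0) → 0 < opForm T x)
    (h1 : ∀ ξ (v : B), ext ξ v = ξ v) (h2 : ∀ ξ, ∀ v ∉ B, T (ext ξ) v = 0) :
    positiveIndex (schurOp T ext) + Fintype.card ι = positiveIndex T + Fintype.card B := by
  have hres : ∀ ξ, (fun v : B => ext ξ v) = ξ := fun ξ => funext (h1 ξ)
  have hS : IsHermOp (schurOp T ext) := by
    intro ξ η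
    have e1 := dotProduct_schurOp h2 η (star (ext ξ))
    have e2 := dotProduct_schurOp h2 ξ (star (ext η))
    have e3 := hT (ext ξ) (ext η)
    have r : ∀ ζ, (fun v : B => star (ext ζ) v) = star ζ := fun ζ => by
      ext v; simp [h1]
    rw [r] at e1 e2
    rw [← e1, e3, ← star_star_dotProduct, e2, star_star_dotProduct]
  have hform : ∀ ξ, opForm (schurOp T ext) ξ = opForm T (ext ξ) := by
    intro ξ
    rw [opForm, opForm, dotProduct_schurOp h2]
    congr 2
    ext v; simp [h1]
  have hmin : ∀ x, opForm T (ext fun v => x v) ≤ opForm T x := by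
    intro x
    set ξ : B → ℂ := fun v => x v
    have hx : x = ext ξ + (x - ext ξ) := by abel
    have hy : ∀ v ∈ B, (x - ext ξ) v = 0 := fun v hv => by
      rw [Pi.sub_apply, h1 ξ ⟨v, hv⟩, sub_self]
    -- The cross term vanishes coordinatewise: one factor is zero on `B`, the other off `B`.
    have h0 : star (x - ext ξ) ⬝ᵥ T (ext ξ) = 0 := Finset.sum_eq_zero fun v _ => by
      by_cases hv : v ∈ B
      · rw [Pi.star_apply, hy v hv]; simp
      · simp [h2 ξ v hv]
    conv_rhs => rw [hx, opForm_add hT, h0]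
    have : 0 ≤ opForm T (x - ext ξ) := by
      by_cases hne : x - ext ξ = 0
      · simp [hne, opForm]
      · exact (hpos _ hne hy).le
    simpa using this
  obtain ⟨m, φ, hm, hinj, hφ⟩ := hT.exists_nonpositive
  obtain ⟨m', φ', hm', hinj', hφ'⟩ := hS.exists_nonpositive
  have e1 := hS.finrank_add_positiveIndex_le (LinearMap.funLeft ℂ ℂ Subtype.val ∘ₗ φ) (by
    refine (injective_iff_map_eq_zero _).2 fun y hy => hinj ?_
    rw [map_zero]
    by_contra hne
    exact (hpos _ hne fun v hv => congrFun hy ⟨v, hv⟩).not_ge (hφ y)) fun y => by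
      rw [hform]
      exact (hmin (φ y)).trans (hφ y)
  have e2 := hT.finrank_add_positiveIndex_le (ext ∘ₗ φ') (by
    have : Function.Injective ext := fun ξ η h => by rw [← hres ξ, ← hres η, h]
    exact this.comp hinj') fun y => (hform _).symm.trans_le (hφ' y)
  simp only [Module.finrank_fin_fun] at e1 e2
  omega

end Schur

namespace MetricGraph

/-! ### Reduction of the Laplacian to the vertices -/

section VertexOperator

variable {V E : Type*} {Γ : MetricGraph V E} {μ lam : ℝ}

/-- The other end of an edge. -/
def flip (h : E × Bool) : E × Bool := (h.1, !h.2)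

theorem onEdge_apply (u : Γ.Fn) (e : E) {x : ℝ} (hx : x ∈ Icc 0 (Γ.len e)) :
    Γ.onEdge u e x = u e ⟨x, hx⟩ := IccExtend_of_mem _ _ hx

theorem solvesOnEdges_iff {u : Γ.Fn} :
    Γ.SolvesOnEdges μ u ↔ ∀ e, ∃ d, IsIntervalSol (Γ.len e) μ (Γ.onEdge u e) d := by
  refine forall_congr' fun e => ⟨?_, ?_⟩
  · rintro ⟨g, hg, hae⟩
    exact IsIntervalSol.of_hasSobolevSecondDeriv hg hae
  · rintro ⟨d, hd⟩
    exact ⟨_, hd.hasSobolevSecondDeriv, Eventually.of_forall fun x => by ring⟩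

theorem outDeriv_eq {u : Γ.Fn} {e : E} {d : ℝ → ℂ}
    (hd : IsIntervalSol (Γ.len e) μ (Γ.onEdge u e) d) (b : Bool) :
    Γ.outDeriv u (e, b) = if b then -d (Γ.len e) else d 0 := by
  have hm := Γ.endPoint_mem (e, b)
  rw [outDeriv, (hd _ hm).1.derivWithin (uniqueDiffOn_Icc (Γ.len_pos e) _ hm)]
  cases b <;> simp [endPoint]

theorem endValue_false (u : Γ.Fn) (e : E) : Γ.endValue u (e, false) = Γ.onEdge u e 0 := rfl

theorem endValue_true (u : Γ.Fn) (e : E) : Γ.endValue u (e, true) = Γ.onEdge u e (Γ.len e) := rfl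

/-- The outgoing derivative at an edge end in terms of the values at both ends. -/
theorem outDeriv_eq_coef {u : Γ.Fn} (hμ : 0 ≤ μ) (hu : Γ.SolvesOnEdges μ u) (h : E × Bool)
    (hπ : √μ * Γ.len h.1 < Real.pi) :
    Γ.outDeriv u h = offCoef (Γ.len h.1) μ * Γ.endValue u (flip h) -
      diagCoef (Γ.len h.1) μ * Γ.endValue u h := by
  obtain ⟨e, b⟩ := h
  obtain ⟨d, hd⟩ := solvesOnEdges_iff.1 hu e
  have := hd.deriv_ends hμ (Γ.len_pos e) hπ
  rw [outDeriv_eq hd]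
  cases b
  · exact this.1
  · exact this.2

theorem eq_of_endValue_eq {u w : Γ.Fn} (hμ : 0 ≤ μ) (hu : Γ.SolvesOnEdges μ u)
    (hw : Γ.SolvesOnEdges μ w) (hπ : ∀ e, √μ * Γ.len e < Real.pi)
    (h : ∀ h, Γ.endValue u h = Γ.endValue w h) : u = w := by
  ext e ⟨x, hx⟩
  obtain ⟨d, hd⟩ := solvesOnEdges_iff.1 hu e
  obtain ⟨d', hd'⟩ := solvesOnEdges_iff.1 hw e
  have h0 : (0 : ℝ) ∈ Icc 0 (Γ.len e) := ⟨le_rfl, (Γ.len_pos e).le⟩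
  have e1 := (hd.eq_of_base hμ h0 hx).1
  have e2 := (hd'.eq_of_base hμ h0 hx).1
  have v0 : Γ.onEdge u e 0 = Γ.onEdge w e 0 := h (e, false)
  have vL : Γ.onEdge u e (Γ.len e) = Γ.onEdge w e (Γ.len e) := h (e, true)
  rw [← onEdge_apply u e hx, ← onEdge_apply w e hx, e1, e2, (hd.deriv_ends hμ (Γ.len_pos e) (hπ e)).1,
    (hd'.deriv_ends hμ (Γ.len_pos e) (hπ e)).1, v0, vL]

variable (Γ) in
/-- The function solving `-u'' = μ u` on the edges with prescribed values at the vertices. -/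
noncomputable def interp (μ : ℝ) : (V → ℂ) →ₗ[ℂ] Γ.Fn where
  toFun x e t := x (Γ.src e) * cosSol μ t + (offCoef (Γ.len e) μ * x (Γ.tgt e) -
    diagCoef (Γ.len e) μ * x (Γ.src e)) * sinSol μ t
  map_add' x y := by
    ext e t
    simp only [Pi.add_apply]
    ring
  map_smul' c x := by
    ext e t
    simp only [Pi.smul_apply, smul_eq_mul, RingHom.id_apply]
    ring

theorem onEdge_interp (x : V → ℂ) (e : E) {t : ℝ} (ht : t ∈ Icc 0 (Γ.len e)) :
    Γ.onEdge (Γ.interp μ x) e t = x (Γ.src e) * cosSol μ (t - 0) +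
      (offCoef (Γ.len e) μ * x (Γ.tgt e) - diagCoef (Γ.len e) μ * x (Γ.src e)) *
        sinSol μ (t - 0) := by
  rw [onEdge_apply _ _ ht, sub_zero]
  rfl

theorem solvesOnEdges_interp (hμ : 0 ≤ μ) (x : V → ℂ) : Γ.SolvesOnEdges μ (Γ.interp μ x) :=
  solvesOnEdges_iff.2 fun e => ⟨_, (IsIntervalSol.of_coeffs hμ (Γ.len e) 0 _ _).congr
    fun _ ht => onEdge_interp x e ht⟩

theorem endValue_interp (hπ : ∀ e, √μ * Γ.len e < Real.pi) (x : V → ℂ)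
    (h : E × Bool) : Γ.endValue (Γ.interp μ x) h = x (Γ.endVertex h) := by
  obtain ⟨e, b⟩ := h
  rw [endValue, onEdge_interp x e (Γ.endPoint_mem (e, b))]
  have hs : (sinSol μ (Γ.len e) : ℂ) ≠ 0 := by exact_mod_cast (sinSol_pos (Γ.len_pos e) (hπ e)).ne'
  cases b
  · simp [endPoint, endVertex]
  · simp only [endPoint, endVertex, if_true, sub_zero, offCoef, diagCoef]
    push_cast
    field_simp
    ring

theorem sqrt_mul_lt (hlen : ∀ e, √lam * Γ.len e ≤ Real.pi) (h0 : 0 ≤ μ) (h : μ < lam) (e : E) :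
    √μ * Γ.len e < Real.pi :=
  (mul_lt_mul_of_pos_right (Real.sqrt_lt_sqrt h0 h) (Γ.len_pos e)).trans_le (hlen e)

/-- The default value `0` is taken only at vertices without edge ends, where the conclusion imposes
nothing. -/
theorem exists_vertex_values {u : Γ.Fn}
    (hu : ∀ v, ∀ h ∈ Γ.endsAt v, ∀ h' ∈ Γ.endsAt v, Γ.endValue u h = Γ.endValue u h') :
    ∃ x : V → ℂ, ∀ h, Γ.endValue u h = x (Γ.endVertex h) := by
  classical
  refine ⟨fun v => if hv : ∃ h, Γ.endVertex h = v then Γ.endValue u hv.choose else 0, fun h => ?_⟩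
  have hv : ∃ h', Γ.endVertex h' = Γ.endVertex h := ⟨h, rfl⟩
  simp only [dif_pos hv]
  exact hu _ h rfl _ hv.choose_spec

theorem interp_injective (hends : ∀ v, ∃ h, Γ.endVertex h = v)
    (hπ : ∀ e, √μ * Γ.len e < Real.pi) : Function.Injective (Γ.interp μ) := by
  intro x y hxy
  ext v
  obtain ⟨h, rfl⟩ := hends v
  rw [← endValue_interp hπ x, ← endValue_interp hπ y, hxy]

/-! ### The vertex operator, its kernel and its Schur complements -/

variable [Fintype E] [DecidableEq V]

theorem finsum_endsAt (F : E × Bool → ℂ) (v : V) :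
    ∑ᶠ h ∈ Γ.endsAt v, F h = ∑ h, if Γ.endVertex h = v then F h else 0 := by
  rw [← Finset.sum_filter, finsum_mem_eq_sum_of_inter_support_eq]
  ext h
  simp [endsAt]

variable (Γ) in
/-- The Dirichlet-to-Neumann map on all vertices. -/
noncomputable def vertexOp (μ : ℝ) : (V → ℂ) →ₗ[ℂ] (V → ℂ) where
  toFun x v := ∑ h, if Γ.endVertex h = v then
    (diagCoef (Γ.len h.1) μ * x (Γ.endVertex h) -
      offCoef (Γ.len h.1) μ * x (Γ.endVertex (flip h))) else 0
  map_add' x y := by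
    ext v
    simp only [Pi.add_apply, ← Finset.sum_add_distrib]
    refine Finset.sum_congr rfl fun h _ => ?_
    split_ifs <;> ring
  map_smul' c x := by
    ext v
    simp only [Pi.smul_apply, smul_eq_mul, RingHom.id_apply, Finset.mul_sum]
    refine Finset.sum_congr rfl fun h _ => ?_
    split_ifs <;> ring

theorem vertexOp_apply (x : V → ℂ) (v : V) :
    Γ.vertexOp μ x v = ∑ h, if Γ.endVertex h = v then
    (diagCoef (Γ.len h.1) μ * x (Γ.endVertex h) -
      offCoef (Γ.len h.1) μ * x (Γ.endVertex (flip h))) else 0 := rfl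

theorem finsum_outDeriv (hμ : 0 ≤ μ) (hπ : ∀ e, √μ * Γ.len e < Real.pi) {u : Γ.Fn}
    (hu : Γ.SolvesOnEdges μ u) {x : V → ℂ} (hx : ∀ h, Γ.endValue u h = x (Γ.endVertex h)) (v : V) :
    ∑ᶠ h ∈ Γ.endsAt v, Γ.outDeriv u h = -Γ.vertexOp μ x v := by
  rw [finsum_endsAt, vertexOp_apply, ← Finset.sum_neg_distrib]
  refine Finset.sum_congr rfl fun h _ => ?_
  rw [outDeriv_eq_coef hμ hu h (hπ _), hx, hx]
  split_ifs <;> ring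

theorem neumannKirchhoff_interp_iff (hμ : 0 ≤ μ) (hπ : ∀ e, √μ * Γ.len e < Real.pi) (x : V → ℂ)
    (v : V) : Γ.NeumannKirchhoff (Γ.interp μ x) v ↔ Γ.vertexOp μ x v = 0 := by
  rw [NeumannKirchhoff, finsum_outDeriv hμ hπ (solvesOnEdges_interp hμ x) (endValue_interp hπ x),
    neg_eq_zero]
  refine and_iff_right fun h hh h' hh' => ?_
  rw [endValue_interp hπ, endValue_interp hπ, show Γ.endVertex h = v from hh,
    show Γ.endVertex h' = v from hh']

/-- Below the Dirichlet spectrum of every edge a solution is the interpolation of its vertex values.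
Continuity is then built in, and current conservation becomes the vanishing of `vertexOp`. -/
theorem eigenspace_eq_map (hμ : 0 ≤ μ)
    (hπ : ∀ e, √μ * Γ.len e < Real.pi) :
    Γ.eigenspace μ = (LinearMap.ker (Γ.vertexOp μ)).map (Γ.interp μ) := by
  ext u
  rw [Submodule.mem_map]
  constructor
  · rintro ⟨hu, hk⟩
    obtain ⟨x, hx⟩ := exists_vertex_values fun v => (hk v).1
    obtain rfl : Γ.interp μ x = u := eq_of_endValue_eq hμ (solvesOnEdges_interp hμ x) hu hπ
      fun h => by rw [endValue_interp hπ, hx]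
    refine ⟨x, LinearMap.mem_ker.2 (funext fun v => ?_), rfl⟩
    exact (neumannKirchhoff_interp_iff hμ hπ x v).1 (hk v)
  · rintro ⟨x, hx, rfl⟩
    exact ⟨solvesOnEdges_interp hμ x, fun v =>
      (neumannKirchhoff_interp_iff hμ hπ x v).2 (congrFun (LinearMap.mem_ker.1 hx) v)⟩

theorem mult_eq_finrank_ker (hends : ∀ v, ∃ h, Γ.endVertex h = v) (hμ : 0 ≤ μ)
    (hπ : ∀ e, √μ * Γ.len e < Real.pi) :
    Γ.mult μ = Module.finrank ℂ (LinearMap.ker (Γ.vertexOp μ)) := by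
  rw [mult, eigenspace_eq_map hμ hπ]
  exact (Submodule.equivMapOfInjective _ (interp_injective hends hπ) _).finrank_eq.symm

/-- Off `B` the equations `vertexOp x = 0` are the Neumann-Kirchhoff conditions, so `ext` solves the
boundary value problem and `h3` gives uniqueness. On `B` the operator returns minus the sum of
outgoing derivatives. -/
theorem isDtNMap_schurOp (hends : ∀ v, ∃ h, Γ.endVertex h = v) (hμ : 0 ≤ μ)
    (hπ : ∀ e, √μ * Γ.len e < Real.pi) {B : Set V} {ext : (B → ℂ) →ₗ[ℂ] (V → ℂ)}
    (h1 : ∀ ξ (v : B), ext ξ v = ξ v) (h2 : ∀ ξ, ∀ v ∉ B, Γ.vertexOp μ (ext ξ) v = 0)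
    (h3 : ∀ x, (∀ v ∉ B, Γ.vertexOp μ x v = 0) → x = ext fun v => x v) :
    Γ.IsDtNMap B μ (schurOp (Γ.vertexOp μ) ext) := by
  have hsol : ∀ ξ, Γ.SolvesDirichlet B μ ξ (Γ.interp μ (ext ξ)) := by
    refine fun ξ => ⟨solvesOnEdges_interp hμ _, fun v h hh => ?_, fun v hv => ?_⟩
    · rw [endValue_interp hπ, show Γ.endVertex h = v from hh, h1]
    · exact (neumannKirchhoff_interp_iff hμ hπ _ v).2 (h2 ξ v hv)
  have huniq : ∀ ξ u, Γ.SolvesDirichlet B μ ξ u → u = Γ.interp μ (ext ξ) := by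
    rintro ξ u ⟨hu, hb, hk⟩
    obtain ⟨x, hx⟩ := exists_vertex_values (u := u) fun v h hh h' hh' => by
      by_cases hv : v ∈ B
      · rw [hb ⟨v, hv⟩ h hh, hb ⟨v, hv⟩ h' hh']
      · exact (hk v hv).1 h hh h' hh'
    obtain rfl : Γ.interp μ x = u := eq_of_endValue_eq hμ (solvesOnEdges_interp hμ x) hu hπ
      fun h => by rw [endValue_interp hπ, hx]
    have e1 := h3 x fun v hv => (neumannKirchhoff_interp_iff hμ hπ x v).1 (hk v hv)
    have e2 : (fun v : B => x v) = ξ := by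
      ext v
      obtain ⟨h, hh⟩ := hends v
      rw [← hb v h hh, hx, hh]
    rw [e2] at e1
    rw [e1]
  refine ⟨fun ξ => ⟨_, hsol ξ, huniq ξ⟩, fun ξ u hu v => ?_⟩
  rw [huniq ξ u hu, finsum_outDeriv hμ hπ (solvesOnEdges_interp hμ _) (endValue_interp hπ _),
    neg_neg, schurOp_apply]

/-! ### The quadratic form of the vertex operator -/

variable [Fintype V]

theorem dotProduct_vertexOp (x y : V → ℂ) :
    y ⬝ᵥ Γ.vertexOp μ x = ∑ h, y (Γ.endVertex h) * (diagCoef (Γ.len h.1) μ * x (Γ.endVertex h) -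
      offCoef (Γ.len h.1) μ * x (Γ.endVertex (flip h))) := by
  simp only [dotProduct, vertexOp_apply, Finset.mul_sum, mul_ite, mul_zero]
  rw [Finset.sum_comm]
  refine Finset.sum_congr rfl fun h _ => ?_
  rw [Finset.sum_ite_eq]
  simp

theorem dotProduct_vertexOp_edges (x y : V → ℂ) :
    y ⬝ᵥ Γ.vertexOp μ x = ∑ e, (diagCoef (Γ.len e) μ *
      (y (Γ.src e) * x (Γ.src e) + y (Γ.tgt e) * x (Γ.tgt e)) -
      offCoef (Γ.len e) μ * (y (Γ.src e) * x (Γ.tgt e) + y (Γ.tgt e) * x (Γ.src e))) := by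
  rw [dotProduct_vertexOp, Fintype.sum_prod_type]
  refine Finset.sum_congr rfl fun e _ => ?_
  simp only [Fintype.sum_bool, endVertex, flip, if_true, Bool.not_true, Bool.not_false,
    Bool.false_eq_true, if_false]
  ring

theorem isHermOp_vertexOp : IsHermOp (Γ.vertexOp μ) := by
  intro x y
  rw [← star_star_dotProduct y, dotProduct_vertexOp_edges, dotProduct_vertexOp_edges, star_sum]
  refine Finset.sum_congr rfl fun e _ => ?_
  simp only [Pi.star_apply, star_sub, star_mul', star_add, RCLike.star_def,
    Complex.conj_ofReal, Complex.conj_conj]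
  ring

/-- Splits the form of each edge into symmetric and antisymmetric parts, so that it depends on `μ`
only through the two monotone combinations of `coef_half_angle`. -/
theorem opForm_vertexOp (x : V → ℂ) :
    opForm (Γ.vertexOp μ) x = ∑ e,
      ((diagCoef (Γ.len e) μ - offCoef (Γ.len e) μ) / 2 * ‖x (Γ.src e) + x (Γ.tgt e)‖ ^ 2 +
      (diagCoef (Γ.len e) μ + offCoef (Γ.len e) μ) / 2 * ‖x (Γ.src e) - x (Γ.tgt e)‖ ^ 2) := by
  rw [opForm, dotProduct_vertexOp_edges, Complex.re_sum]
  refine Finset.sum_congr rfl fun e _ => ?_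
  simp only [← Complex.normSq_eq_norm_sq, Complex.normSq_apply, Pi.star_apply, RCLike.star_def]
  simp
  ring

/-- The form on functions vanishing on a set `B` that meets every edge. -/
theorem opForm_vertexOp_of_vanish {B : Set V} (hB : ∀ e, Γ.src e ∈ B ∨ Γ.tgt e ∈ B) {x : V → ℂ}
    (hx : ∀ v ∈ B, x v = 0) :
    opForm (Γ.vertexOp μ) x =
      ∑ v, (∑ h, if Γ.endVertex h = v then diagCoef (Γ.len h.1) μ else 0) * ‖x v‖ ^ 2 := by
  have h1 : ∑ v, (∑ h, if Γ.endVertex h = v then diagCoef (Γ.len h.1) μ else 0) * ‖x v‖ ^ 2 =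
      ∑ h : E × Bool, diagCoef (Γ.len h.1) μ * ‖x (Γ.endVertex h)‖ ^ 2 := by
    simp only [Finset.sum_mul, ite_mul, zero_mul]
    rw [Finset.sum_comm]
    refine Finset.sum_congr rfl fun h _ => ?_
    rw [Finset.sum_ite_eq]
    simp
  rw [h1, opForm, dotProduct_vertexOp, Complex.re_sum]
  refine Finset.sum_congr rfl fun h _ => ?_
  have h2 : x (Γ.endVertex h) = 0 ∨ x (Γ.endVertex (flip h)) = 0 := by
    obtain ⟨e, b⟩ := h
    rcases hB e with h | h <;> cases b <;> simp [endVertex, flip, hx _ h]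
  rw [← Complex.normSq_eq_norm_sq, Complex.normSq_apply]
  rcases h2 with h2 | h2
  · simp [h2]
  · simp only [h2, mul_zero, sub_zero, Pi.star_apply, RCLike.star_def]
    simp
    ring

/-! #### The family of vertex operators -/

/-- No edge contribution increases. A vertex with `x v ≠ 0` is an end of some edge, on which the sum
or the difference of the end values is nonzero, and there the decrease is strict. -/
theorem opForm_vertexOp_lt {ν : ℝ} (hends : ∀ v, ∃ h, Γ.endVertex h = v) (h0 : 0 ≤ μ) (h : μ < ν)
    (hπ : ∀ e, √ν * Γ.len e < Real.pi) {x : V → ℂ} (hx : x ≠ 0) :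
    opForm (Γ.vertexOp ν) x < opForm (Γ.vertexOp μ) x := by
  rw [opForm_vertexOp, opForm_vertexOp]
  have hsub : ∀ e, _ := fun e => coef_sub_lt (Γ.len_pos e) h0 h (hπ e)
  have hadd : ∀ e, _ := fun e => coef_add_lt (Γ.len_pos e) h0 h (hπ e)
  refine Finset.sum_lt_sum (fun e _ => ?_) ?_
  · have := hsub e
    have := hadd e
    gcongr
  · obtain ⟨v, hv⟩ := Function.ne_iff.1 hx
    obtain ⟨⟨e, b⟩, rfl⟩ := hends v
    refine ⟨e, Finset.mem_univ _, ?_⟩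
    have h1 := hsub e
    have h2 := hadd e
    have h3 : x (Γ.src e) + x (Γ.tgt e) ≠ 0 ∨ x (Γ.src e) - x (Γ.tgt e) ≠ 0 := by
      by_contra! hcon
      have hs : x (Γ.src e) = 0 := by linear_combination (hcon.1 + hcon.2) / 2
      have ht : x (Γ.tgt e) = 0 := by linear_combination (hcon.1 - hcon.2) / 2
      cases b <;> simp [endVertex, hs, ht] at hv
    rcases h3 with h3 | h3
    · have := norm_pos_iff.2 h3
      refine add_lt_add_of_lt_of_le ?_ ?_ <;> gcongr
    · have := norm_pos_iff.2 h3
      refine add_lt_add_of_le_of_lt ?_ ?_ <;> gcongr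

/-- The half-open interval is essential: pieces with `√lam * len = π` are allowed, and their
coefficients have a pole at `lam`. -/
theorem continuous_opForm_vertexOp (hlen : ∀ e, √lam * Γ.len e ≤ Real.pi) :
    Continuous fun z : Ico 0 lam × (V → ℂ) => opForm (Γ.vertexOp z.1) z.2 := by
  simp only [opForm_vertexOp]
  refine continuous_finsetSum _ fun e _ => ?_
  have hsub : ∀ z : Ico 0 lam, (z : ℝ) ∈ {μ | √μ * Γ.len e < Real.pi} := fun z =>
    sqrt_mul_lt hlen z.2.1 z.2.2 e
  have h1 : Continuous fun z : Ico 0 lam × (V → ℂ) => diagCoef (Γ.len e) z.1 :=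
    ((continuousOn_diagCoef (Γ.len_pos e)).comp_continuous continuous_subtype_val hsub).comp
      continuous_fst
  have h2 : Continuous fun z : Ico 0 lam × (V → ℂ) => offCoef (Γ.len e) z.1 :=
    ((continuousOn_offCoef (Γ.len_pos e)).comp_continuous continuous_subtype_val hsub).comp
      continuous_fst
  fun_prop

/-- At `μ = 0` the symmetric part disappears and the form is the discrete Dirichlet energy with
weights `1 / len e`. -/
theorem opForm_vertexOp_zero_nonneg (x : V → ℂ) : 0 ≤ opForm (Γ.vertexOp 0) x := by
  rw [opForm_vertexOp]
  refine Finset.sum_nonneg fun e _ => ?_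
  have := Γ.len_pos e
  rw [diagCoef_zero, offCoef_zero, sub_self]
  positivity

/-- Suppose that every edge meets `B`, that no edge supports a Dirichlet eigenfunction below
`lam`, and that at the vertices outside `B` the Dirichlet problem is solvable at `lam`. Then the
positive eigenvalues of the Dirichlet-to-Neumann map just below `lam` count the difference between
the size of `B` and the number of eigenvalues below `lam`. -/
theorem exists_dtn_counting (hends : ∀ v, ∃ h, Γ.endVertex h = v) {B : Set V}
    (hB : ∀ e, Γ.src e ∈ B ∨ Γ.tgt e ∈ B) (hlam : 0 < lam)
    (hlen : ∀ e, √lam * Γ.len e ≤ Real.pi)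
    (hlt : ∀ h, Γ.endVertex h ∉ B → √lam * Γ.len h.1 < Real.pi)
    (hdiag : ∀ v ∉ B, 0 ≤ ∑ h, if Γ.endVertex h = v then diagCoef (Γ.len h.1) lam else 0) :
    ∃ S : Finset ℝ, (∀ μ, 0 ≤ μ → μ < lam → Γ.mult μ ≠ 0 → μ ∈ S) ∧ (∀ μ ∈ S, μ < lam) ∧
      (∀ μ ∈ S, 0 ≤ μ) ∧
      ∀ᶠ ε in 𝓝[>] (0 : ℝ), ∃ Λ : (B → ℂ) →ₗ[ℂ] (B → ℂ), Γ.IsDtNMap B (lam - ε) Λ ∧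
        positiveIndex Λ + ∑ ν ∈ S, Γ.mult ν = Nat.card B := by
  classical
  have hπ : ∀ μ ∈ Ico 0 lam, ∀ e, √μ * Γ.len e < Real.pi := fun μ hμ e =>
    sqrt_mul_lt hlen hμ.1 hμ.2 e
  obtain ⟨S, hS1, hS2, hS3⟩ := negativeIndex_eq_sum_finrank_ker hlam
    (T := fun μ => Γ.vertexOp μ) (fun μ _ => isHermOp_vertexOp) (continuous_opForm_vertexOp hlen)
    (fun μ hμ ν hν h x hx => opForm_vertexOp_lt hends hμ.1 h (hπ ν hν) hx)
    opForm_vertexOp_zero_nonneg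
  have hmult : ∀ μ ∈ Ico 0 lam, Γ.mult μ = Module.finrank ℂ (LinearMap.ker (Γ.vertexOp μ)) :=
    fun μ hμ => mult_eq_finrank_ker hends hμ.1 (hπ μ hμ)
  refine ⟨S, fun μ h0 h1 hm => hS1 μ ⟨h0, h1⟩ fun hker => hm ?_, fun μ hμ => (hS2 μ hμ).2,
    fun μ hμ => (hS2 μ hμ).1, ?_⟩
  · rw [hmult μ ⟨h0, h1⟩]
    change LinearMap.ker (Γ.vertexOp μ) = ⊥ at hker
    rw [hker, finrank_bot]
  -- For `ε` this small all singular parameters lie below `lam - ε`: the operator there is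
  -- nonsingular and its negative index is the sum over all of `S`.
  have hev : ∀ᶠ ε in 𝓝[>] (0 : ℝ), ∀ ν ∈ S, ν < lam - ε := by
    rw [Filter.eventually_all_finset]
    intro ν hν
    filter_upwards [Ioo_mem_nhdsGT (sub_pos.2 (hS2 ν hν).2)] with ε hε
    linarith [hε.2]
  filter_upwards [hev, Ioo_mem_nhdsGT hlam] with ε hε h0
  set μ := lam - ε with hμdef
  have hμ : μ ∈ Ico 0 lam := ⟨by linarith [h0.2], by linarith [h0.1]⟩
  -- Off `B` the form is diagonal; its entries are nonnegative at `lam` and strictly decreasing in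
  -- the parameter, hence positive at `lam - ε`.
  have hpos : ∀ x ≠ 0, (∀ v ∈ B, x v = 0) → 0 < opForm (Γ.vertexOp μ) x := by
    intro x hx hxB
    rw [opForm_vertexOp_of_vanish hB hxB]
    have hd : ∀ v ∉ B, 0 < ∑ h, if Γ.endVertex h = v then diagCoef (Γ.len h.1) μ else 0 := by
      intro v hv
      refine (hdiag v hv).trans_lt (Finset.sum_lt_sum (fun h _ => ?_) ?_)
      · split_ifs with hh
        · exact (diagCoef_lt (Γ.len_pos _) hμ.1 hμ.2 (hlt h (hh ▸ hv))).le
        · rfl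
      · obtain ⟨h, hh⟩ := hends v
        refine ⟨h, Finset.mem_univ _, ?_⟩
        rw [if_pos hh, if_pos hh]
        exact diagCoef_lt (Γ.len_pos _) hμ.1 hμ.2 (hlt h (hh ▸ hv))
    obtain ⟨v, hv⟩ := Function.ne_iff.1 hx
    have hvB : v ∉ B := fun h => hv (hxB v h)
    refine Finset.sum_pos' (fun w _ => ?_) ⟨v, Finset.mem_univ _, ?_⟩
    · by_cases hw : w ∈ B
      · simp [hxB w hw]
      · exact mul_nonneg (hd w hw).le (by positivity)
    · exact mul_pos (hd v hvB) (pow_pos (norm_pos_iff.2 hv) 2)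
  obtain ⟨ext, h1, h2, h3⟩ := exists_schur_extension hpos
  refine ⟨_, isDtNMap_schurOp hends hμ.1 (hπ μ hμ) h1 h2 h3, ?_⟩
  have e1 := positiveIndex_schurOp isHermOp_vertexOp hpos h1 h2
  have e2 := (isHermOp_vertexOp (Γ := Γ) (μ := μ)).inertia
  have e3 := hS3 μ hμ
  have e4 : LinearMap.ker (Γ.vertexOp μ) = ⊥ := by
    by_contra h
    exact lt_irrefl _ (hε μ (hS1 μ hμ h))
  rw [Finset.filter_true_of_mem hε, ← Finset.sum_congr rfl fun ν hν => hmult ν (hS2 ν hν)] at e3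
  rw [e4, finrank_bot] at e2
  rw [Nat.card_eq_fintype_card]
  replace e3 : positiveIndex (-Γ.vertexOp μ) = ∑ ν ∈ S, Γ.mult ν := e3
  omega

end VertexOperator

end MetricGraph

namespace MetricGraph

/-! ### Counting eigenvalues -/

section Counting

variable {V E : Type*} {Γ : MetricGraph V E} {μ lam : ℝ}

/-- Continuity and current conservation make the fluxes `u' ū` cancel over all edge ends. For `μ <
0` the flux gain along each edge is nonnegative, so every gain is zero and `flux_mono` makes `u`
vanish. -/
theorem eigenspace_eq_bot_of_neg [Finite V] [Finite E] (hμ : μ < 0) : Γ.eigenspace μ = ⊥ := by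
  classical
  have := Fintype.ofFinite V
  have := Fintype.ofFinite E
  rw [Submodule.eq_bot_iff]
  rintro u ⟨hu, hk⟩
  choose d hd using solvesOnEdges_iff.1 hu
  obtain ⟨x, hx⟩ := exists_vertex_values (u := u) fun v => (hk v).1
  have hsum : ∑ h, (Γ.outDeriv u h * starRingEnd ℂ (Γ.endValue u h)).re = 0 := by
    have h1 : ∑ v, (∑ᶠ h ∈ Γ.endsAt v, Γ.outDeriv u h) * starRingEnd ℂ (x v) =
        ∑ h, Γ.outDeriv u h * starRingEnd ℂ (Γ.endValue u h) := by
      simp only [finsum_endsAt, Finset.sum_mul, ite_mul, zero_mul]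
      rw [Finset.sum_comm]
      refine Finset.sum_congr rfl fun h _ => ?_
      rw [Finset.sum_ite_eq, if_pos (Finset.mem_univ _), hx]
    rw [← Complex.re_sum, ← h1]
    simp [fun v => (hk v).2]
  set a : E → ℝ := fun e => (d e 0 * starRingEnd ℂ (Γ.onEdge u e 0)).re
  set b : E → ℝ := fun e => (d e (Γ.len e) * starRingEnd ℂ (Γ.onEdge u e (Γ.len e))).re
  have hflux := fun e => (hd e).flux_mono hμ (Γ.len_pos e)
  have hsum' : ∑ e, (b e - a e) = 0 := by
    rw [Fintype.sum_prod_type] at hsum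
    rw [← neg_eq_zero, ← hsum, ← Finset.sum_neg_distrib]
    refine Finset.sum_congr rfl fun e _ => ?_
    rw [Fintype.sum_bool, outDeriv_eq (hd e), outDeriv_eq (hd e), endValue_true, endValue_false]
    simp only [if_true, Bool.false_eq_true, if_false, neg_mul, Complex.neg_re, a, b]
    ring
  have hzero := (Finset.sum_eq_zero_iff_of_nonneg fun e _ => sub_nonneg.2 (hflux e).1).1 hsum'
  ext e ⟨t, ht⟩
  rw [← onEdge_apply u e ht]
  exact (hflux e).2 (sub_eq_zero.1 (hzero e (Finset.mem_univ e))).symm t ht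

/-- The counting function is at most `N` to the left of `lam` and at least `N + 1` at `lam`, so
`lam` is entry `N + 1` of the list. Entries `1, …, N` are at most the largest element of `S`. -/
theorem firstIndex_eq [Finite E] {S : Finset ℝ} (hS : ∀ μ < lam, Γ.mult μ ≠ 0 → μ ∈ S)
    (hlt : ∀ μ ∈ S, μ < lam) (hlam : Γ.mult lam ≠ 0) :
    Γ.firstIndex lam = ∑ μ ∈ S, Γ.mult μ + 1 := by
  classical
  set N := ∑ μ ∈ S, Γ.mult μ with hN
  let A : Finset (ℝ × ℕ) :=
    (S.sigma fun ν => Finset.range (Γ.mult ν)).map (Equiv.sigmaEquivProd ℝ ℕ).toEmbedding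
  have hA : ∀ p : ℝ × ℕ, p ∈ A ↔ p.1 ∈ S ∧ p.2 < Γ.mult p.1 := by
    rintro ⟨ν, i⟩
    simp [A, Finset.mem_map_equiv]
  have hAcard : A.card = N := by simp [A, Finset.card_sigma, hN]
  have hle : ∀ μ < lam, Γ.countLE μ ≤ N := by
    intro μ hμ
    rw [← hAcard, ← Set.encard_coe_eq_coe_finsetCard]
    refine Set.encard_le_encard fun p hp => ?_
    exact (hA p).2 ⟨hS _ (hp.1.trans_lt hμ) (Nat.ne_zero_of_lt hp.2), hp.2⟩
  have hge : ∀ μ, (∀ ν ∈ S, ν ≤ μ) → (N : ℕ∞) ≤ Γ.countLE μ := by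
    intro μ hμ
    rw [← hAcard, ← Set.encard_coe_eq_coe_finsetCard]
    refine Set.encard_le_encard fun p hp => ?_
    have := (hA p).1 hp
    exact ⟨hμ _ this.1, this.2⟩
  have hgt : ((N + 1 : ℕ) : ℕ∞) ≤ Γ.countLE lam := by
    have hnot : ((lam, 0) : ℝ × ℕ) ∉ A := fun h => lt_irrefl _ (hlt _ ((hA _).1 h).1)
    rw [← hAcard, ← Finset.card_insert_of_notMem hnot, ← Set.encard_coe_eq_coe_finsetCard]
    refine Set.encard_le_encard fun p hp => ?_
    rcases Finset.mem_insert.1 (Finset.mem_coe.1 hp) with rfl | hp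
    · exact ⟨le_rfl, Nat.pos_of_ne_zero hlam⟩
    · exact ⟨(hlt _ ((hA p).1 hp).1).le, ((hA p).1 hp).2⟩
  -- For `k = 0` this set is the whole real line and `sInf` would be meaningless. For `k ≥ 1` each
  -- member lies above some eigenvalue, hence above the minimum of `insert lam S`.
  have hbdd : ∀ k : ℕ, 1 ≤ k → BddBelow {μ : ℝ | (k : ℕ∞) ≤ Γ.countLE μ} := by
    intro k hk
    obtain ⟨c, hc⟩ := (insert lam S).bddBelow
    refine ⟨c, fun μ hμ => ?_⟩
    have h1 : (0 : ℕ∞) < Γ.countLE μ :=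
      lt_of_lt_of_le (by exact_mod_cast hk) (show (k : ℕ∞) ≤ Γ.countLE μ from hμ)
    obtain ⟨p, hp⟩ := Set.encard_pos.1 h1
    refine le_trans ?_ hp.1
    rcases lt_or_ge p.1 lam with h | h
    · exact hc (Finset.mem_coe.2 (Finset.mem_insert_of_mem (hS _ h (Nat.ne_zero_of_lt hp.2))))
    · exact (hc (Finset.mem_coe.2 (Finset.mem_insert_self _ _))).trans h
  have hnth : Γ.nthEigenvalue (N + 1) = lam := by
    refine le_antisymm (csInf_le (hbdd _ (by omega)) hgt) (le_csInf ⟨lam, hgt⟩ fun μ hμ => ?_)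
    by_contra hlt'
    have : ((N + 1 : ℕ) : ℕ∞) ≤ N := le_trans hμ (hle μ (not_le.1 hlt'))
    have : N + 1 ≤ N := by exact_mod_cast this
    omega
  refine le_antisymm (Nat.sInf_le ⟨by omega, hnth⟩) (le_csInf ⟨_, by omega, hnth⟩ ?_)
  rintro k ⟨hk1, hk⟩
  by_contra hlt'
  -- From `1 ≤ k ≤ N` the sum `N` is positive.
  have hne : S.Nonempty := by
    rw [Finset.nonempty_iff_ne_empty]
    intro h
    simp only [h, Finset.sum_empty] at hN
    omega
  have h1 : Γ.nthEigenvalue k ≤ S.max' hne := by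
    refine csInf_le (hbdd k hk1) (le_trans ?_ (hge _ fun ν hν => S.le_max' ν hν))
    exact_mod_cast (by omega : k ≤ N)
  exact absurd (hk ▸ h1) (hlt _ (S.max'_mem hne)).not_ge

end Counting

end MetricGraph

namespace MetricGraph

/-! ### Subdivision -/

section Subdivision

variable {V E : Type*} {Γ : MetricGraph V E} {P : E → Set ℝ}

variable (Γ P) in
/-- The interior points at which the graph is subdivided. -/
abbrev InnerPt : Type _ := {p : E × ℝ // p.2 ∈ P p.1 ∩ Ioo 0 (Γ.len p.1)}

theorem marks_subset (e : E) : Γ.marks P e ⊆ Icc 0 (Γ.len e) := by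
  have := (Γ.len_pos e).le
  rintro x ((rfl | rfl) | h)
  · exact ⟨le_rfl, this⟩
  · exact ⟨this, le_rfl⟩
  · exact ⟨h.2.1.le, h.2.2.le⟩

theorem zero_mem_marks (e : E) : (0 : ℝ) ∈ Γ.marks P e := Or.inl (Or.inl rfl)

theorem len_mem_marks (e : E) : Γ.len e ∈ Γ.marks P e := Or.inl (Or.inr rfl)

theorem mem_inner_of_mem_marks {e : E} {x : ℝ} (hx : x ∈ Γ.marks P e) (h0 : x ≠ 0)
    (h1 : x ≠ Γ.len e) : x ∈ P e ∩ Ioo 0 (Γ.len e) := by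
  rcases hx with (h | h) | h
  · exact absurd h h0
  · exact absurd h h1
  · exact h

theorem subE_left_nonneg (s : Γ.SubE P) : 0 ≤ s.1.2.1 := (marks_subset _ s.2.1).1

theorem subE_right_le (s : Γ.SubE P) : s.1.2.2 ≤ Γ.len s.1.1 := (marks_subset _ s.2.2.1).2

/-- Of two different right ends, the nearer one would be a mark in the interior of the other piece.
-/
theorem subE_ext_left {s s' : Γ.SubE P} (he : s.1.1 = s'.1.1) (ha : s.1.2.1 = s'.1.2.1) :
    s = s' := by
  obtain ⟨⟨e, a, b⟩, h1, h2, h3, h4⟩ := s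
  obtain ⟨⟨e', a', b'⟩, h1', h2', h3', h4'⟩ := s'
  simp only at he ha h1 h2 h3 h4 h1' h2' h3' h4'
  subst he ha
  have : b = b' := by
    rcases lt_trichotomy b b' with h | h | h
    · exact absurd ⟨h3, h⟩ (h4' b h2)
    · exact h
    · exact absurd ⟨h3', h⟩ (h4 b' h2')
  subst this
  rfl

theorem subE_ext_right {s s' : Γ.SubE P} (he : s.1.1 = s'.1.1) (hb : s.1.2.2 = s'.1.2.2) :
    s = s' := by
  obtain ⟨⟨e, a, b⟩, h1, h2, h3, h4⟩ := s
  obtain ⟨⟨e', a', b'⟩, h1', h2', h3', h4'⟩ := s'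
  simp only at he hb h1 h2 h3 h4 h1' h2' h3' h4'
  subst he hb
  have : a = a' := by
    rcases lt_trichotomy a a' with h | h | h
    · exact absurd ⟨h, h3'⟩ (h4 a' h1')
    · exact h
    · exact absurd ⟨h, h3⟩ (h4' a h1)
  subst this
  rfl

theorem marks_finite (hP : ∀ e, (P e ∩ Ioo 0 (Γ.len e)).Finite) (e : E) :
    (Γ.marks P e).Finite :=
  (Set.toFinite {0, Γ.len e}).union (hP e)

/-- A point which is not the terminal point of its edge lies in a piece of the subdivision. -/
theorem exists_subE_left (hP : ∀ e, (P e ∩ Ioo 0 (Γ.len e)).Finite) {e : E} {x : ℝ}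
    (h0 : 0 ≤ x) (h1 : x < Γ.len e) :
    ∃ s : Γ.SubE P, s.1.1 = e ∧ s.1.2.1 ≤ x ∧ x < s.1.2.2 := by
  have hfin := marks_finite hP e
  obtain ⟨a, ha, hmax⟩ := Set.exists_max_image {y ∈ Γ.marks P e | y ≤ x} id
    (hfin.subset (sep_subset _ _)) ⟨0, zero_mem_marks e, h0⟩
  obtain ⟨b, hb, hmin⟩ := Set.exists_min_image {y ∈ Γ.marks P e | x < y} id
    (hfin.subset (sep_subset _ _)) ⟨_, len_mem_marks e, h1⟩
  refine ⟨⟨(e, a, b), ha.1, hb.1, ha.2.trans_lt hb.2, fun y hy hab => ?_⟩, rfl, ha.2, hb.2⟩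
  rcases le_or_gt y x with h | h
  · exact absurd (hmax y ⟨hy, h⟩) hab.1.not_ge
  · exact absurd (hmin y ⟨hy, h⟩) hab.2.not_ge

theorem exists_subE_start (hP : ∀ e, (P e ∩ Ioo 0 (Γ.len e)).Finite) {e : E} {x : ℝ}
    (hx : x ∈ Γ.marks P e) (h1 : x ≠ Γ.len e) : ∃ s : Γ.SubE P, s.1.1 = e ∧ s.1.2.1 = x := by
  have hm := marks_subset e hx
  obtain ⟨s, rfl, h2, h3⟩ := exists_subE_left hP hm.1 (lt_of_le_of_ne hm.2 h1)
  refine ⟨s, rfl, h2.antisymm (not_lt.1 fun h => s.2.2.2.2 x hx ⟨h, h3⟩)⟩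

theorem exists_subE_end (hP : ∀ e, (P e ∩ Ioo 0 (Γ.len e)).Finite) {e : E} {x : ℝ}
    (hx : x ∈ Γ.marks P e) (h1 : x ≠ 0) : ∃ s : Γ.SubE P, s.1.1 = e ∧ s.1.2.2 = x := by
  have hm := marks_subset e hx
  obtain ⟨a, ha, hmax⟩ := Set.exists_max_image {y ∈ Γ.marks P e | y < x} id
    ((marks_finite hP e).subset (sep_subset _ _)) ⟨0, zero_mem_marks e, lt_of_le_of_ne hm.1 h1.symm⟩
  exact ⟨⟨(e, a, x), ha.1, hx, ha.2, fun y hy hab =>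
    absurd (hmax y ⟨hy, hab.2⟩) hab.1.not_ge⟩, rfl, rfl⟩

/-- The coordinate in the original edge of an end of a piece. -/
def endCoord (h : Γ.SubE P × Bool) : ℝ := if h.2 then h.1.1.2.2 else h.1.1.2.1

theorem endCoord_mem (h : Γ.SubE P × Bool) : endCoord h ∈ Γ.marks P h.1.1.1 := by
  unfold endCoord
  split_ifs
  · exact h.1.2.2.1
  · exact h.1.2.1

open Classical in
/-- An end of a piece is an end of an original edge, or one of the two sides of a subdivision
point: `(p, false)` for the piece starting at `p` and `(p, true)` for the one ending there. -/
noncomputable def classifyEnd (h : Γ.SubE P × Bool) : (E × Bool) ⊕ (Γ.InnerPt P × Bool) :=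
  if h0 : endCoord h = 0 then .inl (h.1.1.1, false)
  else if h1 : endCoord h = Γ.len h.1.1.1 then .inl (h.1.1.1, true)
  else .inr (⟨(h.1.1.1, endCoord h), mem_inner_of_mem_marks (endCoord_mem h) h0 h1⟩, h.2)

variable (Γ P) in
/-- The vertex of the subdivided graph at a classified end. -/
def classVertex : (E × Bool) ⊕ (Γ.InnerPt P × Bool) → Γ.SubV P :=
  Sum.elim (fun h => .inl (Γ.endVertex h)) fun p => .inr p.1

theorem endVertex_subdivide (h : Γ.SubE P × Bool) :
    (Γ.subdivide P).endVertex h = Γ.classVertex P (classifyEnd h) := by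
  have key : (Γ.subdivide P).endVertex h = Γ.markVertex P h.1.1.1 (endCoord h) (endCoord_mem h) := by
    obtain ⟨s, b⟩ := h
    cases b <;> rfl
  rw [key]
  unfold markVertex classifyEnd classVertex
  split_ifs <;> rfl

/-- The side need not be recorded by the classification: since `a < b`, a left end never sits at the
terminal coordinate and a right end never at `0`. -/
theorem classifyEnd_eq_inl_iff (h : Γ.SubE P × Bool) (e : E) (b : Bool) :
    classifyEnd h = .inl (e, b) ↔
      h.1.1.1 = e ∧ h.2 = b ∧ endCoord h = if b then Γ.len e else 0 := by
  obtain ⟨s, c⟩ := h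
  have hL := Γ.len_pos s.1.1
  have ha := subE_left_nonneg s
  have hb := subE_right_le s
  have hab := s.2.2.2.1
  constructor
  · intro h
    unfold classifyEnd at h
    split_ifs at h with h0 h1
    · obtain ⟨rfl, rfl⟩ := Prod.mk.inj (Sum.inl.inj h)
      refine ⟨rfl, ?_, by simpa using h0⟩
      cases c
      · rfl
      · simp only [endCoord, if_true] at h0
        linarith
    · obtain ⟨rfl, rfl⟩ := Prod.mk.inj (Sum.inl.inj h)
      refine ⟨rfl, ?_, by simpa using h1⟩
      cases c
      · simp only [endCoord, Bool.false_eq_true, if_false] at h1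
        linarith
      · rfl
  · rintro ⟨rfl, rfl, h⟩
    unfold classifyEnd
    cases c
    · simp only [Bool.false_eq_true, if_false] at h
      rw [dif_pos h]
    · simp only [if_true] at h
      rw [dif_neg (by rw [h]; exact hL.ne'), dif_pos h]

theorem classifyEnd_eq_inr_iff (h : Γ.SubE P × Bool) (p : Γ.InnerPt P) (b : Bool) :
    classifyEnd h = .inr (p, b) ↔ h.1.1.1 = p.1.1 ∧ h.2 = b ∧ endCoord h = p.1.2 := by
  obtain ⟨⟨e, x⟩, hp⟩ := p
  constructor
  · intro h
    unfold classifyEnd at h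
    split_ifs at h with h0 h1
    obtain ⟨h2, h3⟩ := Prod.mk.inj (Sum.inr.inj h)
    obtain ⟨h4, h5⟩ := Prod.mk.inj (Subtype.mk.inj h2)
    exact ⟨h4, h3, h5⟩
  · rintro ⟨rfl, rfl, rfl⟩
    unfold classifyEnd
    rw [dif_neg hp.2.1.ne', dif_neg hp.2.2.ne]

theorem classifyEnd_injective : Function.Injective (classifyEnd (Γ := Γ) (P := P)) := by
  have key : ∀ h h' : Γ.SubE P × Bool, h.1.1.1 = h'.1.1.1 → h.2 = h'.2 →
      endCoord h = endCoord h' → h = h' := by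
    rintro ⟨s, b⟩ ⟨s', b'⟩ h1 h2 h3
    simp only at h1 h2
    subst h2
    cases b
    · rw [subE_ext_left h1 h3]
    · rw [subE_ext_right h1 h3]
  intro h h' hh
  rcases hc : classifyEnd h' with ⟨e, b⟩ | ⟨p, b⟩
  · obtain ⟨h1, h2, h3⟩ := (classifyEnd_eq_inl_iff h e b).1 (hh.trans hc)
    obtain ⟨h1', h2', h3'⟩ := (classifyEnd_eq_inl_iff h' e b).1 hc
    exact key h h' (h1.trans h1'.symm) (h2.trans h2'.symm) (h3.trans h3'.symm)
  · obtain ⟨h1, h2, h3⟩ := (classifyEnd_eq_inr_iff h p b).1 (hh.trans hc)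
    obtain ⟨h1', h2', h3'⟩ := (classifyEnd_eq_inr_iff h' p b).1 hc
    exact key h h' (h1.trans h1'.symm) (h2.trans h2'.symm) (h3.trans h3'.symm)

theorem classifyEnd_surjective (hP : ∀ e, (P e ∩ Ioo 0 (Γ.len e)).Finite) :
    Function.Surjective (classifyEnd (Γ := Γ) (P := P)) := by
  rintro (⟨e, b⟩ | ⟨p, b⟩)
  · cases b
    · obtain ⟨s, h1, h2⟩ := exists_subE_start hP (zero_mem_marks e) (Γ.len_pos e).ne
      exact ⟨(s, false), (classifyEnd_eq_inl_iff _ _ _).2 ⟨h1, rfl, by simpa [endCoord] using h2⟩⟩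
    · obtain ⟨s, h1, h2⟩ := exists_subE_end hP (len_mem_marks e) (Γ.len_pos e).ne'
      exact ⟨(s, true), (classifyEnd_eq_inl_iff _ _ _).2 ⟨h1, rfl, by simpa [endCoord] using h2⟩⟩
  · have hm : p.1.2 ∈ Γ.marks P p.1.1 := Or.inr p.2
    cases b
    · obtain ⟨s, h1, h2⟩ := exists_subE_start hP hm p.2.2.2.ne
      exact ⟨(s, false), (classifyEnd_eq_inr_iff _ _ _).2 ⟨h1, rfl, h2⟩⟩
    · obtain ⟨s, h1, h2⟩ := exists_subE_end hP hm p.2.2.1.ne'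
      exact ⟨(s, true), (classifyEnd_eq_inr_iff _ _ _).2 ⟨h1, rfl, h2⟩⟩

/-- The ends of the subdivided graph. -/
noncomputable def endEquiv (hP : ∀ e, (P e ∩ Ioo 0 (Γ.len e)).Finite) :
    Γ.SubE P × Bool ≃ (E × Bool) ⊕ (Γ.InnerPt P × Bool) :=
  Equiv.ofBijective classifyEnd ⟨classifyEnd_injective, classifyEnd_surjective hP⟩

theorem finite_innerPt [Finite E] (hP : ∀ e, (P e ∩ Ioo 0 (Γ.len e)).Finite) :
    Finite (Γ.InnerPt P) := by
  have : ∀ e, Finite ↥(P e ∩ Ioo 0 (Γ.len e)) := fun e => (hP e).to_subtype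
  refine Finite.of_injective
    (fun p : Γ.InnerPt P => (⟨p.1.1, ⟨p.1.2, p.2⟩⟩ : Σ e, ↥(P e ∩ Ioo 0 (Γ.len e)))) ?_
  rintro ⟨⟨e, x⟩, hp⟩ ⟨⟨e', x'⟩, hp'⟩ h
  simp only [Sigma.mk.injEq] at h
  obtain ⟨rfl, h⟩ := h
  simpa using h

theorem finite_subE [Finite E] (hP : ∀ e, (P e ∩ Ioo 0 (Γ.len e)).Finite) :
    Finite (Γ.SubE P) := by
  have := finite_innerPt hP
  have : Finite (Γ.SubE P × Bool) := Finite.of_injective classifyEnd classifyEnd_injective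
  exact Finite.of_injective (fun s => ((s, false) : Γ.SubE P × Bool)) fun s s' h => by simpa using h

/-- Count edge ends: each piece and each old edge has two, and each subdivision point has two sides.
-/
theorem card_subE [Finite E] (hP : ∀ e, (P e ∩ Ioo 0 (Γ.len e)).Finite) :
    Nat.card (Γ.SubE P) = Nat.card E + Nat.card (Γ.InnerPt P) := by
  have := finite_innerPt hP
  have h := Nat.card_congr (endEquiv hP)
  rw [Nat.card_sum, Nat.card_prod, Nat.card_prod, Nat.card_prod] at h
  simp only [Nat.card_eq_fintype_card (α := Bool), Fintype.card_bool] at h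
  omega

theorem endsAt_subdivide_inl (v : V) :
    (Γ.subdivide P).endsAt (.inl v) = classifyEnd ⁻¹' (Sum.inl '' Γ.endsAt v) := by
  ext h
  simp only [endsAt, mem_ofPred_eq, endVertex_subdivide, mem_preimage, mem_image]
  rcases classifyEnd h with h | h <;> simp [classVertex]

theorem endsAt_subdivide_inr (p : Γ.InnerPt P) :
    (Γ.subdivide P).endsAt (.inr p) =
      classifyEnd ⁻¹' ({.inr (p, false), .inr (p, true)} : Set ((E × Bool) ⊕ (_ × Bool))) := by
  ext h
  simp only [endsAt, mem_ofPred_eq, endVertex_subdivide, mem_preimage, mem_insert_iff,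
    mem_singleton_iff]
  rcases classifyEnd h with h | ⟨q, b⟩
  · simp [classVertex]
  · cases b <;> simp [classVertex]

theorem degree_subdivide_inl (hP : ∀ e, (P e ∩ Ioo 0 (Γ.len e)).Finite) (v : V) :
    (Γ.subdivide P).degree (.inl v) = Γ.degree v := by
  rw [degree, degree, endsAt_subdivide_inl, Set.ncard_preimage_of_injective_subset_range
    classifyEnd_injective (by simp [(classifyEnd_surjective hP).range_eq]),
    Set.ncard_image_of_injective _ Sum.inl_injective]

theorem degree_subdivide_inr (hP : ∀ e, (P e ∩ Ioo 0 (Γ.len e)).Finite) (p : Γ.InnerPt P) :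
    (Γ.subdivide P).degree (.inr p) = 2 := by
  rw [degree, endsAt_subdivide_inr, Set.ncard_preimage_of_injective_subset_range
    classifyEnd_injective (by simp [(classifyEnd_surjective hP).range_eq]),
    Set.ncard_pair (by simp)]

theorem exists_endVertex_subdivide (hP : ∀ e, (P e ∩ Ioo 0 (Γ.len e)).Finite)
    (hends : ∀ v, ∃ h, Γ.endVertex h = v) (v : Γ.SubV P) :
    ∃ h, (Γ.subdivide P).endVertex h = v := by
  simp only [endVertex_subdivide]
  rcases v with v | p
  · obtain ⟨h, rfl⟩ := hends v
    obtain ⟨k, hk⟩ := classifyEnd_surjective hP (.inl h)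
    exact ⟨k, by rw [hk]; rfl⟩
  · obtain ⟨k, hk⟩ := classifyEnd_surjective hP (.inr (p, false))
    exact ⟨k, by rw [hk]; rfl⟩

/-! #### Restriction of functions to the pieces -/

variable {μ : ℝ}

variable (Γ P) in
/-- A function on the graph as a function on the subdivided graph. -/
noncomputable def restrictFn : Γ.Fn →ₗ[ℂ] (Γ.subdivide P).Fn where
  toFun u s t := Γ.onEdge u s.1.1 (s.1.2.1 + t)
  map_add' _ _ := rfl
  map_smul' _ _ := rfl

theorem onEdge_restrictFn (u : Γ.Fn) (s : Γ.SubE P) {t : ℝ} (ht : t ∈ Icc 0 (s.1.2.2 - s.1.2.1)) :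
    (Γ.subdivide P).onEdge (Γ.restrictFn P u) s t = Γ.onEdge u s.1.1 (s.1.2.1 + t) :=
  onEdge_apply (Γ := Γ.subdivide P) (Γ.restrictFn P u) s ht

theorem isIntervalSol_restrictFn {u : Γ.Fn} (s : Γ.SubE P) {d : ℝ → ℂ}
    (hd : IsIntervalSol (Γ.len s.1.1) μ (Γ.onEdge u s.1.1) d) :
    IsIntervalSol ((Γ.subdivide P).len s) μ ((Γ.subdivide P).onEdge (Γ.restrictFn P u) s)
      fun t => d (s.1.2.1 + t) :=
  (hd.restrict (subE_left_nonneg s) (subE_right_le s)).congr fun _ ht => onEdge_restrictFn u s ht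

theorem solvesOnEdges_restrictFn {u : Γ.Fn} (hu : Γ.SolvesOnEdges μ u) :
    (Γ.subdivide P).SolvesOnEdges μ (Γ.restrictFn P u) :=
  solvesOnEdges_iff.2 fun s => by
    obtain ⟨d, hd⟩ := solvesOnEdges_iff.1 hu s.1.1
    exact ⟨_, isIntervalSol_restrictFn s hd⟩

theorem endValue_restrictFn (u : Γ.Fn) (h : Γ.SubE P × Bool) :
    (Γ.subdivide P).endValue (Γ.restrictFn P u) h = Γ.onEdge u h.1.1.1 (endCoord h) := by
  obtain ⟨s, b⟩ := h
  rw [endValue, onEdge_restrictFn u s (endPoint_mem (Γ := Γ.subdivide P) (s, b))]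
  cases b
  · simp [endPoint, endCoord]
  · simp [endPoint, endCoord, subdivide]

theorem outDeriv_restrictFn {u : Γ.Fn} (h : Γ.SubE P × Bool) {d : ℝ → ℂ}
    (hd : IsIntervalSol (Γ.len h.1.1.1) μ (Γ.onEdge u h.1.1.1) d) :
    (Γ.subdivide P).outDeriv (Γ.restrictFn P u) h =
      if h.2 then -d (endCoord h) else d (endCoord h) := by
  obtain ⟨s, b⟩ := h
  rw [outDeriv_eq (isIntervalSol_restrictFn s hd)]
  cases b <;> simp [endCoord, subdivide]

theorem endValue_restrictFn_inl (u : Γ.Fn) {h : Γ.SubE P × Bool} {k : E × Bool}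
    (hk : classifyEnd h = .inl k) :
    (Γ.subdivide P).endValue (Γ.restrictFn P u) h = Γ.endValue u k := by
  obtain ⟨h1, h2, h3⟩ := (classifyEnd_eq_inl_iff h k.1 k.2).1 hk
  rw [endValue_restrictFn, h3, h1]
  rfl

theorem outDeriv_restrictFn_inl {u : Γ.Fn} (hu : Γ.SolvesOnEdges μ u) {h : Γ.SubE P × Bool}
    {k : E × Bool} (hk : classifyEnd h = .inl k) :
    (Γ.subdivide P).outDeriv (Γ.restrictFn P u) h = Γ.outDeriv u k := by
  obtain ⟨e, b⟩ := k
  obtain ⟨h1, h2, h3⟩ := (classifyEnd_eq_inl_iff h e b).1 hk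
  subst h1
  obtain ⟨d, hd⟩ := solvesOnEdges_iff.1 hu h.1.1.1
  rw [outDeriv_restrictFn h hd, outDeriv_eq hd, h2, h3]
  cases b <;> rfl

theorem neumannKirchhoff_restrictFn_inl (hP : ∀ e, (P e ∩ Ioo 0 (Γ.len e)).Finite) {u : Γ.Fn}
    (hu : Γ.SolvesOnEdges μ u) (v : V) :
    (Γ.subdivide P).NeumannKirchhoff (Γ.restrictFn P u) (.inl v) ↔ Γ.NeumannKirchhoff u v := by
  let τ : E × Bool → Γ.SubE P × Bool := fun k => (endEquiv hP).symm (.inl k)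
  have hτ : ∀ k, classifyEnd (τ k) = .inl k := fun k => (endEquiv hP).apply_symm_apply _
  have hbij : BijOn τ (Γ.endsAt v) ((Γ.subdivide P).endsAt (.inl v)) := by
    rw [endsAt_subdivide_inl]
    refine ⟨fun k hk => ?_, fun k _ k' _ h => ?_, fun h hh => ?_⟩
    · rw [mem_preimage, hτ]
      exact mem_image_of_mem _ hk
    · exact Sum.inl_injective ((hτ k).symm.trans ((congrArg _ h).trans (hτ k')))
    · obtain ⟨k, hk, hk'⟩ := hh
      exact ⟨k, hk, classifyEnd_injective ((hτ k).trans hk')⟩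
  have hsum : ∑ᶠ h ∈ (Γ.subdivide P).endsAt (.inl v), (Γ.subdivide P).outDeriv (Γ.restrictFn P u) h =
      ∑ᶠ k ∈ Γ.endsAt v, Γ.outDeriv u k :=
    (finsum_mem_eq_of_bijOn τ hbij fun k _ => (outDeriv_restrictFn_inl hu (hτ k)).symm).symm
  rw [NeumannKirchhoff, NeumannKirchhoff, hsum, ← hbij.image_eq]
  simp only [forall_mem_image, endValue_restrictFn_inl u (hτ _)]

/-- The two outgoing derivatives are those of one differentiable function, taken in opposite
directions. -/
theorem neumannKirchhoff_restrictFn_inr {u : Γ.Fn} (hP : ∀ e, (P e ∩ Ioo 0 (Γ.len e)).Finite)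
    (hu : Γ.SolvesOnEdges μ u) (p : Γ.InnerPt P) :
    (Γ.subdivide P).NeumannKirchhoff (Γ.restrictFn P u) (.inr p) := by
  obtain ⟨d, hd⟩ := solvesOnEdges_iff.1 hu p.1.1
  obtain ⟨h₀, hh₀⟩ := classifyEnd_surjective hP (.inr (p, false))
  obtain ⟨h₁, hh₁⟩ := classifyEnd_surjective hP (.inr (p, true))
  have hends : (Γ.subdivide P).endsAt (.inr p) = {h₀, h₁} := by
    rw [endsAt_subdivide_inr, ← hh₀, ← hh₁]
    ext h
    simp [classifyEnd_injective.eq_iff]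
  have hne : h₀ ≠ h₁ := by
    rintro rfl
    simp [hh₀] at hh₁
  obtain ⟨a1, a2, a3⟩ := (classifyEnd_eq_inr_iff h₀ p false).1 hh₀
  obtain ⟨b1, b2, b3⟩ := (classifyEnd_eq_inr_iff h₁ p true).1 hh₁
  have hval : ∀ h ∈ (Γ.subdivide P).endsAt (.inr p),
      (Γ.subdivide P).endValue (Γ.restrictFn P u) h = Γ.onEdge u p.1.1 p.1.2 := by
    rw [hends]
    rintro h (rfl | rfl)
    · rw [endValue_restrictFn, a1, a3]
    · rw [endValue_restrictFn, b1, b3]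
  refine ⟨fun h hh h' hh' => by rw [hval h hh, hval h' hh'], ?_⟩
  rw [hends, finsum_mem_pair hne, outDeriv_restrictFn h₀ (d := d) (by rwa [a1]),
    outDeriv_restrictFn h₁ (d := d) (by rwa [b1]), a2, a3, b2, b3]
  simp

theorem restrictFn_injective (hP : ∀ e, (P e ∩ Ioo 0 (Γ.len e)).Finite) :
    Function.Injective (Γ.restrictFn P) := by
  refine (injective_iff_map_eq_zero _).2 fun u hu => ?_
  have hz : ∀ (s : Γ.SubE P) (x : ℝ), x ∈ Icc s.1.2.1 s.1.2.2 → Γ.onEdge u s.1.1 x = 0 := by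
    intro s x hx
    have h := onEdge_restrictFn u s (t := x - s.1.2.1)
      ⟨sub_nonneg.2 hx.1, sub_le_sub_right hx.2 _⟩
    rw [hu, add_sub_cancel] at h
    exact h.symm
  ext e ⟨x, hx⟩
  rw [← onEdge_apply u e hx]
  rcases hx.2.lt_or_eq with h | h
  · obtain ⟨s, rfl, h1, h2⟩ := exists_subE_left hP hx.1 h
    exact hz s x ⟨h1, h2.le⟩
  · obtain ⟨s, rfl, h1⟩ := exists_subE_end hP (len_mem_marks e) (Γ.len_pos e).ne'
    exact hz s x ⟨h.symm ▸ h1 ▸ s.2.2.2.1.le, h.trans_le h1.ge⟩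

/-- A solution on the pieces which is continuously differentiable at the subdivision points is
the restriction of a solution on the edges. -/
theorem exists_restrictFn_eq (hμ : 0 ≤ μ) (hP : ∀ e, (P e ∩ Ioo 0 (Γ.len e)).Finite)
    {w : (Γ.subdivide P).Fn} (hw : (Γ.subdivide P).SolvesOnEdges μ w)
    (hk : ∀ p, (Γ.subdivide P).NeumannKirchhoff w (.inr p)) :
    ∃ u, Γ.SolvesOnEdges μ u ∧ Γ.restrictFn P u = w := by
  choose d hd using solvesOnEdges_iff.1 hw
  -- The piece starting at coordinate `0` supplies the Cauchy data for a candidate `U` on the entire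
  -- edge.
  choose s₀ hs₀ hs₀' using fun e =>
    exists_subE_start hP (zero_mem_marks (Γ := Γ) (P := P) e) (Γ.len_pos e).ne
  set A : E → ℂ := fun e => (Γ.subdivide P).onEdge w (s₀ e) 0 with hA
  set B : E → ℂ := fun e => d (s₀ e) 0 with hB
  set U : E → ℝ → ℂ := fun e y => A e * cosSol μ (y - 0) + B e * sinSol μ (y - 0) with hU
  set D : E → ℝ → ℂ := fun e y => -μ * A e * sinSol μ (y - 0) + B e * cosSol μ (y - 0) with hD
  have hUD : ∀ e, IsIntervalSol (Γ.len e) μ (U e) (D e) := fun e =>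
    IsIntervalSol.of_coeffs hμ (Γ.len e) 0 (A e) (B e)
  have prop : ∀ s : Γ.SubE P, (Γ.subdivide P).onEdge w s 0 = U s.1.1 s.1.2.1 →
      d s 0 = D s.1.1 s.1.2.1 → ∀ t ∈ Icc 0 (s.1.2.2 - s.1.2.1),
        (Γ.subdivide P).onEdge w s t = U s.1.1 (s.1.2.1 + t) ∧ d s t = D s.1.1 (s.1.2.1 + t) := by
    intro s h1 h2 t ht
    have m0 : (0 : ℝ) ∈ Icc 0 (s.1.2.2 - s.1.2.1) := ⟨le_rfl, ht.1.trans ht.2⟩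
    have e1 := (hd s).eq_of_base hμ m0 ht
    have e2 := ((hUD s.1.1).restrict (subE_left_nonneg s) (subE_right_le s)).eq_of_base hμ m0 ht
    simp only [add_zero] at e2
    rw [e1.1, e1.2, e2.1, e2.2, h1, h2]
    exact ⟨rfl, rfl⟩
  have start : ∀ s : Γ.SubE P, (Γ.subdivide P).onEdge w s 0 = U s.1.1 s.1.2.1 ∧
      d s 0 = D s.1.1 s.1.2.1 := by
    by_contra! hbad
    obtain ⟨s, hs⟩ := hbad
    -- Propagation along the edge is phrased through a leftmost piece whose initial data disagree
    -- with `U`.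
    set bad : Set (Γ.SubE P) := {t | t.1.1 = s.1.1 ∧
      ¬ ((Γ.subdivide P).onEdge w t 0 = U t.1.1 t.1.2.1 ∧ d t 0 = D t.1.1 t.1.2.1)}
    have hfin : bad.Finite := by
      refine Set.Finite.of_finite_image (f := fun t => t.1.2.1)
        ((marks_finite hP s.1.1).subset ?_) fun t ht t' ht' h => ?_
      · rintro _ ⟨t, ht, rfl⟩
        exact ht.1 ▸ t.2.1
      · exact subE_ext_left (ht.1.trans ht'.1.symm) h
    obtain ⟨t, ht, hmin⟩ := Set.exists_min_image bad (fun t => t.1.2.1) hfin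
      ⟨s, rfl, fun h => hs h.1 h.2⟩
    by_cases h0 : t.1.2.1 = 0
    · have hts : t = s₀ t.1.1 := subE_ext_left (hs₀ _).symm (h0.trans (hs₀' _).symm)
      have key : ∀ e, (Γ.subdivide P).onEdge w (s₀ e) 0 = U e 0 ∧ d (s₀ e) 0 = D e 0 := fun e => by
        simp [hU, hD, hA, hB]
      apply ht.2
      have := key t.1.1
      rw [← hts] at this
      rwa [h0]
    · have hlt : t.1.2.1 < Γ.len t.1.1 := t.2.2.2.1.trans_le (subE_right_le t)
      -- The preceding piece `r` agrees with `U` up to its right end, and the Neumann-Kirchhoff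
      -- condition at the shared point hands value and derivative over to `t`.
      obtain ⟨r, hr1, hr2⟩ := exists_subE_end hP t.2.1 h0
      let p : Γ.InnerPt P := ⟨(t.1.1, t.1.2.1), mem_inner_of_mem_marks t.2.1 h0 hlt.ne⟩
      have hrgood : (Γ.subdivide P).onEdge w r 0 = U r.1.1 r.1.2.1 ∧ d r 0 = D r.1.1 r.1.2.1 := by
        by_contra h
        have := hmin r ⟨hr1.trans ht.1, h⟩
        exact this.not_gt (hr2 ▸ r.2.2.2.1)
      have hr3 := prop r hrgood.1 hrgood.2 (r.1.2.2 - r.1.2.1)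
        ⟨sub_nonneg.2 r.2.2.2.1.le, le_rfl⟩
      rw [add_sub_cancel, hr1, hr2] at hr3
      have c0 : classifyEnd (t, false) = .inr (p, false) :=
        (classifyEnd_eq_inr_iff _ _ _).2 ⟨rfl, rfl, rfl⟩
      have c1 : classifyEnd (r, true) = .inr (p, true) :=
        (classifyEnd_eq_inr_iff _ _ _).2 ⟨hr1, rfl, hr2⟩
      have hends : (Γ.subdivide P).endsAt (.inr p) = {(t, false), (r, true)} := by
        rw [endsAt_subdivide_inr, ← c0, ← c1]
        ext h
        simp [classifyEnd_injective.eq_iff]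
      obtain ⟨k1, k2⟩ := hk p
      rw [hends] at k1 k2
      rw [finsum_mem_pair (by simp), outDeriv_eq (hd t), outDeriv_eq (hd r)] at k2
      have v := k1 _ (mem_insert _ _) _ (mem_insert_of_mem _ rfl)
      rw [endValue_false, endValue_true] at v
      have hlen : (Γ.subdivide P).len r = t.1.2.1 - r.1.2.1 := by rw [← hr2]; rfl
      simp only [Bool.false_eq_true, if_false, if_true, hlen] at k2
      rw [hlen] at v
      refine ht.2 ⟨v.trans hr3.1, ?_⟩
      rw [← hr3.2]
      linear_combination k2
  refine ⟨fun e x => U e x, solvesOnEdges_iff.2 fun e => ⟨D e, (hUD e).congr fun x hx => ?_⟩, ?_⟩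
  · rw [onEdge_apply _ _ hx]
  · ext s ⟨t, ht⟩
    rw [← onEdge_apply (Γ := Γ.subdivide P) w s ht, (prop s (start s).1 (start s).2 t ht).1]
    exact onEdge_apply (Γ := Γ) (fun e x => U e x) s.1.1
      ⟨add_nonneg (subE_left_nonneg s) ht.1, (le_sub_iff_add_le'.1 ht.2).trans (subE_right_le s)⟩

theorem restrictFn_mem_eigenspace [Finite E] [Finite (Γ.SubE P)]
    (hP : ∀ e, (P e ∩ Ioo 0 (Γ.len e)).Finite) {u : Γ.Fn} (hu : u ∈ Γ.eigenspace μ) :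
    Γ.restrictFn P u ∈ (Γ.subdivide P).eigenspace μ := by
  refine ⟨solvesOnEdges_restrictFn hu.1, ?_⟩
  rintro (v | p)
  · exact (neumannKirchhoff_restrictFn_inl hP hu.1 v).2 (hu.2 v)
  · exact neumannKirchhoff_restrictFn_inr hP hu.1 p

/-- Neumann-Kirchhoff conditions at a subdivision point are exactly C¹ matching, so restriction to
the pieces identifies the two eigenspaces. -/
theorem mult_subdivide [Finite E] [Finite (Γ.SubE P)]
    (hP : ∀ e, (P e ∩ Ioo 0 (Γ.len e)).Finite) (hμ : 0 ≤ μ) :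
    (Γ.subdivide P).mult μ = Γ.mult μ := by
  have h : (Γ.subdivide P).eigenspace μ = (Γ.eigenspace μ).map (Γ.restrictFn P) := by
    ext w
    rw [Submodule.mem_map]
    constructor
    · rintro ⟨hw, hk⟩
      obtain ⟨u, hu, rfl⟩ := exists_restrictFn_eq hμ hP hw fun p => hk (.inr p)
      exact ⟨u, ⟨hu, fun v => (neumannKirchhoff_restrictFn_inl hP hu v).1 (hk (.inl v))⟩, rfl⟩
    · rintro ⟨u, hu, rfl⟩
      exact restrictFn_mem_eigenspace hP hu
  rw [mult, mult, h]
  exact (Submodule.equivMapOfInjective _ (restrictFn_injective hP) _).finrank_eq.symm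

end Subdivision

end MetricGraph

namespace MetricGraph

/-! ### Nodal domains -/

section Nodal

variable {V E : Type*} {Γ : MetricGraph V E} {μ lam : ℝ} {f : Γ.Fn}

theorem IsConnected.induction (hΓ : Γ.IsConnected) {p : V → Prop}
    (hp : ∀ e, p (Γ.src e) ↔ p (Γ.tgt e)) {v : V} (hv : p v) (w : V) : p w := by
  have hsub : Subsingleton Γ.Components :=
    (Nat.card_eq_one_iff_unique.1 (show Nat.card Γ.Components = 1 from hΓ)).1
  let q : Γ.Components → Prop := Quot.lift p fun v w h => by
    obtain ⟨e, rfl, rfl⟩ := h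
    exact propext (hp e)
  let mk : V → Γ.Components := Quot.mk _
  have : q (mk v) = q (mk w) := by rw [hsub.elim (mk v) (mk w)]
  exact this.mp hv

theorem IsConnected.exists_end [Nonempty E] (hΓ : Γ.IsConnected) (v : V) :
    ∃ h, Γ.endVertex h = v := by
  obtain ⟨e⟩ := ‹Nonempty E›
  refine hΓ.induction (p := fun v => ∃ h, Γ.endVertex h = v) (fun e => ?_) ⟨(e, false), rfl⟩ v
  exact iff_of_true ⟨(e, false), rfl⟩ ⟨(e, true), rfl⟩

/-- Cauchy data at the initial ends determine a solution. Without finiteness `finrank` could be `0`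
on a nonzero eigenspace. -/
theorem finiteDimensional_eigenspace [Finite E] (hμ : 0 ≤ μ) :
    FiniteDimensional ℂ (Γ.eigenspace μ) := by
  let φ : Γ.eigenspace μ →ₗ[ℂ] (E → ℂ × ℂ) :=
    { toFun := fun u e => (Γ.endValue u.1 (e, false), Γ.outDeriv u.1 (e, false))
      map_add' := fun u w => by
        ext e
        · rfl
        · exact outDeriv_add u.2.1 w.2.1 _
      map_smul' := fun c u => by
        ext e
        · rfl
        · exact outDeriv_smul c u.2.1 _ }
  refine FiniteDimensional.of_injective φ ((injective_iff_map_eq_zero φ).2 fun u hu => ?_)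
  ext e ⟨x, hx⟩
  obtain ⟨d, hd⟩ := solvesOnEdges_iff.1 u.2.1 e
  have h1 : Γ.onEdge u.1 e 0 = 0 := congrArg Prod.fst (congrFun hu e)
  have h2 : Γ.outDeriv u.1 (e, false) = 0 := congrArg Prod.snd (congrFun hu e)
  rw [outDeriv_eq hd] at h2
  simp only [Bool.false_eq_true, if_false] at h2
  rw [← onEdge_apply u.1 e hx, (hd.eq_of_base hμ ⟨le_rfl, (Γ.len_pos e).le⟩ hx).1, h1, h2]
  simp

theorem mult_ne_zero [Finite E] (hμ : 0 ≤ μ) (hf : Γ.IsEigenpair μ f) : Γ.mult μ ≠ 0 := by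
  have := finiteDimensional_eigenspace (Γ := Γ) hμ
  intro h
  have := Submodule.finrank_eq_zero.1 h
  exact hf.2 ((Submodule.mem_bot ℂ).1 (this ▸ hf.1))

/-- A solution with vanishing Cauchy data at an end of an edge vanishes on the edge. -/
theorem eq_zero_of_end (hμ : 0 ≤ μ) (hf : Γ.SolvesOnEdges μ f) {h : E × Bool}
    (h0 : Γ.endValue f h = 0) (h1 : Γ.outDeriv f h = 0) :
    ∀ x ∈ Icc 0 (Γ.len h.1), Γ.onEdge f h.1 x = 0 := by
  intro x hx
  obtain ⟨e, b⟩ := h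
  obtain ⟨d, hd⟩ := solvesOnEdges_iff.1 hf e
  have hm := Γ.endPoint_mem (e, b)
  have h2 : d (Γ.endPoint (e, b)) = 0 := by
    rw [outDeriv_eq hd] at h1
    cases b
    · simpa [endPoint] using h1
    · simpa [endPoint] using h1
  change Γ.onEdge f e (Γ.endPoint (e, b)) = 0 at h0
  rw [(hd.eq_of_base hμ hm hx).1, h0, h2]
  simp

theorem end_eq_zero_of_eq_zero {h : E × Bool}
    (hz : ∀ x ∈ Icc 0 (Γ.len h.1), Γ.onEdge f h.1 x = 0) :
    Γ.endValue f h = 0 ∧ Γ.outDeriv f h = 0 := by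
  refine ⟨hz _ (Γ.endPoint_mem h), ?_⟩
  have : derivWithin (Γ.onEdge f h.1) (Icc 0 (Γ.len h.1)) (Γ.endPoint h) = 0 := by
    rw [derivWithin_congr (f := fun _ => 0) hz (hz _ (Γ.endPoint_mem h))]
    simp
  rw [outDeriv, this, mul_zero]

theorem vanishesAt_iff (hk : ∀ v, Γ.NeumannKirchhoff f v) (h : E × Bool) :
    Γ.VanishesAt f (Γ.endVertex h) ↔ Γ.endValue f h = 0 := by
  constructor
  · rintro ⟨h', hh', h0⟩
    rw [(hk _).1 h rfl h' hh', h0]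
  · exact fun h0 => ⟨h, rfl, h0⟩

/-- An eigenfunction which does not vanish at the branching points vanishes identically on no
edge. -/
theorem exists_ne_zero_on_edge [Finite E] (hΓ : Γ.IsConnected) (hμ : 0 ≤ μ)
    (hf : Γ.IsEigenpair μ f) (hgen : ∀ v, 2 < Γ.degree v → ¬ Γ.VanishesAt f v) (e : E) :
    ¬ ∀ x ∈ Icc 0 (Γ.len e), Γ.onEdge f e x = 0 := by
  intro he
  obtain ⟨⟨hsol, hk⟩, hne⟩ := hf
  let Z : E → Prop := fun e => ∀ x ∈ Icc 0 (Γ.len e), Γ.onEdge f e x = 0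
  -- A zero edge forces `f` to vanish at `v`, hence degree at most two. The only possible other end
  -- then inherits zero value and, by current conservation, zero derivative.
  have spread : ∀ v, ∀ h ∈ Γ.endsAt v, Z h.1 → ∀ h' ∈ Γ.endsAt v, Z h'.1 := by
    intro v h hh hz h' hh'
    by_cases heq : h = h'
    · exact heq ▸ hz
    obtain ⟨z0, z1⟩ := end_eq_zero_of_eq_zero hz
    have hdeg : Γ.degree v ≤ 2 := not_lt.1 fun hlt => hgen v hlt ⟨h, hh, z0⟩
    have hends : {h, h'} = Γ.endsAt v := by
      refine Set.eq_of_subset_of_ncard_le ?_ ?_ (toFinite _)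
      · rintro k (rfl | rfl)
        · exact hh
        · exact hh'
      · rw [Set.ncard_pair heq]
        exact hdeg
    have hsum := (hk v).2
    rw [← hends, finsum_mem_pair heq, z1, zero_add] at hsum
    exact eq_zero_of_end hμ hsol (((hk v).1 h' hh' h hh).trans z0) hsum
  have hall : ∀ v, ∃ h ∈ Γ.endsAt v, Z h.1 := by
    refine hΓ.induction (p := fun v => ∃ h ∈ Γ.endsAt v, Z h.1) (fun e => ⟨?_, ?_⟩)
      (v := Γ.src e) ⟨(e, false), rfl, he⟩
    · rintro ⟨h, hh, hz⟩
      exact ⟨(e, true), rfl, spread _ h hh hz (e, false) rfl⟩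
    · rintro ⟨h, hh, hz⟩
      exact ⟨(e, false), rfl, spread _ h hh hz (e, true) rfl⟩
  apply hne
  ext e ⟨x, hx⟩
  obtain ⟨h, hh, hz⟩ := hall (Γ.src e)
  rw [← onEdge_apply f e hx]
  exact spread _ h hh hz (e, false) rfl x hx

/-- At a vertex of degree one, current conservation is a vanishing derivative; together with a zero
value this would kill `f` on the whole edge. -/
theorem degree_eq_two_of_vanishesAt [Finite E] (hΓ : Γ.IsConnected) (hμ : 0 ≤ μ)
    (hf : Γ.IsEigenpair μ f) (hgen : ∀ v, 2 < Γ.degree v → ¬ Γ.VanishesAt f v) {v : V}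
    (hv : Γ.VanishesAt f v) : Γ.degree v = 2 := by
  have h2 : Γ.degree v ≤ 2 := not_lt.1 fun hlt => hgen v hlt hv
  obtain ⟨h, hh, h0⟩ := hv
  have hpos : 0 < Γ.degree v := (Set.ncard_pos (toFinite _)).2 ⟨h, hh⟩
  by_contra hne
  obtain ⟨k, hk⟩ := Set.ncard_eq_one.1 (show (Γ.endsAt v).ncard = 1 by
    change Γ.degree v = 1
    omega)
  obtain rfl : h = k := by
    rw [hk] at hh
    exact hh
  have hsum := (hf.1.2 v).2
  rw [hk, finsum_mem_singleton] at hsum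
  exact exists_ne_zero_on_edge hΓ hμ hf hgen h.1 (eq_zero_of_end hμ hf.1.1 h0 hsum)

/-! ### Zeros on an edge and the pieces between them -/

theorem mem_edgeZeros {e : E} {x : ℝ} (hx : x ∈ Icc 0 (Γ.len e)) :
    x ∈ Γ.edgeZeros f e ↔ Γ.onEdge f e x = 0 := by
  rw [onEdge_apply f e hx]
  exact ⟨fun ⟨_, h⟩ => h, fun h => ⟨hx, h⟩⟩

/-- Based at one zero, `f` is a nonzero multiple of `sinSol`, so all zeros lie on an arithmetic
progression with step `π/√lam`. -/
theorem finite_edgeZeros (hlam : 0 < lam) (hf : Γ.SolvesOnEdges lam f) {e : E}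
    (hne : ¬ ∀ x ∈ Icc 0 (Γ.len e), Γ.onEdge f e x = 0) : (Γ.edgeZeros f e).Finite := by
  rcases (Γ.edgeZeros f e).eq_empty_or_nonempty with h | ⟨x₀, hx₀⟩
  · rw [h]
    exact finite_empty
  obtain ⟨d, hd⟩ := solvesOnEdges_iff.1 hf e
  have hk : 0 < √lam := Real.sqrt_pos.2 hlam
  have hπ := Real.pi_pos
  have hm : x₀ ∈ Icc 0 (Γ.len e) := hx₀.1
  have h0 := (mem_edgeZeros hm).1 hx₀
  have hd0 : d x₀ ≠ 0 := fun h => hne fun x hx => by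
    rw [(hd.eq_of_base hlam.le hm hx).1, h0, h]
    simp
  obtain ⟨N, hN⟩ := exists_int_gt (√lam * Γ.len e / Real.pi)
  refine ((Set.finite_Icc (-N) N).image fun n : ℤ => x₀ + n * Real.pi / √lam).subset ?_
  intro y hy
  have hym : y ∈ Icc 0 (Γ.len e) := hy.1
  have hs : sinSol lam (y - x₀) = 0 := by
    have := (hd.eq_of_base hlam.le hm hym).1
    rw [(mem_edgeZeros hym).1 hy, h0, zero_mul, zero_add] at this
    exact_mod_cast (mul_eq_zero.1 this.symm).resolve_left hd0
  have hsin : Real.sin (√lam * (y - x₀)) = 0 := by rw [← sqrt_mul_sinSol, hs, mul_zero]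
  obtain ⟨n, hn⟩ := Real.sin_eq_zero_iff.1 hsin
  rw [div_lt_iff₀ hπ] at hN
  have h1 : √lam * (y - x₀) ≤ √lam * Γ.len e := by
    gcongr
    linarith [hym.2, hm.1]
  have h2 : -(√lam * Γ.len e) ≤ √lam * (y - x₀) := by
    rw [← mul_neg]
    gcongr
    linarith [hym.1, hm.2]
  refine ⟨n, ⟨?_, ?_⟩, ?_⟩
  · have : (-N : ℝ) * Real.pi < n * Real.pi := by rw [hn]; linarith
    have := lt_of_mul_lt_mul_right this hπ.le
    exact_mod_cast this.le
  · have : (n : ℝ) * Real.pi < N * Real.pi := by rw [hn]; linarith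
    have := lt_of_mul_lt_mul_right this hπ.le
    exact_mod_cast this.le
  · simp only [hn]
    field_simp
    ring

/-- A piece between consecutive zeros or vertices has length at most half a period, and a full
half period only between two zeros. -/
theorem nodal_piece_length (hlam : 0 < lam) (hf : Γ.SolvesOnEdges lam f)
    (hreal : ∀ e x, (f e x).im = 0) (s : Γ.SubE (Γ.edgeZeros f))
    (hs : Real.pi ≤ √lam * (s.1.2.2 - s.1.2.1)) :
    Γ.onEdge f s.1.1 s.1.2.1 = 0 ∧ Γ.onEdge f s.1.1 s.1.2.2 = 0 ∧
      √lam * (s.1.2.2 - s.1.2.1) = Real.pi := by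
  obtain ⟨⟨e, a, b⟩, ha, hb, hab, hcons⟩ := s
  simp only at ha hb hab hcons hs ⊢
  obtain ⟨d, hd⟩ := solvesOnEdges_iff.1 hf e
  have hk : 0 < √lam := Real.sqrt_pos.2 hlam
  have hπ := Real.pi_pos
  have ma := marks_subset e ha
  have mb := marks_subset e hb
  have hnz : ∀ y ∈ Ioo a b, Γ.onEdge f e y ≠ 0 := by
    intro y hy h0
    have hy1 : 0 < y := ma.1.trans_lt hy.1
    have hy2 : y < Γ.len e := hy.2.trans_le mb.2
    exact hcons y (Or.inr ⟨(mem_edgeZeros ⟨hy1.le, hy2.le⟩).2 h0, hy1, hy2⟩) hy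
  -- Half a period after `a` a solution takes the value `-f(a)`. If `f(a) ≠ 0`, the intermediate
  -- value theorem gives a zero strictly between `a` and `c`, inside the piece. So `f(a) = 0`, hence
  -- `f(c) = 0`, and `c` must be the right end.
  set c := a + Real.pi / √lam with hc
  have hac : a < c := by rw [hc]; linarith [div_pos hπ hk]
  have hcb : c ≤ b := by
    rw [hc, ← le_sub_iff_add_le', div_le_iff₀ hk]
    linarith
  have mc : c ∈ Icc 0 (Γ.len e) := ⟨ma.1.trans hac.le, hcb.trans mb.2⟩
  have harg : √lam * (c - a) = Real.pi := by rw [hc]; field_simp; ring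
  have hcos : cosSol lam (c - a) = -1 := by rw [cosSol, harg, Real.cos_pi]
  have hsin : sinSol lam (c - a) = 0 := by
    have := sqrt_mul_sinSol lam (c - a)
    rw [harg, Real.sin_pi] at this
    exact (mul_eq_zero.1 this).resolve_left hk.ne'
  have hwc : Γ.onEdge f e c = -Γ.onEdge f e a := by
    rw [(hd.eq_of_base hlam.le ma mc).1, hcos, hsin]
    simp
  have hre : ∀ y ∈ Icc 0 (Γ.len e), (Γ.onEdge f e y = 0 ↔ (Γ.onEdge f e y).re = 0) := by
    intro y hy
    rw [Complex.ext_iff, onEdge_apply f e hy]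
    simp [hreal]
  have hsub : Icc a c ⊆ Icc 0 (Γ.len e) := fun y hy => ⟨ma.1.trans hy.1, hy.2.trans mc.2⟩
  have hcont : ContinuousOn (fun y => (Γ.onEdge f e y).re) (Icc a c) :=
    Complex.continuous_re.comp_continuousOn
      fun y hy => ((hd y (hsub hy)).1.continuousWithinAt).mono hsub
  have hfa : Γ.onEdge f e a = 0 := by
    by_contra hfa
    have hra : (Γ.onEdge f e a).re ≠ 0 := fun h => hfa ((hre a ma).2 h)
    have hrc : (Γ.onEdge f e c).re = -(Γ.onEdge f e a).re := by rw [hwc]; rfl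
    have : ∃ y ∈ Ioo a c, (Γ.onEdge f e y).re = 0 := by
      rcases lt_or_gt_of_ne hra with h | h
      · exact intermediate_value_Ioo hac.le hcont ⟨h, by simp only [hrc]; linarith⟩
      · exact intermediate_value_Ioo' hac.le hcont ⟨by simp only [hrc]; linarith, h⟩
    obtain ⟨y, hy, hy0⟩ := this
    exact hnz y ⟨hy.1, hy.2.trans_le hcb⟩ ((hre y (hsub ⟨hy.1.le, hy.2.le⟩)).2 hy0)
  have hfc : Γ.onEdge f e c = 0 := by rw [hwc, hfa, neg_zero]
  have hcb' : c = b := hcb.eq_of_not_lt fun h => hnz c ⟨hac, h⟩ hfc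
  exact ⟨hfa, hcb' ▸ hfc, hcb' ▸ harg⟩

theorem endVertex_mem_nodalSet_iff (hk : ∀ v, Γ.NeumannKirchhoff f v)
    (h : Γ.SubE (Γ.edgeZeros f) × Bool) :
    (Γ.nodalSubdivision f).endVertex h ∈ Γ.nodalSet f ↔
      Γ.onEdge f h.1.1.1 (endCoord h) = 0 := by
  rw [nodalSubdivision, endVertex_subdivide]
  rcases hc : classifyEnd h with ⟨e, b⟩ | ⟨p, b⟩
  · rw [← endValue_restrictFn, endValue_restrictFn_inl f hc, ← vanishesAt_iff hk]
    simp [classVertex, nodalSet]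
  · obtain ⟨h1, -, h3⟩ := (classifyEnd_eq_inr_iff h p b).1 hc
    refine iff_of_true (by simp [classVertex, nodalSet]) ?_
    rw [h1, h3]
    exact (mem_edgeZeros p.2.1.1).1 p.2.1

theorem len_lt_of_endVertex_notMem (hlam : 0 < lam) (hf : Γ.SolvesOnEdges lam f)
    (hk : ∀ v, Γ.NeumannKirchhoff f v) (hreal : ∀ e x, (f e x).im = 0)
    (h : Γ.SubE (Γ.edgeZeros f) × Bool)
    (hh : (Γ.nodalSubdivision f).endVertex h ∉ Γ.nodalSet f) :
    √lam * (Γ.nodalSubdivision f).len h.1 < Real.pi := by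
  rw [endVertex_mem_nodalSet_iff hk] at hh
  by_contra hlt
  obtain ⟨h1, h2, -⟩ := nodal_piece_length hlam hf hreal h.1 (not_lt.1 hlt)
  obtain ⟨s, b⟩ := h
  cases b
  · exact hh h1
  · exact hh h2

/-- Every piece of the nodal subdivision ends at a nodal point. -/
theorem nodal_piece_meets (hlam : 0 < lam) (hf : Γ.SolvesOnEdges lam f)
    (hk : ∀ v, Γ.NeumannKirchhoff f v) (hreal : ∀ e x, (f e x).im = 0)
    (hlen : ∀ e, Real.pi < √lam * Γ.len e) (s : Γ.SubE (Γ.edgeZeros f)) :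
    (Γ.nodalSubdivision f).src s ∈ Γ.nodalSet f ∨ (Γ.nodalSubdivision f).tgt s ∈ Γ.nodalSet f := by
  by_contra! hcon
  have hlt := len_lt_of_endVertex_notMem hlam hf hk hreal (s, false) hcon.1
  have ha : Γ.onEdge f s.1.1 s.1.2.1 ≠ 0 := fun h =>
    hcon.1 ((endVertex_mem_nodalSet_iff hk (s, false)).2 h)
  have hb : Γ.onEdge f s.1.1 s.1.2.2 ≠ 0 := fun h =>
    hcon.2 ((endVertex_mem_nodalSet_iff hk (s, true)).2 h)
  have hab := s.2.2.2.1
  -- Interior marks are zeros, so a piece without nodal ends is a whole original edge, which is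
  -- longer than `π/√lam`.
  have key : ∀ x ∈ Γ.marks (Γ.edgeZeros f) s.1.1, Γ.onEdge f s.1.1 x ≠ 0 →
      x = 0 ∨ x = Γ.len s.1.1 := by
    intro x hx hne
    by_contra! h
    have := mem_inner_of_mem_marks hx h.1 h.2
    exact hne ((mem_edgeZeros this.1.1).1 this.1)
  have ha' : s.1.2.1 = 0 := (key _ s.2.1 ha).resolve_right fun h => by
    linarith [subE_right_le s]
  have hb' : s.1.2.2 = Γ.len s.1.1 := (key _ s.2.2.1 hb).resolve_left fun h => by
    linarith [subE_left_nonneg s]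
  have : (Γ.nodalSubdivision f).len s = Γ.len s.1.1 := by
    change s.1.2.2 - s.1.2.1 = _
    rw [ha', hb', sub_zero]
  exact (hlen s.1.1).not_gt (this ▸ hlt)

/-- At a vertex inside a nodal domain the Dirichlet problem on the surrounding star has the
eigenvalue `lam`. -/
theorem sum_diagCoef_eq_zero [Fintype (Γ.SubE (Γ.edgeZeros f))]
    [DecidableEq (Γ.SubV (Γ.edgeZeros f))] (hlam : 0 < lam) (hf : Γ.SolvesOnEdges lam f)
    (hk : ∀ v, Γ.NeumannKirchhoff f v) (hreal : ∀ e x, (f e x).im = 0)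
    (hlen : ∀ e, Real.pi < √lam * Γ.len e) (hends : ∀ v, ∃ h, Γ.endVertex h = v)
    (hP : ∀ e, (Γ.edgeZeros f e ∩ Ioo 0 (Γ.len e)).Finite)
    {v : Γ.SubV (Γ.edgeZeros f)} (hv : v ∉ Γ.nodalSet f) :
    ∑ h, (if (Γ.nodalSubdivision f).endVertex h = v then
      diagCoef ((Γ.nodalSubdivision f).len h.1) lam else 0) = 0 := by
  let u : (Γ.nodalSubdivision f).Fn := Γ.restrictFn (Γ.edgeZeros f) f
  have hu : (Γ.nodalSubdivision f).SolvesOnEdges lam u := solvesOnEdges_restrictFn hf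
  have huk : (Γ.nodalSubdivision f).NeumannKirchhoff u v := by
    rcases v with v | p
    · exact (neumannKirchhoff_restrictFn_inl hP hf v).2 (hk v)
    · exact neumannKirchhoff_restrictFn_inr hP hf p
  have hval : ∀ h, (Γ.nodalSubdivision f).endValue u h = 0 ↔
      (Γ.nodalSubdivision f).endVertex h ∈ Γ.nodalSet f := fun h => by
    rw [endVertex_mem_nodalSet_iff hk, ← endValue_restrictFn]
    rfl
  obtain ⟨h₀, hh₀⟩ := exists_endVertex_subdivide hP hends v
  change (Γ.nodalSubdivision f).endVertex h₀ = v at hh₀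
  set c := (Γ.nodalSubdivision f).endValue u h₀
  have hc : c ≠ 0 := fun h => hv (hh₀ ▸ (hval h₀).1 h)
  have hsum := huk.2
  rw [finsum_endsAt] at hsum
  -- The far end of every piece at `v` is nodal, so its outgoing derivative at `v` is `-diagCoef`
  -- times the common nonzero value `c`. Summing turns current conservation into the claim.
  have heq : ∀ h, (if (Γ.nodalSubdivision f).endVertex h = v then
      (Γ.nodalSubdivision f).outDeriv u h else 0) =
      -c * ((if (Γ.nodalSubdivision f).endVertex h = v then
        diagCoef ((Γ.nodalSubdivision f).len h.1) lam else 0 : ℝ) : ℂ) := by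
    intro h
    split_ifs with hh
    · have hflip : (Γ.nodalSubdivision f).endValue u (flip h) = 0 := by
        rw [hval]
        obtain ⟨s, b⟩ := h
        rcases nodal_piece_meets hlam hf hk hreal hlen s with h1 | h1
        · cases b
          · exact absurd (show v ∈ Γ.nodalSet f from hh ▸ h1) hv
          · exact h1
        · cases b
          · exact h1
          · exact absurd (show v ∈ Γ.nodalSet f from hh ▸ h1) hv
      rw [outDeriv_eq_coef hlam.le hu h
        (len_lt_of_endVertex_notMem hlam hf hk hreal h (by rwa [hh])), hflip,
        huk.1 h hh h₀ hh₀]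
      ring
    · simp
  rw [Finset.sum_congr rfl fun h _ => heq h, ← Finset.mul_sum, ← Complex.ofReal_sum,
    mul_eq_zero] at hsum
  exact_mod_cast hsum.resolve_left (neg_ne_zero.2 hc)

end Nodal

end MetricGraph

/-! ### Assembly of the spectral count and the Euler characteristics -/

theorem mainTheorem2 {V E : Type*} [Finite V] [Finite E] (Γ : MetricGraph V E)
    (hΓ : Γ.IsConnected) (lam : ℝ) (f : Γ.Fn) (hf : Γ.IsEigenpair lam f)
    (hlam : (Real.pi / Γ.minLen) ^ 2 < lam)
    (hreal : ∀ e x, (f e x).im = 0)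
    (hgen : ∀ v, 2 < Γ.degree v → ¬ Γ.VanishesAt f v) :
    (Γ.nodalSet f).Finite ∧ (Γ.nodalGraph f).betti = 0 ∧
      ∀ᶠ ε in 𝓝[>] (0 : ℝ),
        ∃ Λ : (Γ.nodalSet f → ℂ) →ₗ[ℂ] (Γ.nodalSet f → ℂ),
          (Γ.nodalSubdivision f).IsDtNMap (Γ.nodalSet f) (lam - ε) Λ ∧
          (Γ.firstIndex lam : ℤ) - Γ.numNodalDomains f = Γ.betti - positiveIndex Λ := by
  classical
  have hlam0 : 0 < lam := (sq_nonneg _).trans_lt hlam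
  -- Needed for the infimum `minLen` to be attained, hence positive, and for every vertex of the
  -- connected graph to carry an edge end.
  have hE : Nonempty E := by
    by_contra hE
    rw [not_nonempty_iff] at hE
    exact hf.2 (funext fun e => hE.elim e)
  have hlen : ∀ e, Real.pi < √lam * Γ.len e := by
    intro e
    have hmin : 0 < Γ.minLen := by
      obtain ⟨e', he'⟩ := exists_eq_ciInf_of_finite (f := Γ.len)
      exact (Γ.len_pos e').trans_eq he'
    have hle : Γ.minLen ≤ Γ.len e := ciInf_le (Set.finite_range Γ.len).bddBelow e
    have h1 : Real.pi / Γ.minLen < √lam := Real.lt_sqrt_of_sq_lt hlam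
    rw [div_lt_iff₀ hmin] at h1
    exact h1.trans_le (by gcongr)
  obtain ⟨hsol, hk⟩ := hf.1
  have hends := fun v => hΓ.exists_end v
  have hP : ∀ e, (Γ.edgeZeros f e ∩ Ioo 0 (Γ.len e)).Finite := fun e =>
    (MetricGraph.finite_edgeZeros hlam0 hsol
      (MetricGraph.exists_ne_zero_on_edge hΓ hlam0.le hf hgen e)).subset inter_subset_left
  have hfinI := MetricGraph.finite_innerPt hP
  have hfinE := MetricGraph.finite_subE hP
  have := Fintype.ofFinite (Γ.SubV (Γ.edgeZeros f))
  have := Fintype.ofFinite (Γ.SubE (Γ.edgeZeros f))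
  have hmeet := MetricGraph.nodal_piece_meets hlam0 hsol hk hreal hlen
  have hbetti : (Γ.nodalGraph f).betti = 0 :=
    (Γ.nodalSubdivision f).betti_cut_eq_zero (B := Γ.nodalSet f) hmeet
  refine ⟨toFinite _, hbetti, ?_⟩
  have hdeg : ∀ v ∈ Γ.nodalSet f, (Γ.nodalSubdivision f).degree v = 2 := by
    rintro (v | p) hv
    · exact (MetricGraph.degree_subdivide_inl hP v).trans
        (MetricGraph.degree_eq_two_of_vanishesAt hΓ hlam0.le hf hgen (hv v rfl))
    · exact MetricGraph.degree_subdivide_inr hP p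
  obtain ⟨S, hS1, hS2, hS3, hev⟩ := MetricGraph.exists_dtn_counting (Γ := Γ.nodalSubdivision f)
    (MetricGraph.exists_endVertex_subdivide hP hends) hmeet hlam0
    -- A piece strictly longer than `π/√lam` would have exactly that length by `nodal_piece_length`.
    (fun s => not_lt.1 fun h =>
      h.ne' (MetricGraph.nodal_piece_length hlam0 hsol hreal s h.le).2.2)
    (fun h hh => MetricGraph.len_lt_of_endVertex_notMem hlam0 hsol hk hreal h hh)
    (fun v hv =>
      (MetricGraph.sum_diagCoef_eq_zero hlam0 hsol hk hreal hlen hends hP hv).ge)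
  have hmult : ∀ μ, 0 ≤ μ → (Γ.nodalSubdivision f).mult μ = Γ.mult μ := fun μ hμ =>
    MetricGraph.mult_subdivide hP hμ
  have hfirst : Γ.firstIndex lam = ∑ ν ∈ S, (Γ.nodalSubdivision f).mult ν + 1 := by
    rw [Finset.sum_congr rfl fun ν hν => hmult ν (hS3 ν hν)]
    refine MetricGraph.firstIndex_eq (fun μ hμ hne => ?_) hS2 (MetricGraph.mult_ne_zero hlam0.le hf)
    -- The list of eigenvalues ranges over all reals, whereas `S` was built from `0` upwards.
    have hμ0 : 0 ≤ μ := by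
      by_contra hneg
      rw [MetricGraph.mult, MetricGraph.eigenspace_eq_bot_of_neg (not_le.1 hneg),
        finrank_bot] at hne
      exact hne rfl
    exact hS1 μ hμ0 hμ ((hmult μ hμ0).trans_ne hne)
  have euler := Γ.betti_add_card
  have euler' := ((Γ.nodalSubdivision f).cut (Γ.nodalSet f)).betti_add_card
  have hcut := (Γ.nodalSubdivision f).card_cut_vertices hdeg
  have hsubE := MetricGraph.card_subE hP
  have hsubV : Nat.card (Γ.SubV (Γ.edgeZeros f)) =
    Nat.card V + Nat.card (Γ.InnerPt (Γ.edgeZeros f)) := Nat.card_sum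
  have hconn : Γ.numComponents = 1 := hΓ
  change (Γ.nodalGraph f).betti + _ = _ + Γ.numNodalDomains f at euler'
  filter_upwards [hev] with ε hε
  obtain ⟨Λ, hΛ, hcount⟩ := hε
  refine ⟨Λ, hΛ, ?_⟩
  -- With `B` the nodal set and `N` the sum over `S`: the cut graph gives `ν₀ = |V| + |B| - |E|`,
  -- connectedness gives `|V| - |E| = 1 - β`, and the count gives `Pos Λ = |B| - N` with `firstIndex
  -- = N + 1`. The inner points cancel between vertices and pieces.
  omega
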